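/- Let $n,m\ge 1$, $\gamma>0$, $z=(x,y)\in\mathbb R^n\times\mathbb R^m$, $\nabla_\gamma u=(\nabla_x u,(1+\gamma)|x|^{\gamma}\nabla_y u)$ and $\Delta_\gamma=\Delta_x+(1+\gamma)^2|x|^{2\gamma}\Delta_y$. Put $Q=n+(1+\gamma)m$ and $2_\gamma^*=\frac{2Q}{Q-2}$. Let $\Omega\subset\mathbb R^{n+m}$ be a bounded domain, and let $H=H^1_{0,\gamma}(\Omega)$ be the completion of $C_c^\infty(\Omega)$ for the norm $\|u\|^2=\int_\Omega|\nabla_\gamma u|^2\,dz$. Let $$S=\inf_{0\ne w\in H}\ \|w\|^2\Big/\Big(\int_\Omega|w|^{2_\gamma^*}dz\Big)^{2/2_\gamma^*}.$$ Let $\delta>0$, $\lambda>0$, $p\ge1$. Let $u_0\in H^1_{\gamma,\mathrm{loc}}(\Omega)\cap C(\Omega)$ be a solution of $-\Delta_\gamma u_0=u_0^{-\delta}$ in $\Omega$ in the sense of distributions, with $u_0>0$ in $\Omega$ and $u_0=0$ on $\partial\Omega$ in the sense that $(u_0-\varepsilon)^+\in H$ for every $\varepsilon>0$. Define $g(z,s)=u_0(z)^{-\delta}-(s+u_0(z))^{-\delta}$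 if $s+u_0(z)>0$, $g(z,s)=-\infty$ otherwise, and $G(z,s)=\int_0^s g(z,\tau)\,d\tau$. Let $u\in H$ be a positive weak solution of the translated problem $$-\Delta_\gamma u+g(z,u)=\lambda(u+u_0)^p\ \text{ in }\Omega,\qquad u=0\ \text{ on }\partial\Omega,$$ that is, $u>0$ a.e. in $\Omega$, $g(\cdot,u)\in L^1_{\mathrm{loc}}(\Omega)$, and the equation holds in the sense of distributions. Let $K_u=\{v\in H: v\ge u\text{ a.e. in }\Omega\}$, and define $I_{K_u}:H\to(-\infty,\infty]$ by $$I_{K_u}(v)=\frac12\int_\Omega|\nabla_\gamma v|^2dz+\int_\Omega G(z,v)\,dz-\frac{\lambda}{p+1}\int_\Omega|v+u_0|^{p+1}dz$$ if $v\in K_u$, $G(\cdot,v)\in L^1(\Omega)$ and $v\in L^{p+1}(\Omega)$, and $I_{K_u}(v)=\infty$ otherwise. For a functional $I:H\to(-\infty,\infty]$ and $v\in H$ with $I(v)<\infty$ let $$\partial^-I(v)=\Big\{\alpha\in H:\liminf_{w\to v}\frac{I(w)-I(v)-\langle\alpha,w-v\rangle}{\|w-v\|}\ge0\Big\},$$ and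 let $|||\partial^-I(v)|||$ be the least norm of an element of $\partial^-I(v)$ ($\infty$ if $\partial^-I(v)=\varnothing$). We say that $I$ satisfies $(\mathrm{CPS})_c$, $c\in\mathbb R$, if $I$ is proper and lower semicontinuous and every sequence $(v_k)$ in $\{I<\infty\}$ with $I(v_k)\to c$ and $(1+\|v_k\|)\,|||\partial^-I(v_k)|||\to0$ has a subsequence that converges in $H$. Then: 1. (Subcritical case) if $p<2_\gamma^*-1$, then $I_{K_u}$ satisfies $(\mathrm{CPS})_c$ for every $c\in\mathbb R$; 2. (Critical case) if $p=2_\gamma^*-1$, then $I_{K_u}$ satisfies $(\mathrm{CPS})_c$ for every $c\in\mathbb R$ with $$c<I_{K_u}(u)+\frac{S^{Q/2}}{Q\,\lambda^{(Q-2)/2}}.$$ -/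

import Mathlib

open MeasureTheory Filter Topology Set
open scoped ENNReal ContDiff

noncomputable section

namespace Grushin

/-! ### General nonsmooth analysis on a (semi)normed inner product space -/

section Nonsmooth

variable {H : Type*} [SeminormedAddCommGroup H] [InnerProductSpace ℝ H]

/-- The effective domain `{u : I u < ∞}`. -/
def effDomain (I : H → EReal) : Set H := {u | I u < ⊤}

/-- `I` takes values in `(-∞, ∞]` and is not identically `∞`. -/
def IsProper (I : H → EReal) : Prop := (∀ u, I u ≠ ⊥) ∧ (effDomain I).Nonempty

/-- The Fréchet subdifferential of `I` at a point `u` of its effective domain: all `α` with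
`liminf_{v → u} (I v - I u - ⟪α, v - u⟫) / ‖v - u‖ ≥ 0`, written with `ε`. -/
def frechetSubdiff (I : H → EReal) (u : H) : Set H :=
  {α | u ∈ effDomain I ∧ ∀ ε : ℝ, 0 < ε → ∀ᶠ v in 𝓝 u,
    (((I u).toReal + inner ℝ α (v - u) - ε * ‖v - u‖ : ℝ) : EReal) ≤ I v}

/-- The least norm of an element of the subdifferential; it is `∞` if there is none. -/
def subdiffNorm (I : H → EReal) (u : H) : ℝ≥0∞ := ⨅ α ∈ frechetSubdiff I u, ‖α‖ₑ

/-- The Cerami condition at level `c`, for a proper lower semicontinuous functional. -/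
structure CeramiCondition (I : H → EReal) (c : ℝ) : Prop where
  proper : IsProper I
  lowerSemicontinuous : LowerSemicontinuous I
  exists_subseq : ∀ w : ℕ → H, (∀ k, w k ∈ effDomain I) →
    Tendsto (fun k => I (w k)) atTop (𝓝 (c : EReal)) →
    Tendsto (fun k => (1 + ‖w k‖ₑ) * subdiffNorm I (w k)) atTop (𝓝 0) →
    ∃ (v : H) (κ : ℕ → ℕ), StrictMono κ ∧ Tendsto (fun k => w (κ k)) atTop (𝓝 v)

end Nonsmooth

/-! ### The Grushin gradient and the space of functions vanishing on the boundary -/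

/-- Points `z = (x, y)` of `ℝⁿ × ℝᵐ`. -/
abbrev Pt (n m : ℕ) : Type := EuclideanSpace ℝ (Fin n) × EuclideanSpace ℝ (Fin m)

/-- Values of gradients: `ℝⁿ × ℝᵐ` with its Euclidean norm. -/
abbrev Vec (n m : ℕ) : Type :=
  WithLp 2 (EuclideanSpace ℝ (Fin n) × EuclideanSpace ℝ (Fin m))

/-- The homogeneous dimension `Q = n + (1 + γ) m` of the dilations `(t x, t ^ (1 + γ) y)`. -/
def homDim (n m : ℕ) (γ : ℝ) : ℝ := n + (1 + γ) * m

/-- The critical exponent `2 Q / (Q - 2)`. -/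
def critExp (n m : ℕ) (γ : ℝ) : ℝ := 2 * homDim n m γ / (homDim n m γ - 2)

variable {n m : ℕ}

/-- `φ ∈ C_c^∞(Ω)`, extended by zero. -/
structure IsTest (Ω : Set (Pt n m)) (φ : Pt n m → ℝ) : Prop where
  contDiff : ContDiff ℝ ∞ φ
  hasCompactSupport : HasCompactSupport φ
  tsupport_subset : tsupport φ ⊆ Ω

/-- The pointwise Grushin gradient `(∇ₓ φ, (1 + γ) |x| ^ γ ∇_y φ)`. -/
def gradTest (γ : ℝ) (φ : Pt n m → ℝ) (z : Pt n m) : Vec n m :=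
  WithLp.toLp 2 (gradient (fun x => φ (x, z.2)) z.1,
    ((1 + γ) * ‖z.1‖ ^ γ) • gradient (fun y => φ (z.1, y)) z.2)

/-- The closure in `L²(Ω) × L²(Ω; ℝⁿ × ℝᵐ)` of the set of pairs `(φ, ∇_γ φ)`, `φ ∈ C_c^∞(Ω)`. -/
def graphClosure (γ : ℝ) (Ω : Set (Pt n m)) :
    Submodule ℝ (Lp ℝ 2 (volume.restrict Ω) × Lp (Vec n m) 2 (volume.restrict Ω)) :=
  (Submodule.span ℝ {q | ∃ φ : Pt n m → ℝ, IsTest Ω φ ∧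
    q.1 =ᵐ[volume.restrict Ω] φ ∧ q.2 =ᵐ[volume.restrict Ω] gradTest γ φ}).topologicalClosure

/-- The space `H¹_{0,γ}(Ω)`: the functions `u ∈ L²(Ω)` for which there are `φ_k ∈ C_c^∞(Ω)` with
`φ_k → u` and `∇_γ φ_k → ∇_γ u` in `L²(Ω)`, stored together with `∇_γ u`. The inner product is
`∫_Ω ∇_γ u · ∇_γ v`. When `Ω` is bounded and `n ≥ 1`, Poincaré's inequality in a direction of `x`
makes the norm `‖∇_γ u‖` equivalent to the graph norm, so that this is the completion of
`C_c^∞(Ω)` for the norm `‖∇_γ φ‖`. -/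
def H10 (γ : ℝ) (Ω : Set (Pt n m)) : Type := graphClosure γ Ω

namespace H10

variable {γ : ℝ} {Ω : Set (Pt n m)}

instance : AddCommGroup (H10 γ Ω) := inferInstanceAs (AddCommGroup (graphClosure γ Ω))

instance : Module ℝ (H10 γ Ω) := inferInstanceAs (Module ℝ (graphClosure γ Ω))

/-- The function `u` as an element of `L²(Ω)`. -/
def toL2 : H10 γ Ω →ₗ[ℝ] Lp ℝ 2 (volume.restrict Ω) :=
  (LinearMap.fst ℝ _ _).comp (graphClosure γ Ω).subtype

/-- The Grushin gradient `∇_γ u` as an element of `L²(Ω; ℝⁿ × ℝᵐ)`. -/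
def grad : H10 γ Ω →ₗ[ℝ] Lp (Vec n m) 2 (volume.restrict Ω) :=
  (LinearMap.snd ℝ _ _).comp (graphClosure γ Ω).subtype

instance : CoeFun (H10 γ Ω) (fun _ => Pt n m → ℝ) := ⟨fun u => (toL2 u : Pt n m → ℝ)⟩

instance : SeminormedAddCommGroup (H10 γ Ω) :=
  SeminormedAddCommGroup.induced (H10 γ Ω) (Lp (Vec n m) 2 (volume.restrict Ω)) grad

instance : InnerProductSpace ℝ (H10 γ Ω) where
  norm_smul_le a u := by
    change ‖grad (a • u)‖ ≤ ‖a‖ * ‖grad u‖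
    rw [map_smul, norm_smul]
  inner u v := inner ℝ (grad u) (grad v)
  norm_sq_eq_re_inner u := norm_sq_eq_re_inner (𝕜 := ℝ) (grad u)
  conj_inner_symm u v := inner_conj_symm (𝕜 := ℝ) (grad u) (grad v)
  add_left u v w := by
    change inner ℝ (grad (u + v)) (grad w) = inner ℝ (grad u) (grad w) + inner ℝ (grad v) (grad w)
    rw [map_add, inner_add_left]
  smul_left u v a := by
    change inner ℝ (grad (a • u)) (grad v) = _ * inner ℝ (grad u) (grad v)
    rw [map_smul, inner_smul_left]

end H10

/-- The Sobolev constant: the infimum of `‖∇_γ w‖₂² / ‖w‖_{2*}²` over nonzero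
`w ∈ H¹_{0,γ}(Ω)`. -/
def sobolevConst (γ : ℝ) (Ω : Set (Pt n m)) : ℝ :=
  sInf {r | ∃ w : H10 γ Ω, ¬ (w =ᵐ[volume.restrict Ω] 0) ∧
    r = ‖w‖ ^ 2 / (∫ z in Ω, |w z| ^ critExp n m γ) ^ (2 / critExp n m γ)}

/-! ### The purely singular problem -/

/-- `U` is the weak Grushin gradient of `u` on `Ω`, and `u`, `U` are locally square integrable
in `Ω`: the statement `u ∈ H¹_{γ,loc}(Ω)` with `∇_γ u = U`. -/
structure IsLocWeakGrad (γ : ℝ) (Ω : Set (Pt n m)) (u : Pt n m → ℝ) (U : Pt n m → Vec n m) :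
    Prop where
  memLp : ∀ K ⊆ Ω, IsCompact K → MemLp u 2 (volume.restrict K)
  memLp_grad : ∀ K ⊆ Ω, IsCompact K → MemLp U 2 (volume.restrict K)
  parts : ∀ φ : Pt n m → ℝ, IsTest Ω φ →
    ∫ z in Ω, u z • gradTest γ φ z = - ∫ z in Ω, φ z • U z

/-- `u₀` is a continuous weak solution of `-Δ_γ u₀ = u₀ ^ (-δ)`, `u₀ > 0` in `Ω`, `u₀ = 0` on
`∂Ω`. The boundary condition means that `(u₀ - ε)⁺ ∈ H¹_{0,γ}(Ω)` for every `ε > 0`. -/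
structure IsSingularSolution (γ δ : ℝ) (Ω : Set (Pt n m)) (u₀ : Pt n m → ℝ) : Prop where
  continuousOn : ContinuousOn u₀ Ω
  pos : ∀ z ∈ Ω, 0 < u₀ z
  boundary : ∀ ε : ℝ, 0 < ε → ∃ w : H10 γ Ω,
    w =ᵐ[volume.restrict Ω] fun z => max (u₀ z - ε) 0
  equation : ∃ U : Pt n m → Vec n m, IsLocWeakGrad γ Ω u₀ U ∧
    ∀ φ : Pt n m → ℝ, IsTest Ω φ →
      ∫ z in Ω, inner ℝ (U z) (gradTest γ φ z) = ∫ z in Ω, u₀ z ^ (-δ) * φ z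

/-! ### The translated problem and its functional -/

/-- `g(z, s) = u₀(z) ^ (-δ) - (s + u₀(z)) ^ (-δ)` if `s + u₀(z) > 0`, and `-∞` otherwise. -/
def gFun (δ : ℝ) (u₀ : Pt n m → ℝ) (z : Pt n m) (s : ℝ) : EReal :=
  if 0 < s + u₀ z then ((u₀ z ^ (-δ) - (s + u₀ z) ^ (-δ) : ℝ) : EReal) else ⊥

/-- `G(z, s) = ∫₀ˢ g(z, τ) dτ ∈ [0, ∞]`. For `s < 0` this is `∫ₛ⁰ (-g(z, τ)) dτ`. Where
`u₀(z) > 0` and `δ > 0`, one has `g(z, τ) ≥ 0` for `τ ≥ 0` and `g(z, τ) ≤ 0` for `τ ≤ 0`, so that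
both integrands are nonnegative. -/
def GFun (δ : ℝ) (u₀ : Pt n m → ℝ) (z : Pt n m) (s : ℝ) : ℝ≥0∞ :=
  if 0 ≤ s then ∫⁻ τ in Ioc 0 s, (gFun δ u₀ z τ).toENNReal
  else ∫⁻ τ in Ioc s 0, (-gFun δ u₀ z τ).toENNReal

variable {γ : ℝ} {Ω : Set (Pt n m)}

/-- `u` is a positive weak solution of `-Δ_γ u + g(z, u) = λ (u + u₀) ^ p` in `Ω`, `u = 0` on
`∂Ω`. -/
structure IsPositiveWeakSolution (δ lam p : ℝ) (u₀ : Pt n m → ℝ) (u : H10 γ Ω) : Prop where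
  pos : ∀ᵐ z ∂volume.restrict Ω, 0 < u z
  locallyIntegrable : LocallyIntegrableOn (fun z => (gFun δ u₀ z (u z)).toReal) Ω
  equation : ∀ φ : Pt n m → ℝ, IsTest Ω φ →
    (∫ z in Ω, inner ℝ (u.grad z) (gradTest γ φ z)) +
      ∫ z in Ω, (gFun δ u₀ z (u z)).toReal * φ z =
    lam * ∫ z in Ω, (u z + u₀ z) ^ p * φ z

open Classical in
/-- The energy `I(v) = ½ ∫ |∇_γ v|² + ∫ G(z, v) - λ / (p + 1) ∫ |v + u₀| ^ (p + 1)` if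
`G(·, v) ∈ L¹(Ω)` and `v ∈ L^{p+1}(Ω)`, and `∞` otherwise. -/
def energy (δ lam p : ℝ) (u₀ : Pt n m → ℝ) (v : H10 γ Ω) : EReal :=
  if ∫⁻ z in Ω, GFun δ u₀ z (v z) < ⊤ ∧ MemLp v (ENNReal.ofReal (p + 1)) (volume.restrict Ω) then
    ((1 / 2 * ‖v‖ ^ 2 + (∫⁻ z in Ω, GFun δ u₀ z (v z)).toReal
      - lam / (p + 1) * ∫ z in Ω, |v z + u₀ z| ^ (p + 1) : ℝ) : EReal)
  else ⊤

open Classical in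
/-- The constrained functional `I_K`. -/
def constrainedEnergy (δ lam p : ℝ) (u₀ : Pt n m → ℝ) (K : Set (H10 γ Ω)) (v : H10 γ Ω) :
    EReal :=
  if v ∈ K then energy δ lam p u₀ v else ⊤

/-- `K_u = {v ∈ H¹_{0,γ}(Ω) : v ≥ u a.e. in Ω}`. -/
def aboveSet (u : H10 γ Ω) : Set (H10 γ Ω) := {v | u ≤ᵐ[volume.restrict Ω] v}

end Grushin

end

/-! Let (v_k) be a Cerami sequence with subgradients α_k. Everything rests on one comparison of
energies with the fixed solution u. Since v ≥ u, a subgradient at v may be tested in the direction v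
- u, along which the singular term has a finite upper slope, and the equation for u may be tested
with v - u ≥ 0. Half the difference of the two is the trapezoid rule for the derivative of the
energy between u and v. This rule is exact for the quadratic part. It errs with one sign in the
singular part, because g is concave in s, and with the favourable sign in the power part, because t
↦ t ^ p is convex. This gives `gap_le`: I(v) - I(u) is at least ½⟨α, v - u⟩ plus two nonnegative
integrals, those of `singularGap` and λ `powerGap`. Along a Cerami sequence the inner product tends
to 0, so both gaps stay bounded.

Boundedness. If p > 1, the power gap dominates a positive multiple of |v + u₀| ^ (p + 1) up to a
fixed function, so the power term is bounded and the energy bounds the norm. If p = 1, the power gap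
carries no information, but the singular gap grows linearly in v (`le_GReal_sub_trapezoid`). If the
norms were unbounded, a limit w ≥ 0 of normalized terms would satisfy ∫ (u + u₀)^(-δ) w ≤ 0, hence w
= 0; compactness in L² then contradicts the energy bound divided by the square of the norm.

Compactness. Let v be the weak limit of a subsequence. The variational inequality with competitor v,
with Fatou's lemma for the singular term, gives ‖v_k - v‖² ≤ λ ∫ |v_k + u₀| ^ p (v_k - v) + o(1). In
the subcritical case the right side tends to 0. In the critical case Brezis–Lieb arguments show that
it equals λ ∫ |v_k - v| ^ 2* + o(1), and that the power gap of v_k exceeds that of v by (1/2 - 1/2*)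
∫ |v_k - v| ^ 2* + o(1), where 1/2 - 1/2* = 1/Q. If B is the limit of ∫ |v_k - v| ^ 2*, then S
B^(2/2*) ≤ λ B, and the gap inequality gives λ B / Q ≤ c - I(u). A positive B is at least
(S/λ)^(Q/2), which contradicts the bound on c; so B = 0 and convergence is strong.

The function space is built from scratch. The Sobolev inequality comes from an isoperimetric
estimate by slices in x and in y (`volume_le_of_slices`), which yields a weak-type L¹ inequality,
and then from truncation at dyadic levels. Rellich's theorem combines smallness on a strip around x
= 0, by Sobolev, with translation estimates away from it. Testing the distributional equation with
nonnegative elements of `H10` uses smooth substitutes for the minimum of two test functions. -/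

namespace Grushin

/-! ### Inequalities in one variable -/

section OneVariable

/-- The trapezoid rule overestimates the integral of a convex function. -/
lemma integral_le_trapezoid {f : ℝ → ℝ} {a b : ℝ} (hab : a ≤ b) (hf : ConvexOn ℝ (Icc a b) f)
    (hc : ContinuousOn f (Icc a b)) :
    ∫ x in a..b, f x ≤ 1 / 2 * (f a + f b) * (b - a) := by
  rcases hab.eq_or_lt with rfl | hlt
  · simp
  have hpos : 0 < b - a := sub_pos.2 hlt
  have hchord : ∀ x ∈ Icc a b, f x ≤ (b - x) / (b - a) * f a + (x - a) / (b - a) * f b := by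
    intro x hx
    have h := hf.2 (left_mem_Icc.2 hab) (right_mem_Icc.2 hab)
      (div_nonneg (sub_nonneg.2 hx.2) hpos.le) (div_nonneg (sub_nonneg.2 hx.1) hpos.le)
      (by field_simp; ring)
    simp only [smul_eq_mul] at h
    rwa [show (b - x) / (b - a) * a + (x - a) / (b - a) * b = x by field_simp; ring] at h
  have hint : ∫ x in a..b, ((b - x) / (b - a) * f a + (x - a) / (b - a) * f b) =
      1 / 2 * (f a + f b) * (b - a) := by
    have : ∀ x : ℝ, (b - x) / (b - a) * f a + (x - a) / (b - a) * f b =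
        (f b - f a) / (b - a) * x + (b * f a - a * f b) / (b - a) := by
      intro x; field_simp; ring
    simp_rw [this]
    rw [intervalIntegral.integral_add (Continuous.intervalIntegrable (by fun_prop) _ _) (by simp),
      intervalIntegral.integral_const_mul, integral_id, intervalIntegral.integral_const]
    simp only [smul_eq_mul]
    field_simp
    ring
  rw [← hint]
  refine intervalIntegral.integral_mono_on hab (hc.intervalIntegrable_of_Icc hab) ?_ hchord
  exact Continuous.intervalIntegrable (by fun_prop) _ _

/-- Here x ^ (-δ) = exp (-δ log x) is the increasing convex exponential of a convex function. -/
lemma convexOn_rpow_neg {δ : ℝ} (hδ : 0 < δ) : ConvexOn ℝ (Ioi (0 : ℝ)) fun x => x ^ (-δ) := by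
  refine ⟨convex_Ioi 0, fun x hx y hy a b ha hb hab => ?_⟩
  have hx' : 0 < x := hx
  have hy' : 0 < y := hy
  have hxy : 0 < a • x + b • y := (convex_Ioi (0 : ℝ)) hx hy ha hb hab
  have h1 := strictConcaveOn_log_Ioi.concaveOn.2 hx hy ha hb hab
  have h2 := convexOn_exp.2 (mem_univ (Real.log x * -δ)) (mem_univ (Real.log y * -δ)) ha hb hab
  simp only [smul_eq_mul] at h1 h2 hxy ⊢
  rw [Real.rpow_def_of_pos hxy, Real.rpow_def_of_pos hx', Real.rpow_def_of_pos hy']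
  refine le_trans (Real.exp_le_exp.2 ?_) h2
  nlinarith

/-- A power function lies above its tangents. -/
lemma rpow_tangent_le {q : ℝ} (hq : 1 ≤ q) {x y : ℝ} (hx : 0 ≤ x) (hy : 0 ≤ y) :
    x ^ q + q * x ^ (q - 1) * (y - x) ≤ y ^ q := by
  rcases hx.eq_or_lt with rfl | hx
  · rcases hq.eq_or_lt with rfl | hq1
    · simp
    · rw [Real.zero_rpow (by linarith), Real.zero_rpow (by linarith)]
      simpa using Real.rpow_nonneg hy q
  -- Bernoulli's inequality for y / x = 1 + s, to be multiplied by x ^ q.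
  · have h := one_add_mul_self_le_rpow_one_add (s := y / x - 1) (p := q) (by
      have := div_nonneg hy hx.le; linarith) hq
    rw [show 1 + (y / x - 1) = y / x by ring, Real.div_rpow hy hx.le,
      le_div_iff₀ (Real.rpow_pos_of_pos hx q)] at h
    have e : x ^ q = x * x ^ (q - 1) := by
      rw [mul_comm, ← Real.rpow_add_one hx.ne']; ring_nf
    calc x ^ q + q * x ^ (q - 1) * (y - x) = (1 + q * (y / x - 1)) * x ^ q := by
          rw [e]; field_simp
      _ ≤ y ^ q := h

/-- The tangent at the larger of the two points bounds the increment. -/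
lemma abs_rpow_sub_rpow_le {q : ℝ} (hq : 1 ≤ q) {x y : ℝ} (hx : 0 ≤ x) (hy : 0 ≤ y) :
    |x ^ q - y ^ q| ≤ q * max x y ^ (q - 1) * |x - y| := by
  rcases le_total x y with h | h
  · rw [max_eq_right h, abs_sub_comm, abs_sub_comm x, abs_of_nonneg
      (sub_nonneg.2 (Real.rpow_le_rpow hx h (by linarith))), abs_of_nonneg (sub_nonneg.2 h)]
    linarith [rpow_tangent_le hq hy hx]
  · rw [max_eq_left h, abs_of_nonneg
      (sub_nonneg.2 (Real.rpow_le_rpow hy h (by linarith))), abs_of_nonneg (sub_nonneg.2 h)]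
    linarith [rpow_tangent_le hq hx hy]

/-- Young's inequality with a small constant. -/
lemma rpow_mul_le_add {p : ℝ} (hp : 0 ≤ p) {η : ℝ} (hη : 0 < η) {x y : ℝ} (hx : 0 ≤ x)
    (hy : 0 ≤ y) : x ^ p * y ≤ η * x ^ (p + 1) + η⁻¹ ^ p * y ^ (p + 1) := by
  have hp1 : p + 1 ≠ 0 := by linarith
  have e : ∀ z : ℝ, 0 ≤ z → z ^ (p + 1) = z ^ p * z := fun z hz => by
    rw [Real.rpow_add' hz hp1, Real.rpow_one]
  -- Where y ≤ η x the first term on the right suffices; otherwise x ≤ η⁻¹ y and the second one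
  -- does.
  rcases le_total y (η * x) with h | h
  · calc x ^ p * y ≤ x ^ p * (η * x) := by gcongr
      _ = η * x ^ (p + 1) := by rw [e x hx]; ring
      _ ≤ _ := by
        have : 0 ≤ η⁻¹ ^ p * y ^ (p + 1) := by positivity
        linarith
  · have h' : x ≤ η⁻¹ * y := by rw [inv_mul_eq_div, le_div_iff₀ hη]; linarith
    calc x ^ p * y ≤ (η⁻¹ * y) ^ p * y := by gcongr
      _ = η⁻¹ ^ p * y ^ (p + 1) := by
        rw [Real.mul_rpow (by positivity) hy, e y hy]; ring
      _ ≤ _ := by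
        have : 0 ≤ η * x ^ (p + 1) := by positivity
        linarith

/-- The elementary inequality behind the Brezis-Lieb lemma. -/
lemma exists_abs_rpow_add_sub_le {q : ℝ} (hq : 1 ≤ q) {ε : ℝ} (hε : 0 < ε) :
    ∃ C : ℝ, 0 ≤ C ∧ ∀ a b : ℝ, |(|a + b| ^ q - |a| ^ q)| ≤ ε * |a| ^ q + C * |b| ^ q := by
  -- The increment is at most q (|a| + |b|)^(q - 1) |b|. For |b| ≤ η |a| with η ≤ 1 this is at most
  -- K η |a| ^ q, and η is chosen with K η ≤ ε. For larger |b| everything is a multiple of |b| ^ q.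
  set K : ℝ := q * 2 ^ (q - 1) with hK
  have hKpos : 0 < K := by positivity
  set η : ℝ := min 1 (ε / K) with hη
  have hηpos : 0 < η := lt_min one_pos (by positivity)
  refine ⟨q * (η⁻¹ + 1) ^ (q - 1), by positivity, fun a b => ?_⟩
  have hq0 : q ≠ 0 := by linarith
  have e : ∀ z : ℝ, 0 ≤ z → z ^ q = z ^ (q - 1) * z := fun z hz => by
    conv_lhs => rw [show q = (q - 1) + 1 by ring]
    rw [Real.rpow_add' hz (by simpa using hq0), Real.rpow_one]
  have h1 : |(|a + b| ^ q - |a| ^ q)| ≤ q * (|a| + |b|) ^ (q - 1) * |b| := by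
    refine (abs_rpow_sub_rpow_le hq (abs_nonneg _) (abs_nonneg _)).trans ?_
    have h2 : max |a + b| |a| ≤ |a| + |b| :=
      max_le (abs_add_le a b) (by linarith [abs_nonneg b])
    have h3 : |(|a + b| - |a|)| ≤ |b| := by
      simpa using abs_abs_sub_abs_le_abs_sub (a + b) a
    have h4 : max |a + b| |a| ^ (q - 1) ≤ (|a| + |b|) ^ (q - 1) :=
      Real.rpow_le_rpow (le_max_of_le_right (abs_nonneg _)) h2 (by linarith)
    gcongr
  refine h1.trans ?_
  rcases le_total |b| (η * |a|) with h | h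
  · have hb : |b| ≤ |a| := h.trans (mul_le_of_le_one_left (abs_nonneg a) (min_le_left _ _))
    have hs : q * (|a| + |b|) ^ (q - 1) * |b| ≤ ε * |a| ^ q := by
      have h5 : (|a| + |b|) ^ (q - 1) ≤ (2 * |a|) ^ (q - 1) :=
        Real.rpow_le_rpow (by positivity) (by linarith) (by linarith)
      calc q * (|a| + |b|) ^ (q - 1) * |b| ≤ q * (2 * |a|) ^ (q - 1) * (η * |a|) := by gcongr
        _ = K * η * |a| ^ q := by
          rw [Real.mul_rpow (by norm_num) (abs_nonneg a), e _ (abs_nonneg a), hK]; ring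
        _ ≤ ε * |a| ^ q := by
          gcongr
          calc K * η ≤ K * (ε / K) := by gcongr; exact min_le_right _ _
            _ = ε := by field_simp
    have : 0 ≤ q * (η⁻¹ + 1) ^ (q - 1) * |b| ^ q := by positivity
    linarith
  · have ha : |a| ≤ η⁻¹ * |b| := by rw [inv_mul_eq_div, le_div_iff₀ hηpos]; linarith
    have h5 : (|a| + |b|) ^ (q - 1) ≤ ((η⁻¹ + 1) * |b|) ^ (q - 1) :=
      Real.rpow_le_rpow (by positivity) (by linarith) (by linarith)
    have : q * (|a| + |b|) ^ (q - 1) * |b| ≤ q * (η⁻¹ + 1) ^ (q - 1) * |b| ^ q := by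
      calc q * (|a| + |b|) ^ (q - 1) * |b| ≤ q * ((η⁻¹ + 1) * |b|) ^ (q - 1) * |b| := by gcongr
        _ = _ := by
          rw [Real.mul_rpow (by positivity) (abs_nonneg b), e _ (abs_nonneg b)]; ring
    have : 0 ≤ ε * |a| ^ q := by positivity
    linarith

/-- The trapezoid rule for a power. -/
lemma rpow_trapezoid {p : ℝ} (hp : 1 ≤ p) {a b : ℝ} (ha : 0 ≤ a) (hab : a ≤ b) :
    (b ^ (p + 1) - a ^ (p + 1)) / (p + 1) ≤ 1 / 2 * (a ^ p + b ^ p) * (b - a) := by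
  have h := integral_le_trapezoid (f := fun x => x ^ p) hab
    ((convexOn_rpow hp).subset (fun x hx => ha.trans hx.1) (convex_Icc a b))
    (fun x _ => (Real.continuousAt_rpow_const x p (Or.inr (by linarith))).continuousWithinAt)
  rwa [integral_rpow (Or.inl (by linarith))] at h

/-! ### The singular term as a real function -/

/-- The real value of `g(z, s)` where `u₀ z = a`. -/
noncomputable def gReal (δ a s : ℝ) : ℝ := a ^ (-δ) - (s + a) ^ (-δ)

/-- The real value of `G(z, s)` where `u₀ z = a`. -/
noncomputable def GReal (δ a s : ℝ) : ℝ := ∫ τ in (0 : ℝ)..s, gReal δ a τ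

variable {δ a s : ℝ}

lemma continuousOn_gReal (ha : 0 < a) : ContinuousOn (gReal δ a) (Ici 0) := by
  intro x hx
  have hx : 0 ≤ x := hx
  have : x + a ≠ 0 := by linarith
  unfold gReal
  refine ContinuousWithinAt.sub continuousWithinAt_const ?_
  exact ((continuousAt_id.add continuousAt_const).rpow_const (Or.inl this)).continuousWithinAt

lemma gReal_mono (hδ : 0 < δ) (ha : 0 < a) {t : ℝ} (hs : 0 ≤ s) (hst : s ≤ t) :
    gReal δ a s ≤ gReal δ a t := by
  have := Real.rpow_le_rpow_of_nonpos (z := -δ) (x := s + a) (y := t + a) (by linarith)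
    (by linarith) (by linarith)
  unfold gReal; linarith

lemma gReal_nonneg (hδ : 0 < δ) (ha : 0 < a) (hs : 0 ≤ s) : 0 ≤ gReal δ a s := by
  have h := gReal_mono hδ ha le_rfl hs
  simpa [gReal] using h

/-- Concavity in s and the value 0 at s = 0: s + a is the convex combination of c s + a and a with
weights 1 / c and 1 - 1 / c. -/
lemma gReal_mul_le (hδ : 0 < δ) (ha : 0 < a) (hs : 0 ≤ s) {c : ℝ} (hc : 1 ≤ c) :
    gReal δ a (c * s) ≤ c * gReal δ a s := by
  have hc0 : 0 < c := by linarith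
  have h := (convexOn_rpow_neg hδ).2 (x := c * s + a) (by simp; positivity) (y := a) ha
    (show (0 : ℝ) ≤ 1 / c by positivity)
    (show 0 ≤ 1 - 1 / c by rw [sub_nonneg, div_le_one hc0]; exact hc) (by ring)
  simp only [smul_eq_mul] at h
  rw [show 1 / c * (c * s + a) + (1 - 1 / c) * a = s + a by field_simp; ring] at h
  have h2 := mul_le_mul_of_nonneg_left h hc0.le
  rw [show c * (1 / c * (c * s + a) ^ (-δ) + (1 - 1 / c) * a ^ (-δ)) =
    (c * s + a) ^ (-δ) + (c - 1) * a ^ (-δ) by field_simp] at h2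
  unfold gReal
  linarith

lemma intervalIntegrable_gReal (ha : 0 < a) {t : ℝ} (hs : 0 ≤ s) (ht : 0 ≤ t) :
    IntervalIntegrable (gReal δ a) volume s t :=
  ((continuousOn_gReal ha).mono fun _ hx => (le_min hs ht).trans hx.1).intervalIntegrable

lemma GReal_sub (ha : 0 < a) {t : ℝ} (hs : 0 ≤ s) (ht : 0 ≤ t) :
    GReal δ a t - GReal δ a s = ∫ τ in s..t, gReal δ a τ :=
  intervalIntegral.integral_interval_sub_left (intervalIntegrable_gReal ha le_rfl ht)
    (intervalIntegrable_gReal ha le_rfl hs)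

lemma GReal_nonneg (hδ : 0 < δ) (ha : 0 < a) (hs : 0 ≤ s) : 0 ≤ GReal δ a s :=
  intervalIntegral.integral_nonneg hs fun _ hx => gReal_nonneg hδ ha hx.1

lemma GReal_sub_le (hδ : 0 < δ) (ha : 0 < a) {t : ℝ} (hs : 0 ≤ s) (hst : s ≤ t) :
    GReal δ a t - GReal δ a s ≤ gReal δ a t * (t - s) := by
  rw [GReal_sub ha hs (hs.trans hst)]
  have h := intervalIntegral.integral_mono_on hst
    (intervalIntegrable_gReal (δ := δ) ha hs (hs.trans hst))
    (intervalIntegrable_const (c := gReal δ a t)) fun x hx =>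
    gReal_mono hδ ha (hs.trans hx.1) hx.2
  simpa [mul_comm] using h

lemma le_GReal_sub (hδ : 0 < δ) (ha : 0 < a) {t : ℝ} (hs : 0 ≤ s) (hst : s ≤ t) :
    gReal δ a s * (t - s) ≤ GReal δ a t - GReal δ a s := by
  rw [GReal_sub ha hs (hs.trans hst)]
  have h := intervalIntegral.integral_mono_on hst
    (intervalIntegrable_const (c := gReal δ a s))
    (intervalIntegrable_gReal (δ := δ) ha hs (hs.trans hst)) fun x hx =>
    gReal_mono hδ ha hs hx.1
  simpa [mul_comm] using h

/-- `G` lies above its tangents. -/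
lemma GReal_tangent_le (hδ : 0 < δ) (ha : 0 < a) {t : ℝ} (hs : 0 ≤ s) (ht : 0 ≤ t) :
    GReal δ a s + gReal δ a s * (t - s) ≤ GReal δ a t := by
  rcases le_total s t with h | h
  · linarith [le_GReal_sub hδ ha hs h]
  · linarith [GReal_sub_le hδ ha ht h]

/-- Average the tangent inequalities based at the intermediate point, evaluated at the two ends,
with weights θ and 1 - θ. -/
lemma GReal_convex (hδ : 0 < δ) (ha : 0 < a) {t θ : ℝ} (hs : 0 ≤ s) (ht : 0 ≤ t)
    (h0 : 0 ≤ θ) (h1 : θ ≤ 1) :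
    GReal δ a (s + θ * (t - s)) ≤ GReal δ a s + θ * (GReal δ a t - GReal δ a s) := by
  have hm : 0 ≤ s + θ * (t - s) := by nlinarith
  have h2 := mul_le_mul_of_nonneg_left (GReal_tangent_le hδ ha hm ht) h0
  have h3 := mul_le_mul_of_nonneg_left (GReal_tangent_le hδ ha hm hs) (sub_nonneg.2 h1)
  linear_combination h2 + h3

/-- The derivative g of G is concave in s, so the trapezoid rule underestimates its integral. This
sign makes `singularGap` nonnegative. -/
lemma GReal_trapezoid (hδ : 0 < δ) (ha : 0 < a) {t : ℝ} (hs : 0 ≤ s) (hst : s ≤ t) :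
    1 / 2 * (gReal δ a s + gReal δ a t) * (t - s) ≤ GReal δ a t - GReal δ a s := by
  rw [GReal_sub ha hs (hs.trans hst)]
  have hsub : Icc s t ⊆ Ici 0 := fun x hx => hs.trans hx.1
  have hconv : ConvexOn ℝ (Icc s t) fun x => -gReal δ a x := by
    refine ⟨convex_Icc s t, fun x hx y hy c d hc hd hcd => ?_⟩
    have hx := hs.trans hx.1
    have hy := hs.trans hy.1
    have h := (convexOn_rpow_neg hδ).2 (x := x + a) (y := y + a)
      (by simp; positivity) (by simp; positivity) hc hd hcd
    simp only [smul_eq_mul, gReal] at h ⊢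
    rw [show c * (x + a) + d * (y + a) = c * x + d * y + a by linear_combination a * hcd] at h
    linear_combination h + a ^ (-δ) * hcd
  have h := integral_le_trapezoid hst hconv ((continuousOn_gReal ha).mono hsub).neg
  rw [intervalIntegral.integral_neg] at h
  linarith

/-- The trapezoid rule on [0, s], where g vanishes at 0. Thus g(v) v is integrable as soon as G(v)
is. -/
lemma gReal_mul_self_le (hδ : 0 < δ) (ha : 0 < a) (hs : 0 ≤ s) :
    gReal δ a s * s ≤ 2 * GReal δ a s := by
  have h := GReal_trapezoid hδ ha le_rfl hs
  simp [gReal, GReal] at h ⊢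
  linarith

lemma GReal_le_gReal_mul (hδ : 0 < δ) (ha : 0 < a) (hs : 0 ≤ s) :
    GReal δ a s ≤ gReal δ a s * s := by
  have h := GReal_sub_le hδ ha le_rfl hs
  simpa [GReal] using h

lemma GReal_mono (hδ : 0 < δ) (ha : 0 < a) {t : ℝ} (hs : 0 ≤ s) (hst : s ≤ t) :
    GReal δ a s ≤ GReal δ a t := by
  have h := le_GReal_sub hδ ha hs hst
  have := mul_nonneg (gReal_nonneg hδ ha hs) (sub_nonneg.2 hst)
  linarith

/-- Growth of `G` along `s ↦ s + θ φ`, `0 ≤ φ ≤ s`. -/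
lemma GReal_add_le (hδ : 0 < δ) (ha : 0 < a) {φ θ : ℝ} (hφ : 0 ≤ φ) (hφs : φ ≤ s)
    (h0 : 0 ≤ θ) :
    GReal δ a (s + θ * φ) ≤ GReal δ a s + θ * (1 + θ) * (gReal δ a s * φ) := by
  have hs : 0 ≤ s := hφ.trans hφs
  have h1 := GReal_sub_le (δ := δ) hδ ha hs (t := s + θ * φ) (by nlinarith)
  -- Since φ ≤ s, the point s + θ φ is at most (1 + θ) s, and g grows at most linearly under
  -- dilation.
  have h2 : gReal δ a (s + θ * φ) ≤ (1 + θ) * gReal δ a s :=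
    (gReal_mono hδ ha (by positivity) (by nlinarith)).trans
      (gReal_mul_le hδ ha hs (by linarith))
  have h3 := mul_le_mul_of_nonneg_right h2 (show 0 ≤ θ * φ by positivity)
  calc GReal δ a (s + θ * φ) ≤ GReal δ a s + gReal δ a (s + θ * φ) * (θ * φ) := by
        linear_combination h1
    _ ≤ _ := by linear_combination h3

/-- The trapezoid error of `G` grows at least linearly. -/
lemma le_GReal_sub_trapezoid (hδ : 0 < δ) (ha : 0 < a) {t : ℝ} (hs : 0 ≤ s) (hst : s ≤ t) :
    1 / 4 * (s + a) ^ (-δ) * (t - s - 4 * 4 ^ (1 / δ) * (s + a)) ≤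
      GReal δ a t - GReal δ a s - 1 / 2 * (gReal δ a s + gReal δ a t) * (t - s) := by
  have htrap := GReal_trapezoid hδ ha hs hst
  set U := s + a with hU
  have hUpos : 0 < U := by linarith
  -- With this m, (m U)^(-δ) = U^(-δ) / 4: at the point r with r + a = m U, g is already within
  -- U^(-δ) / 4 of its limit a^(-δ). If t - s ≤ m U the left side is nonpositive and the plain
  -- trapezoid inequality suffices.
  set m : ℝ := 4 ^ (1 / δ) with hm
  have hm1 : 1 ≤ m := Real.one_le_rpow (by norm_num) (by positivity)
  have hmδ : m ^ (-δ) = 1 / 4 := by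
    rw [hm, ← Real.rpow_mul (by norm_num), show 1 / δ * -δ = -1 by field_simp,
      Real.rpow_neg_one]; norm_num
  have hUδ : 0 < U ^ (-δ) := Real.rpow_pos_of_pos hUpos _
  rcases le_total (t - s) (m * U) with h | h
  · have : 1 / 4 * U ^ (-δ) * (t - s - 4 * m * U) ≤ 0 := by
      apply mul_nonpos_of_nonneg_of_nonpos (by positivity)
      nlinarith [mul_pos (by linarith : 0 < m) hUpos]
    linarith
  -- On [r, t] one has g ≥ a^(-δ) - U^(-δ) / 4, while the mean of g(s) and g(t) is at most a^(-δ) -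
  -- U^(-δ) / 2. The surplus U^(-δ) / 4 per unit length is lost only on [s, r], of length at most m
  -- U.
  · set r := s + (m - 1) * U with hr
    have hsr : s ≤ r := by
      have := mul_nonneg (sub_nonneg.2 hm1) hUpos.le; linarith
    have hrt : r ≤ t := by nlinarith
    have hra : r + a = m * U := by rw [hr, hU]; ring
    have h1 := le_GReal_sub hδ ha hs hsr
    have h2 := le_GReal_sub hδ ha (hs.trans hsr) hrt
    have hgr : gReal δ a r = a ^ (-δ) - 1 / 4 * U ^ (-δ) := by
      rw [gReal, hra, Real.mul_rpow (by positivity) hUpos.le, hmδ]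
    have hgs : gReal δ a s = a ^ (-δ) - U ^ (-δ) := rfl
    have hgt : gReal δ a t ≤ a ^ (-δ) := by
      have : 0 < (t + a) ^ (-δ) := Real.rpow_pos_of_pos (by linarith) _
      unfold gReal; linarith
    rw [hgr] at h2
    rw [hgs] at h1 ⊢
    have h3 := mul_le_mul_of_nonneg_right hgt (sub_nonneg.2 hst)
    have hrs : r - s = (m - 1) * U := by rw [hr]; ring
    have h4 : 0 ≤ U ^ (-δ) * (r - s) := by
      exact mul_nonneg hUδ.le (sub_nonneg.2 hsr)
    have h5 : U ^ (-δ) * (r - s) ≤ U ^ (-δ) * (m * U) := by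
      rw [hrs]; gcongr; linarith
    nlinarith

end OneVariable

end Grushin

namespace Grushin

/-! ### A weak-type Sobolev inequality for the Grushin gradient -/

section WeakType

/-- The isoperimetric estimate for sets whose slices are controlled in both directions. -/
lemma volume_le_of_slices {n m : ℕ} (hn : 1 ≤ n) (hm : 1 ≤ m) {γ : ℝ} (hγ : 0 < γ) :
    ∃ C : ℝ, 0 ≤ C ∧ ∀ E : Set (Pt n m), MeasurableSet E →
      (∀ y, volume {x | (x, y) ∈ E} ≠ ⊤) → ∀ τ : ℝ, 0 < τ →
      (∫⁻ y in {y | volume {x | (x, y) ∈ E} ≠ 0},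
        volume {x | (x, y) ∈ E} ^ (((n : ℝ) - 1) / n)) ≤ ENNReal.ofReal τ →
      (∫⁻ x in {x | volume {y | (x, y) ∈ E} ≠ 0},
        ‖x‖ₑ ^ γ * volume {y | (x, y) ∈ E} ^ (((m : ℝ) - 1) / m)) ≤ ENNReal.ofReal τ →
      volume E ≤ ENNReal.ofReal (C * τ ^ (homDim n m γ / (homDim n m γ - 1))) := by
  have hn0 : (1 : ℝ) ≤ n := by exact_mod_cast hn
  have hm0 : (1 : ℝ) ≤ m := by exact_mod_cast hm
  have : Nonempty (Fin n) := ⟨⟨0, hn⟩⟩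
  set κ : ℝ := (volume (Metric.ball (0 : EuclideanSpace ℝ (Fin n)) 1)).toReal with hκ
  have hκ0 : 0 ≤ κ := ENNReal.toReal_nonneg
  -- Small enough that the ball of radius c ρ in ℝⁿ has volume at most ρ ^ n / 2, half the threshold
  -- that defines a thick slice.
  set c : ℝ := min 1 (1 / (2 * (κ + 1))) with hc
  have hcpos : 0 < c := lt_min one_pos (by positivity)
  have hcκ : c ^ n * κ ≤ 1 / 2 := by
    have h1 : c ^ n ≤ c := pow_le_of_le_one hcpos.le (min_le_left _ _) (by omega)
    have h2 : c ≤ 1 / (2 * (κ + 1)) := min_le_right _ _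
    calc c ^ n * κ ≤ 1 / (2 * (κ + 1)) * (κ + 1) := by gcongr; exact h1.trans h2; linarith
      _ = 1 / 2 := by field_simp
  refine ⟨1 + 2 * c ^ (-γ), by positivity, fun E hE hfin τ hτ hX hY => ?_⟩
  set Q := homDim n m γ with hQ
  have hQ1 : 0 < Q - 1 := by
    rw [hQ, homDim]; nlinarith
  set e : EuclideanSpace ℝ (Fin m) → ℝ≥0∞ := fun y => volume {x | (x, y) ∈ E} with he
  set h : EuclideanSpace ℝ (Fin n) → ℝ≥0∞ := fun x => volume {y | (x, y) ∈ E} with hh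
  have hem : Measurable e := measurable_measure_prodMk_right hE
  have hhm : Measurable h := measurable_measure_prodMk_left hE
  -- Slices are thin or thick according to whether their volume is at most ρ ^ n. At this scale both
  -- parts contribute a multiple of τ ^ (Q / (Q - 1)).
  set ρ : ℝ := τ ^ (1 / (Q - 1)) with hρ
  have hρpos : 0 < ρ := Real.rpow_pos_of_pos hτ _
  set R : ℝ≥0∞ := ENNReal.ofReal (ρ ^ n) with hR
  have hα0 : 0 ≤ ((n : ℝ) - 1) / n := div_nonneg (by linarith) (by linarith)
  have hβ0 : 0 ≤ ((m : ℝ) - 1) / m := div_nonneg (by linarith) (by linarith)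
  set B : Set (EuclideanSpace ℝ (Fin m)) := {y | R < e y} with hB
  have hBm : MeasurableSet B := measurableSet_lt measurable_const hem
  -- the part over thin slices
  have hsplit : volume E ≤ (∫⁻ y in Bᶜ, e y) + ∫⁻ y in B, e y := by
    rw [add_comm, lintegral_add_compl _ hBm, Measure.volume_eq_prod, Measure.prod_apply_symm hE]
    rfl
  have h1 : ∫⁻ y in Bᶜ, e y ≤ ENNReal.ofReal (ρ * τ) := by
    have : ∫⁻ y in Bᶜ, e y ≤ ∫⁻ y in {y | e y ≠ 0},
        ENNReal.ofReal ρ * e y ^ (((n : ℝ) - 1) / n) := by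
      have hs0 : MeasurableSet {y | e y ≠ 0} := hem (measurableSet_singleton 0).compl
      rw [← lintegral_indicator hBm.compl, ← lintegral_indicator hs0]
      refine lintegral_mono fun y => ?_
      by_cases hy : y ∈ Bᶜ
      · rw [indicator_of_mem hy]
        by_cases hy0 : e y = 0
        · simp [hy0]
        · rw [indicator_of_mem (show y ∈ {y | e y ≠ 0} from hy0)]
          have hyR : e y ≤ R := not_lt.1 hy
          have h2 : e y ^ (1 / (n : ℝ)) ≤ ENNReal.ofReal ρ := by
            calc e y ^ (1 / (n : ℝ)) ≤ R ^ (1 / (n : ℝ)) := by gcongr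
              _ = ENNReal.ofReal ρ := by
                rw [hR, ENNReal.ofReal_rpow_of_pos (by positivity), ← Real.rpow_natCast,
                  ← Real.rpow_mul hρpos.le, mul_one_div_cancel (by positivity), Real.rpow_one]
          calc e y = e y ^ (1 / (n : ℝ) + ((n : ℝ) - 1) / n) := by
                rw [show 1 / (n : ℝ) + ((n : ℝ) - 1) / n = 1 by field_simp; ring, ENNReal.rpow_one]
            _ = e y ^ (1 / (n : ℝ)) * e y ^ (((n : ℝ) - 1) / n) := by
              rw [ENNReal.rpow_add_of_nonneg _ _ (by positivity) hα0]
            _ ≤ _ := by gcongr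
      · rw [indicator_of_notMem hy]; exact zero_le
    refine this.trans ?_
    rw [lintegral_const_mul _ (hem.pow_const _), ENNReal.ofReal_mul hρpos.le]
    gcongr
  -- the measure of the set of thick slices
  have hRα : R ^ (((n : ℝ) - 1) / n) = ENNReal.ofReal (ρ ^ ((n : ℝ) - 1)) := by
    rw [hR, ENNReal.ofReal_rpow_of_pos (by positivity), ← Real.rpow_natCast,
      ← Real.rpow_mul hρpos.le, mul_div_cancel₀ _ (by positivity)]
  -- Chebyshev's inequality: on a thick slice the integrand of the first hypothesis is at least ρ ^
  -- (n - 1).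
  have hBvol : volume B ≤ ENNReal.ofReal (τ * ρ ^ (1 - (n : ℝ))) := by
    have h2 : ENNReal.ofReal (ρ ^ ((n : ℝ) - 1)) * volume B ≤ ENNReal.ofReal τ := by
      refine le_trans ?_ hX
      rw [← setLIntegral_const]
      have hsub : B ⊆ {y | e y ≠ 0} := fun y hy => (bot_lt_of_lt hy).ne'
      calc ∫⁻ _ in B, ENNReal.ofReal (ρ ^ ((n : ℝ) - 1))
          ≤ ∫⁻ y in B, e y ^ (((n : ℝ) - 1) / n) := by
            refine setLIntegral_mono (hem.pow_const _) fun y hy => ?_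
            rw [← hRα]
            have hy : R < e y := hy
            gcongr
        _ ≤ _ := lintegral_mono_set hsub
    have hpos : 0 < ρ ^ ((n : ℝ) - 1) := Real.rpow_pos_of_pos hρpos _
    rw [mul_comm] at h2
    have h3 := (ENNReal.le_div_iff_mul_le (Or.inl (by simpa using hpos))
      (Or.inl ENNReal.ofReal_ne_top)).2 h2
    rw [← ENNReal.ofReal_div_of_pos hpos] at h3
    convert h3 using 2
    rw [div_eq_mul_inv, ← Real.rpow_neg hρpos.le, neg_sub]
  -- the part over thick slices
  set σ : ℝ := c * ρ with hσ
  have hσpos : 0 < σ := by positivity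
  set E' : Set (Pt n m) := {z | z ∈ E ∧ z.2 ∈ B ∧ σ ≤ ‖z.1‖} with hE'
  have hE'm : MeasurableSet E' :=
    hE.inter ((measurable_snd hBm).inter (measurableSet_le measurable_const measurable_fst.norm))
  have hball : volume (Metric.ball (0 : EuclideanSpace ℝ (Fin n)) σ) ≤ R / 2 := by
    rw [Measure.addHaar_ball_of_pos _ _ hσpos]
    have : volume (Metric.ball (0 : EuclideanSpace ℝ (Fin n)) 1) = ENNReal.ofReal κ :=
      (ENNReal.ofReal_toReal measure_ball_lt_top.ne).symm
    have hR2 : R / 2 = ENNReal.ofReal (ρ ^ n / 2) := by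
      rw [ENNReal.ofReal_div_of_pos (by norm_num)]; simp [hR]
    rw [this, ← ENNReal.ofReal_mul (by positivity), hR2]
    apply ENNReal.ofReal_le_ofReal
    rw [finrank_euclideanSpace_fin, hσ, mul_pow]
    have : 0 < ρ ^ n := by positivity
    nlinarith
  -- The ball |x| < σ fills at most half of a thick slice, so its removal costs a factor 2 and
  -- leaves points where the weight |x| ^ γ is bounded below. Finiteness of the slice allows the
  -- subtraction.
  have h2 : ∫⁻ y in B, e y ≤ 2 * volume E' := by
    rw [Measure.volume_eq_prod, Measure.prod_apply_symm hE'm,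
      ← lintegral_const_mul _ (measurable_measure_prodMk_right hE'm), ← lintegral_indicator hBm]
    refine lintegral_mono fun y => ?_
    by_cases hy : y ∈ B
    · rw [indicator_of_mem hy]
      set e' := volume ((fun x => (x, y)) ⁻¹' E') with he'
      have h3 : e y ≤ e' + R / 2 := by
        refine (measure_mono (?_ : {x | (x, y) ∈ E} ⊆
          ((fun x => (x, y)) ⁻¹' E') ∪ Metric.ball 0 σ)).trans
          ((measure_union_le _ _).trans (by gcongr))
        intro x hx
        by_cases hxσ : σ ≤ ‖x‖
        · exact Or.inl ⟨hx, hy, hxσ⟩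
        · exact Or.inr (by simpa using hxσ)
      have h4 : R / 2 ≤ e y / 2 := by
        have : R < e y := hy
        gcongr
      have h5 : e y / 2 + e y / 2 ≤ e' + e y / 2 := by
        rw [ENNReal.add_halves]; exact h3.trans (by gcongr)
      have h6 : e y / 2 ≤ e' :=
        (ENNReal.add_le_add_iff_right (ENNReal.div_lt_top (hfin y) (by norm_num)).ne).1 h5
      calc e y = 2 * (e y / 2) := by
            rw [ENNReal.mul_div_cancel (by norm_num) (by norm_num)]
        _ ≤ 2 * e' := by gcongr
    · rw [indicator_of_notMem hy]; exact zero_le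
  -- A section w of E' in the y direction is at most |B|, so w ≤ |B|^(1/m) w^((m-1)/m); on E' also 1
  -- ≤ σ^(-γ) |x| ^ γ. This produces the integrand of the second hypothesis.
  have h3 : volume E' ≤ ENNReal.ofReal ((τ * ρ ^ (1 - (n : ℝ))) ^ (1 / (m : ℝ)) * σ ^ (-γ) * τ) := by
    rw [Measure.volume_eq_prod, Measure.prod_apply hE'm]
    set A : ℝ≥0∞ := volume B ^ (1 / (m : ℝ)) * ENNReal.ofReal (σ ^ (-γ)) with hA
    have : ∫⁻ x, volume (Prod.mk x ⁻¹' E') ≤ ∫⁻ x in {x | h x ≠ 0},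
        A * (‖x‖ₑ ^ γ * h x ^ (((m : ℝ) - 1) / m)) := by
      have hs0 : MeasurableSet {x | h x ≠ 0} := hhm (measurableSet_singleton 0).compl
      rw [← lintegral_indicator hs0]
      refine lintegral_mono fun x => ?_
      set w := volume (Prod.mk x ⁻¹' E') with hw
      have hwh : w ≤ h x := measure_mono fun y hy => hy.1
      have hwB : w ≤ volume B := measure_mono fun y hy => hy.2.1
      by_cases hx0 : h x = 0
      · rw [indicator_of_notMem (by simpa using hx0)]
        exact hwh.trans hx0.le
      rw [indicator_of_mem (show x ∈ {x | h x ≠ 0} from hx0)]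
      by_cases hxσ : σ ≤ ‖x‖
      · have h1x : 1 ≤ ENNReal.ofReal (σ ^ (-γ)) * ‖x‖ₑ ^ γ := by
          rw [← ofReal_norm, ENNReal.ofReal_rpow_of_nonneg (norm_nonneg _) hγ.le,
            ← ENNReal.ofReal_mul (by positivity), ENNReal.one_le_ofReal, Real.rpow_neg hσpos.le,
            inv_mul_eq_div, one_le_div (by positivity)]
          gcongr
        calc w = w ^ (1 / (m : ℝ)) * w ^ (((m : ℝ) - 1) / m) * 1 := by
              rw [mul_one, ← ENNReal.rpow_add_of_nonneg _ _ (by positivity) hβ0,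
                show 1 / (m : ℝ) + ((m : ℝ) - 1) / m = 1 by field_simp; ring, ENNReal.rpow_one]
          _ ≤ volume B ^ (1 / (m : ℝ)) * h x ^ (((m : ℝ) - 1) / m) *
              (ENNReal.ofReal (σ ^ (-γ)) * ‖x‖ₑ ^ γ) := by gcongr
          _ = _ := by rw [hA]; ring
      · have : w = 0 := by
          have : Prod.mk x ⁻¹' E' = ∅ := by
            ext y; simp only [mem_preimage, mem_empty_iff_false, iff_false]
            exact fun hy => hxσ hy.2.2
          rw [hw, this, measure_empty]
        rw [this]; exact zero_le
    refine this.trans ?_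
    have hAle : A ≤ ENNReal.ofReal ((τ * ρ ^ (1 - (n : ℝ))) ^ (1 / (m : ℝ)) * σ ^ (-γ)) := by
      rw [hA, ENNReal.ofReal_mul (by positivity)]
      gcongr
      exact (ENNReal.rpow_le_rpow hBvol (by positivity)).trans_eq
        (ENNReal.ofReal_rpow_of_pos (by positivity))
    rw [lintegral_const_mul _ (by fun_prop), ENNReal.ofReal_mul (by positivity)]
    gcongr
  calc volume E ≤ ENNReal.ofReal (ρ * τ) +
      2 * ENNReal.ofReal ((τ * ρ ^ (1 - (n : ℝ))) ^ (1 / (m : ℝ)) * σ ^ (-γ) * τ) := by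
        refine hsplit.trans (add_le_add h1 (h2.trans ?_))
        gcongr
    _ = ENNReal.ofReal (ρ * τ +
        2 * ((τ * ρ ^ (1 - (n : ℝ))) ^ (1 / (m : ℝ)) * σ ^ (-γ) * τ)) := by
        rw [ENNReal.ofReal_add (by positivity) (by positivity), ENNReal.ofReal_mul (p := 2)
          (by norm_num)]
        simp
    _ = _ := by
        congr 1
        have e1 : ρ * τ = τ ^ (Q / (Q - 1)) := by
          rw [hρ, ← Real.rpow_add_one hτ.ne']
          congr 1; field_simp; ring
        have e2 : (τ * ρ ^ (1 - (n : ℝ))) ^ (1 / (m : ℝ)) * σ ^ (-γ) * τ =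
            c ^ (-γ) * τ ^ (Q / (Q - 1)) := by
          rw [hσ, Real.mul_rpow hcpos.le hρpos.le, Real.mul_rpow hτ.le (by positivity), hρ,
            ← Real.rpow_mul hτ.le, ← Real.rpow_mul hτ.le, ← Real.rpow_mul hτ.le]
          have : τ ^ (1 / (m : ℝ)) * τ ^ (1 / (Q - 1) * (1 - (n : ℝ)) * (1 / (m : ℝ))) *
              (c ^ (-γ) * τ ^ (1 / (Q - 1) * -γ)) * τ =
              c ^ (-γ) * (τ ^ (1 / (m : ℝ)) * τ ^ (1 / (Q - 1) * (1 - (n : ℝ)) * (1 / (m : ℝ))) *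
              τ ^ (1 / (Q - 1) * -γ) * τ ^ (1 : ℝ)) := by rw [Real.rpow_one]; ring
          rw [this, ← Real.rpow_add hτ, ← Real.rpow_add hτ, ← Real.rpow_add hτ]
          congr 2
          field_simp
          rw [hQ, homDim]; ring
        rw [e1, e2]; ring

end WeakType

end Grushin

namespace Grushin

/-! ### From sets with controlled slices to the superlevel sets of C¹ functions -/

section WeakType

/-- The `L¹` Sobolev inequality on a Euclidean space, in a form that includes dimension one. -/
lemma volume_rpow_le_lintegral_fderiv {d : ℕ} (hd : 1 ≤ d) :
    ∃ K : ℝ, 1 ≤ K ∧ ∀ f : EuclideanSpace ℝ (Fin d) → ℝ, ContDiff ℝ 1 f → HasCompactSupport f →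
      volume {x | 1 ≤ ‖f x‖ₑ} ≠ 0 →
      volume {x | 1 ≤ ‖f x‖ₑ} ^ (((d : ℝ) - 1) / d) ≤
        ENNReal.ofReal K * ∫⁻ x, ‖fderiv ℝ f x‖ₑ := by
  rcases hd.eq_or_lt with rfl | hd1
  -- In dimension one the exponent is 0 and the left side is 1. The superlevel set contains a point,
  -- and |f| there is at most the integral of |f'|.
  · refine ⟨1, le_rfl, fun f hf hfc h0 => ?_⟩
    obtain ⟨x₀, hx₀⟩ : {x | 1 ≤ ‖f x‖ₑ}.Nonempty := nonempty_of_measure_ne_zero h0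
    set L : ℝ ≃ᵐ EuclideanSpace ℝ (Fin 1) :=
      (MeasurableEquiv.funUnique (Fin 1) ℝ).symm.trans (MeasurableEquiv.toLp 2 (Fin 1 → ℝ)) with hL
    have hLm : MeasurePreserving L volume volume :=
      ((volume_preserving_funUnique (Fin 1) ℝ).symm _).trans
        (PiLp.volume_preserving_toLp (Fin 1))
    let e : ℝ →L[ℝ] EuclideanSpace ℝ (Fin 1) :=
      ContinuousLinearMap.toSpanSingleton ℝ (EuclideanSpace.single 0 1)
    have hLe : ∀ t, L t = e t := by
      intro t; ext i; fin_cases i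
      simp [hL, e, MeasurableEquiv.funUnique, ContinuousLinearMap.toSpanSingleton_apply]
    have he1 : ‖e‖ₑ ≤ 1 := by
      rw [← ofReal_norm, ENNReal.ofReal_le_one]
      simp [e]
    have hxe : x₀ = e (x₀ 0) := by
      ext i; fin_cases i; simp [e, ContinuousLinearMap.toSpanSingleton_apply]
    have hemb : Topology.IsClosedEmbedding e :=
      (LinearMap.isClosedEmbedding_of_injective (f := e.toLinearMap) (by
        rw [LinearMap.ker_eq_bot]
        intro a b hab
        have := congrArg (fun v : EuclideanSpace ℝ (Fin 1) => v 0) hab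
        simpa [e, ContinuousLinearMap.toSpanSingleton_apply] using this))
    have hg : ContDiff ℝ 1 (f ∘ e) := hf.comp e.contDiff
    have hgc : HasCompactSupport (f ∘ e) := hfc.comp_isClosedEmbedding hemb
    have h1 := hgc.enorm_le_lintegral_Ici_deriv hg (x₀ 0)
    simp only [Nat.cast_one, sub_self, zero_div, ENNReal.rpow_zero, ENNReal.ofReal_one, one_mul]
    calc (1 : ℝ≥0∞) ≤ ‖(f ∘ e) (x₀ 0)‖ₑ := by
          rw [Function.comp_apply, ← hxe]; exact hx₀
      _ ≤ ∫⁻ t in Iic (x₀ 0), ‖deriv (f ∘ e) t‖ₑ := h1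
      _ ≤ ∫⁻ t, ‖deriv (f ∘ e) t‖ₑ := setLIntegral_le_lintegral _ _
      _ ≤ ∫⁻ t, ‖fderiv ℝ f (L t)‖ₑ := by
          refine lintegral_mono fun t => ?_
          have hd : HasDerivAt (f ∘ e) (fderiv ℝ f (e t) (e 1)) t :=
            ((hf.differentiable one_ne_zero (e t)).hasFDerivAt.comp_hasDerivAt t e.hasDerivAt)
          rw [hd.deriv, hLe]
          have h2 : ‖e 1‖ₑ ≤ 1 := by simp [e, ContinuousLinearMap.toSpanSingleton_apply, ← ofReal_norm]
          calc ‖fderiv ℝ f (e t) (e 1)‖ₑ ≤ ‖fderiv ℝ f (e t)‖ₑ * ‖e 1‖ₑ :=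
                ContinuousLinearMap.le_opENorm _ _
            _ ≤ ‖fderiv ℝ f (e t)‖ₑ * 1 := by gcongr
            _ = _ := mul_one _
      _ = ∫⁻ x, ‖fderiv ℝ f x‖ₑ :=
          hLm.lintegral_comp_emb L.measurableEmbedding fun x => ‖fderiv ℝ f x‖ₑ
  · have hd0 : (1 : ℝ) < d := by exact_mod_cast hd1
    -- The Gagliardo–Nirenberg inequality in L^(d/(d-1)), followed by Chebyshev. The constant is
    -- enlarged by 1 to make it at least 1.
    set p : ℝ := d / (d - 1) with hp
    have hp0 : 0 < p := div_pos (by linarith) (by linarith)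
    have hconj : Real.HolderConjugate (Module.finrank ℝ (EuclideanSpace ℝ (Fin d))) p := by
      rw [finrank_euclideanSpace_fin]
      exact (Real.holderConjugate_iff_eq_conjExponent hd0).2 rfl
    set c : ℝ := (lintegralPowLePowLIntegralFDerivConst
      (volume : Measure (EuclideanSpace ℝ (Fin d))) p : ℝ) with hc
    refine ⟨c ^ (1 / p) + 1, by
      have : 0 ≤ c ^ (1 / p) := by rw [hc]; positivity
      linarith, fun f hf hfc _ => ?_⟩
    have h1 := lintegral_pow_le_pow_lintegral_fderiv volume hf hfc hconj
    have h2 : volume {x | 1 ≤ ‖f x‖ₑ} ≤ ∫⁻ x, ‖f x‖ₑ ^ p := by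
      have hm : MeasurableSet {x | 1 ≤ ‖f x‖ₑ} :=
        measurableSet_le measurable_const hf.continuous.enorm.measurable
      rw [← setLIntegral_one]
      refine (setLIntegral_mono' hm fun x hx => ?_).trans (setLIntegral_le_lintegral _ _)
      exact ENNReal.one_le_rpow hx hp0
    have h3 := ENNReal.rpow_le_rpow (h2.trans h1) (show 0 ≤ 1 / p by positivity)
    rw [ENNReal.mul_rpow_of_nonneg _ _ (by positivity), ← ENNReal.rpow_mul,
      mul_one_div_cancel hp0.ne', ENNReal.rpow_one] at h3
    have h4 : ((d : ℝ) - 1) / d = 1 / p := by rw [hp, one_div_div]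
    rw [h4]
    refine h3.trans ?_
    gcongr
    rw [← ENNReal.ofReal_coe_nnreal, ENNReal.ofReal_rpow_of_nonneg (by positivity) (by positivity)]
    exact ENNReal.ofReal_le_ofReal (by linarith)

variable {n m : ℕ} {γ : ℝ}

lemma isClosedEmbedding_slice_fst (y : EuclideanSpace ℝ (Fin m)) :
    IsClosedEmbedding fun x : EuclideanSpace ℝ (Fin n) => ((x, y) : Pt n m) := by
  refine ⟨isEmbedding_prodMkLeft y, ?_⟩
  convert isClosed_singleton.preimage (continuous_snd : Continuous fun z : Pt n m => z.2) using 1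
  swap
  · exact y
  ext z; constructor
  · rintro ⟨x, rfl⟩; rfl
  · rintro rfl; exact ⟨z.1, rfl⟩

lemma isClosedEmbedding_slice_snd (x : EuclideanSpace ℝ (Fin n)) :
    IsClosedEmbedding fun y : EuclideanSpace ℝ (Fin m) => ((x, y) : Pt n m) := by
  refine ⟨isEmbedding_prodMkRight x, ?_⟩
  convert isClosed_singleton.preimage (continuous_fst : Continuous fun z : Pt n m => z.1) using 1
  swap
  · exact x
  ext z; constructor
  · rintro ⟨y, rfl⟩; rfl
  · rintro rfl; exact ⟨z.2, rfl⟩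

lemma hasFDerivAt_slice_fst {f : Pt n m → ℝ} {z : Pt n m} (hf : DifferentiableAt ℝ f z) :
    HasFDerivAt (fun x => f (x, z.2)) ((fderiv ℝ f z).comp (ContinuousLinearMap.inl ℝ _ _)) z.1 := by
  have h := HasFDerivAt.comp (g := f) (f := fun x => (x, z.2)) z.1 hf.hasFDerivAt
    (hasFDerivAt_prodMk_left z.1 z.2)
  exact h

lemma hasFDerivAt_slice_snd {f : Pt n m → ℝ} {z : Pt n m} (hf : DifferentiableAt ℝ f z) :
    HasFDerivAt (fun y => f (z.1, y)) ((fderiv ℝ f z).comp (ContinuousLinearMap.inr ℝ _ _)) z.2 := by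
  have h := HasFDerivAt.comp (g := f) (f := fun y => (z.1, y)) z.2 hf.hasFDerivAt
    (hasFDerivAt_prodMk_right z.1 z.2)
  exact h

/-- The Grushin gradient as a linear function of the differential. -/
noncomputable def gradOfFDeriv (γ : ℝ) (z : Pt n m) : (Pt n m →L[ℝ] ℝ) →ₗ[ℝ] Vec n m where
  toFun L := WithLp.toLp 2
    ((InnerProductSpace.toDual ℝ _).symm (L.comp (ContinuousLinearMap.inl ℝ _ _)),
      ((1 + γ) * ‖z.1‖ ^ γ) •
        (InnerProductSpace.toDual ℝ _).symm (L.comp (ContinuousLinearMap.inr ℝ _ _)))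
  map_add' L L' := by
    rw [← WithLp.toLp_add, ContinuousLinearMap.add_comp, ContinuousLinearMap.add_comp, map_add,
      map_add, smul_add, Prod.mk_add_mk]
  map_smul' a L := by
    rw [RingHom.id_apply, ContinuousLinearMap.smul_comp, ContinuousLinearMap.smul_comp, map_smul,
      map_smul, smul_comm ((1 + γ) * ‖z.1‖ ^ γ) a]
    rfl

lemma gradTest_eq {f : Pt n m → ℝ} {z : Pt n m} (hf : DifferentiableAt ℝ f z) :
    gradTest γ f z = gradOfFDeriv γ z (fderiv ℝ f z) := by
  simp only [gradTest, gradOfFDeriv, gradient, (hasFDerivAt_slice_fst hf).fderiv,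
    (hasFDerivAt_slice_snd hf).fderiv, LinearMap.coe_mk, AddHom.coe_mk]

lemma continuous_gradTest (hγ : 0 < γ) {f : Pt n m → ℝ} (hf : ContDiff ℝ 1 f) :
    Continuous (gradTest γ f) := by
  have h : gradTest γ f = fun z => gradOfFDeriv γ z (fderiv ℝ f z) :=
    funext fun z => gradTest_eq (hf.differentiable one_ne_zero z)
  rw [h]
  have hd := hf.continuous_fderiv one_ne_zero
  have h1 : Continuous fun z : Pt n m => ‖z.1‖ ^ γ :=
    continuous_fst.norm.rpow_const fun _ => Or.inr hγ.le
  simp only [gradOfFDeriv, LinearMap.coe_mk, AddHom.coe_mk]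
  refine (WithLp.prod_continuous_toLp 2 _ _).comp (Continuous.prodMk ?_ ((continuous_const.mul h1).smul ?_))
  · exact (LinearIsometryEquiv.continuous _).comp (hd.clm_comp continuous_const)
  · exact (LinearIsometryEquiv.continuous _).comp (hd.clm_comp continuous_const)

lemma norm_toLp_sq (v : EuclideanSpace ℝ (Fin n)) (w : EuclideanSpace ℝ (Fin m)) :
    ‖(WithLp.toLp 2 (v, w) : Vec n m)‖ ^ 2 = ‖v‖ ^ 2 + ‖w‖ ^ 2 :=
  WithLp.prod_norm_sq_eq_of_L2 _

lemma norm_fderiv_slice_fst_le (f : Pt n m → ℝ) (z : Pt n m) :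
    ‖fderiv ℝ (fun x => f (x, z.2)) z.1‖ ≤ ‖gradTest γ f z‖ := by
  refine le_of_sq_le_sq ?_ (norm_nonneg _)
  rw [gradTest, norm_toLp_sq, gradient, LinearIsometryEquiv.norm_map]
  linarith [sq_nonneg ‖((1 + γ) * ‖z.1‖ ^ γ) • gradient (fun y => f (z.1, y)) z.2‖]

lemma norm_fderiv_slice_snd_le (hγ : 0 < γ) (f : Pt n m → ℝ) (z : Pt n m) :
    ‖z.1‖ ^ γ * ‖fderiv ℝ (fun y => f (z.1, y)) z.2‖ ≤ ‖gradTest γ f z‖ := by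
  have h0 : 0 ≤ ‖z.1‖ ^ γ * ‖fderiv ℝ (fun y => f (z.1, y)) z.2‖ := by positivity
  have h1 : ‖z.1‖ ^ γ * ‖fderiv ℝ (fun y => f (z.1, y)) z.2‖ ≤
      ‖((1 + γ) * ‖z.1‖ ^ γ) • gradient (fun y => f (z.1, y)) z.2‖ := by
    rw [gradient, norm_smul, LinearIsometryEquiv.norm_map, Real.norm_of_nonneg (by positivity),
      mul_assoc]
    exact le_mul_of_one_le_left h0 (by linarith)
  refine h1.trans (le_of_sq_le_sq ?_ (norm_nonneg _))
  rw [gradTest, norm_toLp_sq]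
  linarith [sq_nonneg ‖gradient (fun x => f (x, z.2)) z.1‖]

/-- The weak-type `L¹` Sobolev inequality for the Grushin gradient. -/
lemma volume_le_lintegral_gradTest (hn : 1 ≤ n) (hm : 1 ≤ m) (hγ : 0 < γ) :
    ∃ K : ℝ, 0 ≤ K ∧ ∀ f : Pt n m → ℝ, ContDiff ℝ 1 f → HasCompactSupport f →
      volume {z | 1 ≤ ‖f z‖ₑ} ≤ ENNReal.ofReal K *
        (∫⁻ z, ‖gradTest γ f z‖ₑ) ^ (homDim n m γ / (homDim n m γ - 1)) := by
  obtain ⟨C, hC0, hC⟩ := volume_le_of_slices hn hm hγ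
  obtain ⟨K₁, hK₁, h₁⟩ := volume_rpow_le_lintegral_fderiv hn
  obtain ⟨K₂, hK₂, h₂⟩ := volume_rpow_le_lintegral_fderiv hm
  have hQ1 : 0 < homDim n m γ - 1 := by
    have : (1 : ℝ) ≤ n := by exact_mod_cast hn
    have : (1 : ℝ) ≤ m := by exact_mod_cast hm
    rw [homDim]; nlinarith
  set r := homDim n m γ / (homDim n m γ - 1) with hr
  have hr0 : 0 < r := div_pos (by linarith) hQ1
  set M := max K₁ K₂ with hM
  have hM1 : 1 ≤ M := hK₁.trans (le_max_left _ _)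
  have hMpos : 0 < M := by linarith
  -- The summand 1 keeps the constant positive, so that the bound is ∞ rather than 0 · ∞ when the
  -- gradient integral is infinite.
  refine ⟨C * M ^ r + 1, by positivity, fun f hf hfc => ?_⟩
  set I := ∫⁻ z, ‖gradTest γ f z‖ₑ with hI
  set E := {z | 1 ≤ ‖f z‖ₑ} with hE
  have hdiff := hf.differentiable one_ne_zero
  have hEcl : IsClosed E := isClosed_le continuous_const hf.continuous.enorm
  have hEc : IsCompact E := hfc.isCompact.of_isClosed_subset hEcl fun z hz =>
    subset_tsupport _ (by
      intro h0
      have hz : 1 ≤ ‖f z‖ₑ := hz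
      rw [h0] at hz; simp at hz)
  have hcs1 : ∀ y, HasCompactSupport fun x => f (x, y) := fun y =>
    hfc.comp_isClosedEmbedding (isClosedEmbedding_slice_fst y)
  have hcs2 : ∀ x, HasCompactSupport fun y => f (x, y) := fun x =>
    hfc.comp_isClosedEmbedding (isClosedEmbedding_slice_snd x)
  have hc1 : ∀ y, ContDiff ℝ 1 fun x => f (x, y) := fun y => hf.comp (contDiff_prodMk_left y)
  have hc2 : ∀ x, ContDiff ℝ 1 fun y => f (x, y) := fun x => hf.comp (contDiff_prodMk_right x)
  have hm1 : Measurable fun z : Pt n m => ‖fderiv ℝ (fun x => f (x, z.2)) z.1‖ₑ := by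
    have : Continuous fun z : Pt n m => fderiv ℝ (fun x => f (x, z.2)) z.1 := by
      rw [funext fun z => (hasFDerivAt_slice_fst (hdiff z)).fderiv]
      exact (hf.continuous_fderiv one_ne_zero).clm_comp continuous_const
    exact this.enorm.measurable
  have hm2 : Measurable fun z : Pt n m => ‖fderiv ℝ (fun y => f (z.1, y)) z.2‖ₑ := by
    have : Continuous fun z : Pt n m => fderiv ℝ (fun y => f (z.1, y)) z.2 := by
      rw [funext fun z => (hasFDerivAt_slice_snd (hdiff z)).fderiv]
      exact (hf.continuous_fderiv one_ne_zero).clm_comp continuous_const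
    exact this.enorm.measurable
  have hX : (∫⁻ y in {y | volume {x | (x, y) ∈ E} ≠ 0},
      volume {x | (x, y) ∈ E} ^ (((n : ℝ) - 1) / n)) ≤ ENNReal.ofReal M * I := by
    have hs : MeasurableSet {y | volume {x | (x, y) ∈ E} ≠ 0} :=
      measurable_measure_prodMk_right hEcl.measurableSet (measurableSet_singleton 0).compl
    calc _ ≤ ∫⁻ y in {y | volume {x | (x, y) ∈ E} ≠ 0},
          ENNReal.ofReal K₁ * ∫⁻ x, ‖fderiv ℝ (fun x => f (x, y)) x‖ₑ :=
          setLIntegral_mono' hs fun y hy => h₁ _ (hc1 y) (hcs1 y) hy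
      _ ≤ ∫⁻ y, ENNReal.ofReal K₁ * ∫⁻ x, ‖fderiv ℝ (fun x => f (x, y)) x‖ₑ :=
          setLIntegral_le_lintegral _ _
      _ = ENNReal.ofReal K₁ * ∫⁻ z : Pt n m, ‖fderiv ℝ (fun x => f (x, z.2)) z.1‖ₑ := by
          rw [lintegral_const_mul _ hm1.lintegral_prod_left', Measure.volume_eq_prod,
            lintegral_prod_symm' _ hm1]
      _ ≤ _ := by
          refine mul_le_mul' (ENNReal.ofReal_le_ofReal (le_max_left _ _)) (lintegral_mono fun z => ?_)
          · rw [← ofReal_norm, ← ofReal_norm]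
            exact ENNReal.ofReal_le_ofReal (norm_fderiv_slice_fst_le f z)
  have hY : (∫⁻ x in {x | volume {y | (x, y) ∈ E} ≠ 0},
      ‖x‖ₑ ^ γ * volume {y | (x, y) ∈ E} ^ (((m : ℝ) - 1) / m)) ≤ ENNReal.ofReal M * I := by
    have hs : MeasurableSet {x | volume {y | (x, y) ∈ E} ≠ 0} :=
      measurable_measure_prodMk_left hEcl.measurableSet (measurableSet_singleton 0).compl
    calc _ ≤ ∫⁻ x in {x | volume {y | (x, y) ∈ E} ≠ 0},
          ENNReal.ofReal K₂ * ∫⁻ y, ‖x‖ₑ ^ γ * ‖fderiv ℝ (fun y => f (x, y)) y‖ₑ := by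
          refine setLIntegral_mono' hs fun x hx => ?_
          have hm2x : Measurable fun y => ‖fderiv ℝ (fun y => f (x, y)) y‖ₑ :=
            ((hc2 x).continuous_fderiv one_ne_zero).enorm.measurable
          rw [lintegral_const_mul _ hm2x, mul_left_comm]
          gcongr
          exact h₂ _ (hc2 x) (hcs2 x) hx
      _ ≤ ∫⁻ x, ENNReal.ofReal K₂ * ∫⁻ y, ‖x‖ₑ ^ γ * ‖fderiv ℝ (fun y => f (x, y)) y‖ₑ :=
          setLIntegral_le_lintegral _ _
      _ = ENNReal.ofReal K₂ * ∫⁻ z : Pt n m, ‖z.1‖ₑ ^ γ * ‖fderiv ℝ (fun y => f (z.1, y)) z.2‖ₑ := by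
          have hm3 : Measurable fun z : Pt n m =>
            ‖z.1‖ₑ ^ γ * ‖fderiv ℝ (fun y => f (z.1, y)) z.2‖ₑ :=
            (measurable_fst.enorm.pow_const γ).mul hm2
          rw [lintegral_const_mul _ hm3.lintegral_prod_right', Measure.volume_eq_prod,
            lintegral_prod _ hm3.aemeasurable]
      _ ≤ _ := by
          refine mul_le_mul' (ENNReal.ofReal_le_ofReal (le_max_right _ _)) (lintegral_mono fun z => ?_)
          · rw [← ofReal_norm, ← ofReal_norm, ← ofReal_norm,
              ENNReal.ofReal_rpow_of_nonneg (norm_nonneg _) hγ.le,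
              ← ENNReal.ofReal_mul (by positivity)]
            exact ENNReal.ofReal_le_ofReal (norm_fderiv_slice_snd_le hγ f z)
  have hfin : ∀ y, volume {x | (x, y) ∈ E} ≠ ⊤ := fun y => by
    refine (IsCompact.measure_lt_top ?_).ne
    exact (isClosedEmbedding_slice_fst y).isCompact_preimage hEc
  rcases eq_or_ne I ⊤ with hItop | hItop
  · rw [hItop, ENNReal.top_rpow_of_pos hr0, ENNReal.mul_top (by
      rw [Ne, ENNReal.ofReal_eq_zero, not_le]; positivity)]
    exact le_top
  -- The slice estimate asks for τ > 0 while I may vanish, so it is applied above M I and τ then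
  -- decreases to M I.
  have key : ∀ τ : ℝ, M * I.toReal < τ → volume E ≤ ENNReal.ofReal (C * τ ^ r) := by
    intro τ hτ
    have hτ0 : 0 < τ := lt_of_le_of_lt (by positivity) hτ
    have hle : ENNReal.ofReal M * I ≤ ENNReal.ofReal τ := by
      rw [← ENNReal.ofReal_toReal hItop, ← ENNReal.ofReal_mul hMpos.le]
      exact ENNReal.ofReal_le_ofReal hτ.le
    exact hC E hEcl.measurableSet hfin τ hτ0 (hX.trans hle) (hY.trans hle)
  have hlim : Tendsto (fun τ : ℝ => ENNReal.ofReal (C * τ ^ r)) (𝓝[>] (M * I.toReal))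
      (𝓝 (ENNReal.ofReal (C * (M * I.toReal) ^ r))) := by
    refine ENNReal.tendsto_ofReal (Tendsto.const_mul _ ?_)
    exact ((Real.continuousAt_rpow_const _ _ (Or.inr hr0.le)).tendsto).mono_left
      nhdsWithin_le_nhds
  refine (ge_of_tendsto hlim (eventually_mem_nhdsWithin.mono fun τ hτ => key τ hτ)).trans ?_
  rw [Real.mul_rpow hMpos.le ENNReal.toReal_nonneg, ← mul_assoc,
    ENNReal.ofReal_mul (by positivity), ← ENNReal.ofReal_rpow_of_nonneg ENNReal.toReal_nonneg hr0.le,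
    ENNReal.ofReal_toReal hItop]
  gcongr
  linarith

end WeakType

end Grushin

namespace Grushin

/-! ### The Sobolev inequality for test functions -/

section Truncation

/-- A smooth even cut-off: `0` on `[-1, 1]` and `1` outside `(-2, 2)`. -/
noncomputable def levelCut (s : ℝ) : ℝ := Real.smoothTransition ((s ^ 2 - 1) / 3)

lemma contDiff_levelCut : ContDiff ℝ ∞ levelCut :=
  Real.smoothTransition.contDiff.comp (by fun_prop)

lemma levelCut_of_le {s : ℝ} (h : |s| ≤ 1) : levelCut s = 0 := by
  apply Real.smoothTransition.zero_of_nonpos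
  have : s ^ 2 ≤ 1 := (sq_le_one_iff_abs_le_one s).2 h
  linarith

lemma levelCut_of_ge {s : ℝ} (h : 2 ≤ |s|) : levelCut s = 1 := by
  apply Real.smoothTransition.one_of_one_le
  have : 4 ≤ s ^ 2 := by rw [← sq_abs]; nlinarith
  linarith

/-- These are minimum points of the cut-off, so the derivative vanishes at |s| = 1 too. -/
lemma deriv_levelCut_of_le {s : ℝ} (h : |s| ≤ 1) : deriv levelCut s = 0 :=
  IsLocalMin.deriv_eq_zero <| Eventually.of_forall fun x => by
    rw [levelCut_of_le h]; exact Real.smoothTransition.nonneg _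

lemma deriv_levelCut_of_ge {s : ℝ} (h : 2 ≤ |s|) : deriv levelCut s = 0 :=
  IsLocalMax.deriv_eq_zero <| Eventually.of_forall fun x => by
    rw [levelCut_of_ge h]; exact Real.smoothTransition.le_one _

lemma exists_deriv_levelCut_le : ∃ L : ℝ, 0 < L ∧ ∀ s, |deriv levelCut s| ≤ L := by
  have hc : Continuous (deriv levelCut) := contDiff_levelCut.continuous_deriv (by simp)
  obtain ⟨C, hC⟩ := (isCompact_Icc (a := (-2 : ℝ)) (b := 2)).exists_bound_of_continuousOn
    hc.continuousOn
  refine ⟨max C 1, by positivity, fun s => ?_⟩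
  rcases le_total 2 |s| with h | h
  · rw [deriv_levelCut_of_ge h]; simp
  · exact (hC s (abs_le.1 h)).trans (le_max_left _ _)

end Truncation

/-! ### Summation over dyadic levels -/

section Sequences

/-- Each term satisfies z_j ^ k ≤ z_j (∑ z)^(k - 1). -/
lemma tsum_rpow_le {z : ℕ → ℝ≥0∞} {k : ℝ} (hk : 1 ≤ k) : ∑' j, z j ^ k ≤ (∑' j, z j) ^ k := by
  have e : ∀ w : ℝ≥0∞, w ^ k = w * w ^ (k - 1) := fun w => by
    conv_lhs => rw [show k = 1 + (k - 1) by ring]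
    rw [ENNReal.rpow_add_of_nonneg _ _ (by norm_num) (by linarith), ENNReal.rpow_one]
  calc ∑' j, z j ^ k ≤ ∑' j, z j * (∑' j, z j) ^ (k - 1) := by
        refine ENNReal.tsum_le_tsum fun j => ?_
        rw [e]
        gcongr
        exact ENNReal.le_tsum j
    _ = _ := by rw [ENNReal.tsum_mul_right, ← e]

/-- For α = 1/2 this is the Cauchy–Schwarz inequality; for larger α the power 2α ≥ 1 of the summands
is taken afterwards. -/
lemma tsum_mul_rpow_le {x y : ℕ → ℝ≥0∞} {α : ℝ} (hα : 1 / 2 ≤ α) :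
    ∑' j, (x j * y j) ^ α ≤ ((∑' j, x j) * ∑' j, y j) ^ α := by
  have h2 : Real.HolderConjugate 2 2 := Real.HolderConjugate.two_two
  have cs : ∑' j, (x j * y j) ^ (1 / 2 : ℝ) ≤ ((∑' j, x j) * ∑' j, y j) ^ (1 / 2 : ℝ) := by
    have h := ENNReal.lintegral_mul_le_Lp_mul_Lq (Measure.count : Measure ℕ) h2
      (f := fun j => x j ^ (1 / 2 : ℝ)) (g := fun j => y j ^ (1 / 2 : ℝ))
      (Measurable.of_discrete).aemeasurable (Measurable.of_discrete).aemeasurable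
    simp only [lintegral_count, Pi.mul_apply, ← ENNReal.rpow_mul] at h
    norm_num at h
    rw [ENNReal.mul_rpow_of_nonneg _ _ (by norm_num)]
    simp_rw [ENNReal.mul_rpow_of_nonneg _ _ (show (0 : ℝ) ≤ 1 / 2 by norm_num)]
    exact h
  calc ∑' j, (x j * y j) ^ α = ∑' j, ((x j * y j) ^ (1 / 2 : ℝ)) ^ (2 * α) := by
        congr 1; ext j; rw [← ENNReal.rpow_mul]; congr 1; ring
    _ ≤ (∑' j, (x j * y j) ^ (1 / 2 : ℝ)) ^ (2 * α) := tsum_rpow_le (by linarith)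
    _ ≤ (((∑' j, x j) * ∑' j, y j) ^ (1 / 2 : ℝ)) ^ (2 * α) := by gcongr
    _ = _ := by rw [← ENNReal.rpow_mul]; congr 1; ring

end Sequences

variable {n m : ℕ} {γ : ℝ}

lemma gradTest_comp {f : Pt n m → ℝ} {z : Pt n m} (hf : DifferentiableAt ℝ f z) {ψ : ℝ → ℝ}
    (hψ : DifferentiableAt ℝ ψ (f z)) :
    gradTest γ (fun w => ψ (f w)) z = deriv ψ (f z) • gradTest γ f z := by
  have h := hψ.hasDerivAt.comp_hasFDerivAt z hf.hasFDerivAt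
  rw [gradTest_eq hf, gradTest_eq (f := fun w => ψ (f w)) h.differentiableAt]
  have h' : fderiv ℝ (fun w => ψ (f w)) z = deriv ψ (f z) • fderiv ℝ f z := h.fderiv
  rw [h', map_smul]

lemma one_lt_homDim_sub_one (hn : 1 ≤ n) (hm : 1 ≤ m) (hγ : 0 < γ) : 2 < homDim n m γ := by
  have : (1 : ℝ) ≤ n := by exact_mod_cast hn
  have : (1 : ℝ) ≤ m := by exact_mod_cast hm
  rw [homDim]; nlinarith

/-- Decay of the superlevel sets in terms of the gradient on a dyadic layer. -/
lemma volume_superlevel_le (hn : 1 ≤ n) (hm : 1 ≤ m) (hγ : 0 < γ) :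
    ∃ K : ℝ, 0 ≤ K ∧ ∀ u : Pt n m → ℝ, ContDiff ℝ ∞ u → HasCompactSupport u → ∀ t : ℝ, 0 < t →
      volume {z | 2 * t ≤ |u z|} ≤
        ENNReal.ofReal (K * t ^ (-(homDim n m γ / (homDim n m γ - 1)))) *
          (volume {z | t ≤ |u z|} * ∫⁻ z in {z | t < |u z| ∧ |u z| ≤ 2 * t}, ‖gradTest γ u z‖ₑ ^ (2 : ℝ))
            ^ (homDim n m γ / (homDim n m γ - 1) / 2) := by
  obtain ⟨K₀, hK₀, h₀⟩ := volume_le_lintegral_gradTest hn hm hγ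
  obtain ⟨L, hL, hψ⟩ := exists_deriv_levelCut_le
  have hQ := one_lt_homDim_sub_one hn hm hγ
  set r := homDim n m γ / (homDim n m γ - 1) with hr
  have hr0 : 0 < r := div_pos (by linarith) (by linarith)
  refine ⟨K₀ * L ^ r, by positivity, fun u hu huc t ht => ?_⟩
  -- Truncation between the levels t and 2t: f is 1 where |u| ≥ 2t, and its gradient lives on the
  -- layer t < |u| ≤ 2t. The weak-type inequality is applied to f.
  set f : Pt n m → ℝ := fun z => levelCut (u z / t) with hf
  have hfs : ContDiff ℝ ∞ f := contDiff_levelCut.comp (hu.div_const t)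
  have hfc : HasCompactSupport f := huc.comp_left (g := fun s => levelCut (s / t))
    (by rw [zero_div]; exact levelCut_of_le (by simp))
  set A : Set (Pt n m) := {z | t < |u z| ∧ |u z| ≤ 2 * t} with hA
  have hAm : MeasurableSet A :=
    (measurableSet_lt measurable_const hu.continuous.abs.measurable).inter
      (measurableSet_le hu.continuous.abs.measurable measurable_const)
  have hgrad : ∀ z, ‖gradTest γ f z‖ₑ ≤
      A.indicator (fun z => ENNReal.ofReal (L / t) * ‖gradTest γ u z‖ₑ) z := by
    intro z
    have hc : HasDerivAt (fun s => levelCut (s / t)) (deriv levelCut (u z / t) * (1 / t)) (u z) :=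
      (contDiff_levelCut.differentiable (by simp) _).hasDerivAt.comp (u z)
        ((hasDerivAt_id _).div_const t)
    have hg : gradTest γ f z = (deriv levelCut (u z / t) * (1 / t)) • gradTest γ u z := by
      rw [hf, gradTest_comp (ψ := fun s => levelCut (s / t)) (hu.differentiable (by simp) z)
        hc.differentiableAt, hc.deriv]
    rw [hg]
    by_cases hz : z ∈ A
    · rw [indicator_of_mem hz, enorm_smul]
      gcongr
      rw [← ofReal_norm, Real.norm_eq_abs, abs_mul, abs_of_pos (by positivity : 0 < 1 / t),
        mul_one_div]
      exact ENNReal.ofReal_le_ofReal (by gcongr; exact hψ _)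
    · rw [indicator_of_notMem hz]
      have h0 : deriv levelCut (u z / t) = 0 := by
        by_cases h1 : |u z| ≤ t
        · apply deriv_levelCut_of_le
          rwa [abs_div, abs_of_pos ht, div_le_one ht]
        · apply deriv_levelCut_of_ge
          rw [abs_div, abs_of_pos ht, le_div_iff₀ ht]
          by_contra h2
          exact hz ⟨not_le.1 h1, (not_le.1 h2).le⟩
      simp [h0]
  have hgm : Measurable fun z => ‖gradTest γ u z‖ₑ :=
    (continuous_gradTest hγ (hu.of_le (by simp))).enorm.measurable
  -- Cauchy–Schwarz on the layer, whose measure is at most that of {t ≤ |u|}.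
  have hint : ∫⁻ z, ‖gradTest γ f z‖ₑ ≤ ENNReal.ofReal (L / t) *
      (volume {z | t ≤ |u z|} * ∫⁻ z in A, ‖gradTest γ u z‖ₑ ^ (2 : ℝ)) ^ (1 / 2 : ℝ) := by
    calc ∫⁻ z, ‖gradTest γ f z‖ₑ
        ≤ ∫⁻ z in A, ENNReal.ofReal (L / t) * ‖gradTest γ u z‖ₑ := by
          rw [← lintegral_indicator hAm]; exact lintegral_mono hgrad
      _ = ENNReal.ofReal (L / t) * ∫⁻ z in A, 1 * ‖gradTest γ u z‖ₑ := by
          rw [lintegral_const_mul _ hgm]; simp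
      _ ≤ _ := by
          gcongr
          have h := ENNReal.lintegral_mul_le_Lp_mul_Lq (volume.restrict A)
            Real.HolderConjugate.two_two (f := fun _ => 1) aemeasurable_const hgm.aemeasurable
          refine h.trans ?_
          rw [← ENNReal.mul_rpow_of_nonneg _ _ (by norm_num)]
          gcongr
          simp only [ENNReal.one_rpow, lintegral_const, one_mul, Measure.restrict_apply_univ]
          exact measure_mono fun z hz => hz.1.le
  calc volume {z | 2 * t ≤ |u z|} ≤ volume {z | 1 ≤ ‖f z‖ₑ} := by
        refine measure_mono fun z hz => ?_
        have h1 : f z = 1 := levelCut_of_ge (by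
          rw [abs_div, abs_of_pos ht, le_div_iff₀ ht]; exact hz)
        simp [h1]
    _ ≤ ENNReal.ofReal K₀ * (∫⁻ z, ‖gradTest γ f z‖ₑ) ^ r := h₀ f (hfs.of_le (by simp)) hfc
    _ ≤ ENNReal.ofReal K₀ * (ENNReal.ofReal (L / t) *
      (volume {z | t ≤ |u z|} * ∫⁻ z in A, ‖gradTest γ u z‖ₑ ^ (2 : ℝ)) ^ (1 / 2 : ℝ)) ^ r := by
        gcongr
    _ = _ := by
        rw [ENNReal.mul_rpow_of_nonneg _ _ hr0.le, ← ENNReal.rpow_mul, ← mul_assoc,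
          ENNReal.ofReal_rpow_of_nonneg (by positivity) hr0.le, ← ENNReal.ofReal_mul hK₀,
          Real.div_rpow hL.le ht.le, Real.rpow_neg ht.le, ← div_eq_mul_inv, mul_div_assoc,
          one_div_mul_eq_div]

/-- The Sobolev inequality for smooth functions with compact support. -/
theorem lintegral_rpow_le_gradTest (hn : 1 ≤ n) (hm : 1 ≤ m) (hγ : 0 < γ) :
    ∃ K : ℝ, 0 ≤ K ∧ ∀ u : Pt n m → ℝ, ContDiff ℝ ∞ u → HasCompactSupport u →
      ∫⁻ z, ‖u z‖ₑ ^ critExp n m γ ≤ ENNReal.ofReal K *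
        (∫⁻ z, ‖gradTest γ u z‖ₑ ^ (2 : ℝ)) ^ (critExp n m γ / 2) := by
  obtain ⟨K₀, hK₀, h₀⟩ := volume_superlevel_le hn hm hγ
  have hQ := one_lt_homDim_sub_one hn hm hγ
  set Q := homDim n m γ with hQdef
  set r := Q / (Q - 1) with hr
  set s := critExp n m γ with hs
  have hs' : s = 2 * Q / (Q - 2) := rfl
  have hs0 : 0 < s := div_pos (by linarith) (by linarith)
  -- The bound 1/2 ≤ α permits the summation over levels, and α < 1 permits the absorption of the
  -- sum into the left side at the end.
  set α := r / 2 with hα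
  have hα' : α = Q / (2 * (Q - 1)) := by rw [hα, hr]; field_simp
  have hα1 : 1 / 2 ≤ α := by
    rw [hα', div_le_div_iff₀ (by norm_num) (by linarith)]; linarith
  have hα2 : α < 1 := by rw [hα', div_lt_one (by linarith)]; linarith
  set K₂ := 2 ^ s * K₀ with hK₂
  refine ⟨2 ^ s * K₂ ^ (1 / (1 - α)), by positivity, fun u hu huc => ?_⟩
  set D := ∫⁻ z, ‖gradTest γ u z‖ₑ ^ (2 : ℝ) with hD
  obtain ⟨T, hT⟩ : ∃ T : ℝ, ∀ z, ‖u z‖ ≤ T := hu.continuous.bounded_above_of_compact_support huc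
  obtain ⟨T, hT0, hT⟩ : ∃ T : ℝ, 0 < T ∧ ∀ z, |u z| < T :=
    ⟨max T 0 + 1, by positivity, fun z =>
      lt_of_le_of_lt (hT z) (by linarith [le_max_left T 0])⟩
  -- Dyadic levels descending from a strict bound T of |u|; the layers between consecutive levels
  -- are disjoint, so the gradient energies on them add up to at most D.
  set t : ℕ → ℝ := fun j => T * (1 / 2) ^ j with ht
  have htpos : ∀ j, 0 < t j := fun j => by positivity
  have ht2 : ∀ j, t j = 2 * t (j + 1) := fun j => by simp only [ht, pow_succ]; ring
  set a : ℕ → ℝ≥0∞ := fun j => volume {z | t j ≤ |u z|} with ha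
  set A : ℕ → Set (Pt n m) := fun j => {z | t j < |u z| ∧ |u z| ≤ 2 * t j} with hA
  have hAm : ∀ j, MeasurableSet (A j) := fun j =>
    (measurableSet_lt measurable_const hu.continuous.abs.measurable).inter
      (measurableSet_le hu.continuous.abs.measurable measurable_const)
  have hAd : Pairwise (Function.onFun Disjoint A) := by
    have key : ∀ i j, i < j → Disjoint (A i) (A j) := by
      intro i j hij
      rw [Set.disjoint_left]
      intro z hz hz'
      have h1 : t j ≤ t (i + 1) := by
        simp only [ht]
        gcongr ?_ * ?_
        exact pow_le_pow_of_le_one (by norm_num) (by norm_num) hij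
      have := hz.1
      have := hz'.2
      have := ht2 i
      linarith
    intro i j hij
    rcases lt_or_gt_of_ne hij with h | h
    · exact key i j h
    · exact (key j i h).symm
  set d : ℕ → ℝ≥0∞ := fun j => ∫⁻ z in A j, ‖gradTest γ u z‖ₑ ^ (2 : ℝ) with hd
  have hdD : ∑' j, d j ≤ D := by
    rw [hd, ← lintegral_iUnion hAm hAd]
    exact setLIntegral_le_lintegral _ _
  set b : ℕ → ℝ≥0∞ := fun j => ENNReal.ofReal (t j ^ s) * a j with hb
  set B := ∑' j, b j with hB
  -- The powers of the level match because s α = s - r. This identity singles out the critical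
  -- exponent.
  have hstep : ∀ j, b j ≤ ENNReal.ofReal K₂ * (b (j + 1) * d (j + 1)) ^ α := by
    intro j
    have h1 : a j ≤ ENNReal.ofReal (K₀ * t (j + 1) ^ (-r)) * (a (j + 1) * d (j + 1)) ^ α := by
      have h := h₀ u hu huc (t (j + 1)) (htpos _)
      simp only [ha]
      rw [ht2 j]
      exact h
    have htj := htpos (j + 1)
    calc b j ≤ ENNReal.ofReal (t j ^ s) *
          (ENNReal.ofReal (K₀ * t (j + 1) ^ (-r)) * (a (j + 1) * d (j + 1)) ^ α) := by
          exact mul_le_mul' le_rfl h1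
      _ = ENNReal.ofReal K₂ * (b (j + 1) * d (j + 1)) ^ α := by
          simp only [hb]
          rw [mul_assoc (ENNReal.ofReal (t (j + 1) ^ s)),
            ENNReal.mul_rpow_of_nonneg (ENNReal.ofReal (t (j + 1) ^ s)) _ (by linarith),
            ENNReal.ofReal_rpow_of_pos (by positivity), ← mul_assoc, ← mul_assoc,
            ← ENNReal.ofReal_mul (by positivity), ← ENNReal.ofReal_mul (by positivity)]
          congr 2
          rw [ht2 j, Real.mul_rpow (by norm_num) htj.le, ← Real.rpow_mul htj.le, hK₂]
          have e : t (j + 1) ^ (s * α) = t (j + 1) ^ s * t (j + 1) ^ (-r) := by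
            rw [← Real.rpow_add htj]
            congr 1
            have : Q - 2 ≠ 0 := by linarith
            have : Q - 1 ≠ 0 := by linarith
            rw [hα', hs', hr]; field_simp; ring
          rw [e]; ring
  have ha0 : b 0 = 0 := by
    have : {z | t 0 ≤ |u z|} = ∅ := by
      ext z; simp only [ht, mem_ofPred_eq, pow_zero, mul_one, mem_empty_iff_false, iff_false, not_le]
      exact hT z
    simp only [hb, ha]
    rw [this, measure_empty, mul_zero]
  have hBle : B ≤ ENNReal.ofReal K₂ * (B * D) ^ α := by
    calc B ≤ ∑' j, ENNReal.ofReal K₂ * (b (j + 1) * d (j + 1)) ^ α := ENNReal.tsum_le_tsum hstep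
      _ ≤ ENNReal.ofReal K₂ * ((∑' j, b (j + 1)) * ∑' j, d (j + 1)) ^ α := by
          rw [ENNReal.tsum_mul_left]; gcongr; exact tsum_mul_rpow_le hα1
      _ ≤ _ := by
          gcongr
          · exact ENNReal.tsum_comp_le_tsum_of_injective (add_left_injective 1) b
          · exact (ENNReal.tsum_comp_le_tsum_of_injective (add_left_injective 1) d).trans hdD
  -- Finiteness, needed to cancel B ^ α in B ≤ K₂ (B D)^α. It holds because u has compact support
  -- and t_j ^ s is geometric.
  have hBtop : B ≠ ⊤ := by
    have hV : volume (tsupport u) < ⊤ := huc.isCompact.measure_lt_top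
    have hbj : ∀ j, b j ≤ ENNReal.ofReal (T ^ s) * volume (tsupport u) *
        ENNReal.ofReal ((1 / 2) ^ s) ^ j := by
      intro j
      have h1 : a j ≤ volume (tsupport u) := measure_mono fun z hz => subset_tsupport _ (by
        intro h0
        have hz : t j ≤ |u z| := hz
        rw [h0, abs_zero] at hz
        exact absurd (htpos j) (not_lt.2 hz))
      have h2 : t j ^ s = T ^ s * ((1 / 2) ^ s) ^ j := by
        simp only [ht]
        rw [Real.mul_rpow hT0.le (by positivity), ← Real.rpow_natCast, ← Real.rpow_mul (by norm_num),
          mul_comm (j : ℝ), Real.rpow_mul (by norm_num), Real.rpow_natCast]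
      simp only [hb]
      rw [h2, ENNReal.ofReal_mul (by positivity), ENNReal.ofReal_pow (by positivity), mul_right_comm]
      gcongr
    refine ((ENNReal.tsum_le_tsum hbj).trans_lt ?_).ne
    rw [ENNReal.tsum_mul_left, ENNReal.tsum_geometric]
    have hlt : ENNReal.ofReal ((1 / 2) ^ s) < 1 := by
      rw [ENNReal.ofReal_lt_one]
      exact Real.rpow_lt_one (by norm_num) (by norm_num) hs0
    exact ENNReal.mul_lt_top (ENNReal.mul_lt_top ENNReal.ofReal_lt_top hV)
      (by rw [ENNReal.inv_lt_top]; exact tsub_pos_of_lt hlt)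
  have hBfin : B ≤ ENNReal.ofReal (K₂ ^ (1 / (1 - α))) * D ^ (s / 2) := by
    rcases eq_or_ne B 0 with h0 | h0
    · rw [h0]; exact zero_le
    have hα3 : 0 < 1 - α := by linarith
    have h1 : B ^ (1 - α) ≤ ENNReal.ofReal K₂ * D ^ α := by
      have h2 : B ^ α * B ^ (1 - α) ≤ B ^ α * (ENNReal.ofReal K₂ * D ^ α) := by
        rw [← ENNReal.rpow_add _ _ h0 hBtop, show α + (1 - α) = 1 by ring, ENNReal.rpow_one]
        refine hBle.trans_eq ?_
        rw [ENNReal.mul_rpow_of_nonneg _ _ (by linarith)]; ring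
      exact (ENNReal.mul_le_mul_iff_right (ENNReal.rpow_pos (pos_iff_ne_zero.2 h0) hBtop).ne'
        (ENNReal.rpow_ne_top_of_nonneg (by linarith) hBtop)).1 h2
    have h3 := ENNReal.rpow_le_rpow h1 (show 0 ≤ 1 / (1 - α) by positivity)
    rw [← ENNReal.rpow_mul, mul_one_div_cancel hα3.ne', ENNReal.rpow_one,
      ENNReal.mul_rpow_of_nonneg _ _ (by positivity), ← ENNReal.rpow_mul,
      ENNReal.ofReal_rpow_of_nonneg (by positivity) (by positivity)] at h3
    convert h3 using 3
    have : Q - 2 ≠ 0 := by linarith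
    have h5 : 1 - α = (Q - 2) / (2 * (Q - 1)) := by
      have : Q - 1 ≠ 0 := by linarith
      rw [hα']; field_simp; ring
    have : Q - 1 ≠ 0 := by linarith
    rw [h5, hα', hs']; field_simp
  have hcover : ∫⁻ z, ‖u z‖ₑ ^ s ≤ ENNReal.ofReal (2 ^ s) * B := by
    have hsub : ∫⁻ z, ‖u z‖ₑ ^ s ≤ ∫⁻ z in ⋃ j, A j, ‖u z‖ₑ ^ s := by
      rw [← lintegral_indicator (MeasurableSet.iUnion hAm)]
      refine lintegral_mono fun z => ?_
      by_cases hz : u z = 0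
      · simp [hz, hs0]
      · obtain ⟨j, hj1, hj2⟩ := exists_nat_pow_near_of_lt_one (x := |u z| / T) (y := 1 / 2)
          (by positivity) ((div_le_one hT0).2 (hT z).le) (by norm_num) (by norm_num)
        rw [lt_div_iff₀ hT0, mul_comm] at hj1
        rw [div_le_iff₀ hT0, mul_comm] at hj2
        rw [indicator_of_mem (mem_iUnion.2 ⟨j + 1, show z ∈ A (j + 1) from ⟨hj1, (ht2 j) ▸ hj2⟩⟩)]
    refine hsub.trans ?_
    rw [lintegral_iUnion hAm hAd, hB, ← ENNReal.tsum_mul_left]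
    refine ENNReal.tsum_le_tsum fun j => ?_
    calc ∫⁻ z in A j, ‖u z‖ₑ ^ s ≤ ∫⁻ _ in A j, ENNReal.ofReal (2 ^ s * t j ^ s) := by
          refine setLIntegral_mono' (hAm j) fun z hz => ?_
          rw [← ofReal_norm, ENNReal.ofReal_rpow_of_nonneg (norm_nonneg _) hs0.le,
            ← Real.mul_rpow (by norm_num) (htpos j).le]
          exact ENNReal.ofReal_le_ofReal (Real.rpow_le_rpow (norm_nonneg _) hz.2 hs0.le)
      _ = ENNReal.ofReal (2 ^ s) * ENNReal.ofReal (t j ^ s) * volume (A j) := by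
          rw [setLIntegral_const, ENNReal.ofReal_mul (by positivity)]
      _ ≤ _ := by
          rw [mul_assoc]
          exact mul_le_mul' le_rfl (mul_le_mul' le_rfl (measure_mono fun z hz => hz.1.le))
  refine hcover.trans ?_
  rw [ENNReal.ofReal_mul (by positivity), mul_assoc]
  gcongr

end Grushin

namespace Grushin

/-! ### Weak sequential compactness in Hilbert spaces -/

/-- Sequential Banach–Alaoglu in the dual, carried back by the Riesz isomorphism; separability makes
the dual ball weak-* sequentially compact. -/
lemma exists_subseq_tendsto_inner {E : Type*} [NormedAddCommGroup E] [InnerProductSpace ℝ E]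
    [CompleteSpace E] [TopologicalSpace.SeparableSpace E] {x : ℕ → E} {C : ℝ}
    (hx : ∀ k, ‖x k‖ ≤ C) :
    ∃ (v : E) (κ : ℕ → ℕ), StrictMono κ ∧
      ∀ w, Tendsto (fun k => inner ℝ (x (κ k)) w) atTop (𝓝 (inner ℝ v w)) := by
  have hmem : ∀ k, StrongDual.toWeakDual (InnerProductSpace.toDual ℝ E (x k)) ∈
      (WeakDual.toStrongDual ⁻¹' Metric.closedBall (0 : StrongDual ℝ E) C :
        Set (WeakDual ℝ E)) := by
    intro k
    simp only [mem_preimage, Metric.mem_closedBall, dist_zero_right]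
    exact ((InnerProductSpace.toDual ℝ E).norm_map (x k)).le.trans (hx k)
  obtain ⟨a, _, κ, hκ, ha⟩ := WeakDual.isSeqCompact_closedBall ℝ E 0 C hmem
  refine ⟨(InnerProductSpace.toDual ℝ E).symm (WeakDual.toStrongDual a), κ, hκ, fun w => ?_⟩
  have h := ((WeakDual.eval_continuous w).tendsto a).comp ha
  rw [InnerProductSpace.toDual_symm_apply]
  exact h

/-- A closed subspace of a Hilbert space is weakly sequentially closed. -/
lemma mem_of_tendsto_inner {E : Type*} [NormedAddCommGroup E] [InnerProductSpace ℝ E]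
    [CompleteSpace E] {K : Submodule ℝ E} (hK : IsClosed (K : Set E)) {x : ℕ → E}
    (hx : ∀ k, x k ∈ K) {v : E}
    (hv : ∀ w, Tendsto (fun k => inner ℝ (x k) w) atTop (𝓝 (inner ℝ v w))) : v ∈ K := by
  rw [← hK.submodule_topologicalClosure_eq, ← Submodule.orthogonal_orthogonal_eq_closure,
    Submodule.mem_orthogonal]
  intro w hw
  have h := hv w
  have h0 : ∀ k, inner ℝ (x k) w = 0 := fun k => hw (x k) (hx k)
  simp only [h0] at h
  rw [real_inner_comm]
  exact tendsto_nhds_unique h tendsto_const_nhds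

lemma secondCountable_L2 {X F : Type*} [MeasurableSpace X] [MeasurableSpace.CountablyGenerated X]
    (μ : Measure X) [SFinite μ] [NormedAddCommGroup F] [TopologicalSpace.SeparableSpace F] :
    SecondCountableTopology (Lp F 2 μ) := by
  have : Fact ((2 : ℝ≥0∞) ≠ ⊤) := ⟨by simp⟩
  exact inferInstance

/-! ### The space `H10` -/

section Tests

variable {n m : ℕ} {γ : ℝ} {Ω : Set (Pt n m)} {φ ψ : Pt n m → ℝ}

lemma IsTest.differentiable (h : IsTest Ω φ) : Differentiable ℝ φ :=
  h.contDiff.differentiable (by simp)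

lemma IsTest.add (hφ : IsTest Ω φ) (hψ : IsTest Ω ψ) : IsTest Ω fun z => φ z + ψ z :=
  ⟨hφ.contDiff.add hψ.contDiff, hφ.hasCompactSupport.add hψ.hasCompactSupport,
    (tsupport_add φ ψ).trans (union_subset hφ.tsupport_subset hψ.tsupport_subset)⟩

lemma IsTest.smul (a : ℝ) (hφ : IsTest Ω φ) : IsTest Ω fun z => a * φ z :=
  ⟨contDiff_const.mul hφ.contDiff, hφ.hasCompactSupport.mul_left,
    (tsupport_mul_subset_right (f := fun _ => a) (g := φ)).trans hφ.tsupport_subset⟩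

lemma IsTest.zero : IsTest Ω (fun _ : Pt n m => (0 : ℝ)) :=
  ⟨contDiff_const, HasCompactSupport.zero, by
    have : tsupport (fun _ : Pt n m => (0 : ℝ)) = ∅ := tsupport_eq_empty_iff.2 rfl
    rw [this]; exact empty_subset _⟩

lemma IsTest.eq_zero (hφ : IsTest Ω φ) {z : Pt n m} (hz : z ∉ Ω) : φ z = 0 :=
  image_eq_zero_of_notMem_tsupport fun h => hz (hφ.tsupport_subset h)

lemma gradTest_eq_zero {z : Pt n m} (hφ : Differentiable ℝ φ) (hz : z ∉ tsupport φ) :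
    gradTest γ φ z = 0 := by
  rw [gradTest_eq (hφ z)]
  have : fderiv ℝ φ z = 0 :=
    image_eq_zero_of_notMem_tsupport fun h => hz (tsupport_fderiv_subset ℝ h)
  rw [this, map_zero]

lemma hasCompactSupport_gradTest (hφ : IsTest Ω φ) : HasCompactSupport (gradTest γ φ) :=
  HasCompactSupport.intro hφ.hasCompactSupport fun _ hz => gradTest_eq_zero hφ.differentiable hz

lemma IsTest.memLp (hφ : IsTest Ω φ) (p : ℝ≥0∞) : MemLp φ p (volume.restrict Ω) :=
  hφ.contDiff.continuous.memLp_of_hasCompactSupport hφ.hasCompactSupport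

lemma IsTest.continuous_grad (hγ : 0 < γ) (hφ : IsTest Ω φ) : Continuous (gradTest γ φ) :=
  continuous_gradTest hγ (hφ.contDiff.of_le (by simp))

lemma IsTest.memLp_grad (hγ : 0 < γ) (hφ : IsTest Ω φ) (p : ℝ≥0∞) :
    MemLp (gradTest γ φ) p (volume.restrict Ω) :=
  (hφ.continuous_grad hγ).memLp_of_hasCompactSupport (hasCompactSupport_gradTest hφ)

lemma gradTest_add (hφ : Differentiable ℝ φ) (hψ : Differentiable ℝ ψ) (z : Pt n m) :
    gradTest γ (fun w => φ w + ψ w) z = gradTest γ φ z + gradTest γ ψ z := by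
  rw [gradTest_eq (hφ z), gradTest_eq (hψ z), gradTest_eq (f := fun w => φ w + ψ w) ((hφ z).add (hψ z)), ← map_add]
  congr 1
  exact fderiv_add (hφ z) (hψ z)

lemma gradTest_smul (a : ℝ) (hφ : Differentiable ℝ φ) (z : Pt n m) :
    gradTest γ (fun w => a * φ w) z = a • gradTest γ φ z := by
  rw [gradTest_eq (hφ z), gradTest_eq ((hφ z).const_mul a), ← map_smul]
  congr 1
  exact fderiv_const_mul (hφ z) a

end Tests

namespace H10

variable {n m : ℕ} {γ : ℝ} {Ω : Set (Pt n m)}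

lemma norm_def (v : H10 γ Ω) : ‖v‖ = ‖grad v‖ := rfl

lemma inner_def (v w : H10 γ Ω) : inner ℝ v w = inner ℝ (grad v) (grad w) := rfl

lemma coe_add (v w : H10 γ Ω) : (v + w : H10 γ Ω) =ᵐ[volume.restrict Ω] fun z => v z + w z := by
  rw [map_add]; exact Lp.coeFn_add _ _

lemma coe_sub (v w : H10 γ Ω) : (v - w : H10 γ Ω) =ᵐ[volume.restrict Ω] fun z => v z - w z := by
  rw [map_sub]; exact Lp.coeFn_sub _ _

lemma coe_smul (a : ℝ) (v : H10 γ Ω) :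
    (a • v : H10 γ Ω) =ᵐ[volume.restrict Ω] fun z => a * v z := by
  rw [map_smul]; exact Lp.coeFn_smul _ _

lemma aestronglyMeasurable (v : H10 γ Ω) : AEStronglyMeasurable v (volume.restrict Ω) :=
  Lp.aestronglyMeasurable _

/-- `Φ ∈ H10` is the class of the test function `φ`. -/
structure IsClass (Φ : H10 γ Ω) (φ : Pt n m → ℝ) : Prop where
  isTest : IsTest Ω φ
  coe_eq : Φ =ᵐ[volume.restrict Ω] φ
  grad_eq : Φ.grad =ᵐ[volume.restrict Ω] gradTest γ φ

lemma exists_isClass (hγ : 0 < γ) {φ : Pt n m → ℝ} (hφ : IsTest Ω φ) :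
    ∃ Φ : H10 γ Ω, IsClass Φ φ := by
  refine ⟨⟨((hφ.memLp 2).toLp φ, (hφ.memLp_grad hγ 2).toLp (gradTest γ φ)),
    Submodule.le_topologicalClosure _ (Submodule.subset_span ⟨φ, hφ, ?_, ?_⟩)⟩, hφ, ?_, ?_⟩
  · exact (hφ.memLp 2).coeFn_toLp
  · exact (hφ.memLp_grad hγ 2).coeFn_toLp
  · exact (hφ.memLp 2).coeFn_toLp
  · exact (hφ.memLp_grad hγ 2).coeFn_toLp

/-- Test functions are dense, for the graph norm. -/
lemma exists_tendsto (v : H10 γ Ω) :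
    ∃ (Φ : ℕ → H10 γ Ω) (φ : ℕ → Pt n m → ℝ), (∀ k, IsClass (Φ k) (φ k)) ∧
      Tendsto (fun k => toL2 (Φ k)) atTop (𝓝 (toL2 v)) ∧
      Tendsto (fun k => grad (Φ k)) atTop (𝓝 (grad v)) := by
  set S := Submodule.span ℝ {q : Lp ℝ 2 (volume.restrict Ω) × Lp (Vec n m) 2 (volume.restrict Ω) |
    ∃ φ : Pt n m → ℝ, IsTest Ω φ ∧
      q.1 =ᵐ[volume.restrict Ω] φ ∧ q.2 =ᵐ[volume.restrict Ω] gradTest γ φ} with hS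
  -- Pairs coming from test functions already form a subspace, so the span in the definition adds
  -- nothing.
  have hspan : ∀ q ∈ S, ∃ φ : Pt n m → ℝ, IsTest Ω φ ∧
      q.1 =ᵐ[volume.restrict Ω] φ ∧ q.2 =ᵐ[volume.restrict Ω] gradTest γ φ := by
    intro q hq
    induction hq using Submodule.span_induction with
    | mem q hq => exact hq
    | zero =>
      refine ⟨fun _ => 0, IsTest.zero, Lp.coeFn_zero _ _ _, ?_⟩
      filter_upwards [Lp.coeFn_zero (Vec n m) 2 (volume.restrict Ω)] with z hz
      rw [gradTest_eq_zero (differentiable_const _)]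
      · exact hz
      · have : tsupport (fun _ : Pt n m => (0 : ℝ)) = ∅ := tsupport_eq_empty_iff.2 rfl
        rw [this]; exact notMem_empty z
    | add q q' _ _ h h' =>
      obtain ⟨φ, hφ, h1, h2⟩ := h
      obtain ⟨φ', hφ', h1', h2'⟩ := h'
      refine ⟨_, hφ.add hφ', ?_, ?_⟩
      · filter_upwards [h1, h1', Lp.coeFn_add q.1 q'.1] with z e1 e2 e3
        rw [Prod.fst_add, e3, Pi.add_apply, e1, e2]
      · filter_upwards [h2, h2', Lp.coeFn_add q.2 q'.2] with z e1 e2 e3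
        rw [Prod.snd_add, e3, Pi.add_apply, e1, e2,
          gradTest_add hφ.differentiable hφ'.differentiable]
    | smul a q _ h =>
      obtain ⟨φ, hφ, h1, h2⟩ := h
      refine ⟨_, hφ.smul a, ?_, ?_⟩
      · filter_upwards [h1, Lp.coeFn_smul a q.1] with z e1 e3
        rw [Prod.smul_fst, e3, Pi.smul_apply, e1, smul_eq_mul]
      · filter_upwards [h2, Lp.coeFn_smul a q.2] with z e1 e3
        rw [Prod.smul_snd, e3, Pi.smul_apply, e1, gradTest_smul a hφ.differentiable]
  have hv : (v.1 : Lp ℝ 2 (volume.restrict Ω) × Lp (Vec n m) 2 (volume.restrict Ω)) ∈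
      closure (S : Set _) := v.2
  obtain ⟨x, hxS, hx⟩ := mem_closure_iff_seq_limit.1 hv
  choose φ hφ using fun k => hspan (x k) (hxS k)
  refine ⟨fun k => ⟨x k, S.le_topologicalClosure (hxS k)⟩, φ,
    fun k => ⟨(hφ k).1, (hφ k).2.1, (hφ k).2.2⟩, ?_, ?_⟩
  · exact (continuous_fst.tendsto _).comp hx
  · exact (continuous_snd.tendsto _).comp hx

lemma exists_subseq_ae {Φ : ℕ → H10 γ Ω} {v : H10 γ Ω}
    (h : Tendsto (fun k => toL2 (Φ k)) atTop (𝓝 (toL2 v))) :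
    ∃ κ : ℕ → ℕ, StrictMono κ ∧
      ∀ᵐ z ∂volume.restrict Ω, Tendsto (fun k => Φ (κ k) z) atTop (𝓝 (v z)) :=
  (tendstoInMeasure_of_tendsto_Lp h).exists_seq_tendsto_ae

lemma IsClass.lintegral_grad {Φ : H10 γ Ω} {φ : Pt n m → ℝ} (hΩo : IsOpen Ω) (h : IsClass Φ φ) :
    ∫⁻ z, ‖gradTest γ φ z‖ₑ ^ (2 : ℝ) = ‖Φ‖ₑ ^ (2 : ℝ) := by
  have h1 : ‖Φ‖ₑ = eLpNorm Φ.grad 2 (volume.restrict Ω) := by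
    rw [← Lp.enorm_def, ← ofReal_norm, ← ofReal_norm, norm_def]
  have h2 : ∫⁻ z, ‖gradTest γ φ z‖ₑ ^ (2 : ℝ) = ∫⁻ z in Ω, ‖gradTest γ φ z‖ₑ ^ (2 : ℝ) := by
    rw [← lintegral_indicator hΩo.measurableSet]
    congr 1
    ext z
    by_cases hz : z ∈ Ω
    · rw [indicator_of_mem hz]
    · rw [indicator_of_notMem hz, gradTest_eq_zero h.isTest.differentiable
        fun h' => hz (h.isTest.tsupport_subset h')]
      simp
  rw [h1, eLpNorm_congr_ae h.grad_eq, h2, eLpNorm_eq_lintegral_rpow_enorm_toReal (by simp) (by simp),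
    ← ENNReal.rpow_mul]
  norm_num

lemma critExp_gt_two (hn : 1 ≤ n) (hm : 1 ≤ m) (hγ : 0 < γ) : 2 < critExp n m γ := by
  have hQ := one_lt_homDim_sub_one hn hm hγ
  rw [critExp, lt_div_iff₀ (by linarith)]; linarith

/-- The Sobolev inequality on `H10`. -/
theorem exists_sobolev (hn : 1 ≤ n) (hm : 1 ≤ m) (hγ : 0 < γ) (hΩo : IsOpen Ω) :
    ∃ K : ℝ, 0 ≤ K ∧ ∀ v : H10 γ Ω,
      eLpNorm v (ENNReal.ofReal (critExp n m γ)) (volume.restrict Ω) ≤ ENNReal.ofReal K * ‖v‖ₑ := by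
  obtain ⟨K, hK, h⟩ := lintegral_rpow_le_gradTest hn hm hγ
  have hs := critExp_gt_two hn hm hγ
  set s := critExp n m γ with hsdef
  have hs0 : 0 < s := by linarith
  have key : ∀ v : H10 γ Ω, ∫⁻ z in Ω, ‖v z‖ₑ ^ s ≤ ENNReal.ofReal K * ‖v‖ₑ ^ s := by
    intro v
    obtain ⟨Φ, φ, hΦ, h1, h2⟩ := exists_tendsto v
    obtain ⟨κ, hκ, hae⟩ := exists_subseq_ae h1
    have hk : ∀ k, ∫⁻ z in Ω, ‖Φ k z‖ₑ ^ s ≤ ENNReal.ofReal K * ‖Φ k‖ₑ ^ s := by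
      intro k
      have h3 := h (φ k) (hΦ k).isTest.contDiff (hΦ k).isTest.hasCompactSupport
      rw [(hΦ k).lintegral_grad hΩo, ← ENNReal.rpow_mul, mul_div_cancel₀ _ (by norm_num)] at h3
      refine le_trans ?_ h3
      rw [lintegral_congr_ae (((hΦ k).coe_eq).mono fun z hz => by rw [hz])]
      exact setLIntegral_le_lintegral _ _
    have hlim : Tendsto (fun k => ENNReal.ofReal K * ‖Φ (κ k)‖ₑ ^ s) atTop
        (𝓝 (ENNReal.ofReal K * ‖v‖ₑ ^ s)) := by
      refine ENNReal.Tendsto.const_mul ?_ (Or.inr ENNReal.ofReal_ne_top)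
      refine ((ENNReal.continuous_rpow_const (y := s)).tendsto _).comp ?_
      have h4 : Tendsto (fun k => ‖grad (Φ (κ k))‖) atTop (𝓝 ‖grad v‖) :=
        (h2.comp hκ.tendsto_atTop).norm
      have h5 := ENNReal.tendsto_ofReal h4
      simpa only [ofReal_norm, ← norm_def] using h5
    -- Fatou's lemma along an a.e. convergent sequence of test functions passes the inequality to
    -- the closure.
    calc ∫⁻ z in Ω, ‖v z‖ₑ ^ s ≤ ∫⁻ z in Ω, liminf (fun k => ‖Φ (κ k) z‖ₑ ^ s) atTop := by
          refine lintegral_mono_ae (hae.mono fun z hz => ?_)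
          have : Tendsto (fun k => ‖Φ (κ k) z‖ₑ ^ s) atTop (𝓝 (‖v z‖ₑ ^ s)) :=
            ((ENNReal.continuous_rpow_const (y := s)).tendsto _).comp hz.enorm
          exact this.liminf_eq.ge
      _ ≤ liminf (fun k => ∫⁻ z in Ω, ‖Φ (κ k) z‖ₑ ^ s) atTop :=
          lintegral_liminf_le' fun k => (aestronglyMeasurable _).enorm.pow_const _
      _ ≤ liminf (fun k => ENNReal.ofReal K * ‖Φ (κ k)‖ₑ ^ s) atTop :=
          liminf_le_liminf (Eventually.of_forall fun k => hk _)
      _ = _ := hlim.liminf_eq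
  refine ⟨K ^ (1 / s), by positivity, fun v => ?_⟩
  rw [eLpNorm_eq_lintegral_rpow_enorm_toReal (by simpa using hs0) ENNReal.ofReal_ne_top,
    ENNReal.toReal_ofReal hs0.le]
  refine (ENNReal.rpow_le_rpow (key v) (by positivity)).trans_eq ?_
  rw [ENNReal.mul_rpow_of_nonneg _ _ (by positivity), ← ENNReal.rpow_mul,
    mul_one_div_cancel hs0.ne', ENNReal.rpow_one, ENNReal.ofReal_rpow_of_nonneg hK (by positivity)]

lemma isFiniteMeasure_restrict (hΩb : Bornology.IsBounded Ω) :
    IsFiniteMeasure (volume.restrict Ω) :=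
  ⟨by rw [Measure.restrict_apply_univ]; exact hΩb.measure_lt_top⟩

lemma memLp_critExp (hn : 1 ≤ n) (hm : 1 ≤ m) (hγ : 0 < γ) (hΩo : IsOpen Ω) (v : H10 γ Ω) :
    MemLp v (ENNReal.ofReal (critExp n m γ)) (volume.restrict Ω) := by
  obtain ⟨K, hK, h⟩ := exists_sobolev hn hm hγ hΩo
  exact ⟨aestronglyMeasurable v, (h v).trans_lt (ENNReal.mul_lt_top ENNReal.ofReal_lt_top
    enorm_lt_top)⟩

/-- Poincaré's inequality. -/
theorem exists_poincare (hn : 1 ≤ n) (hm : 1 ≤ m) (hγ : 0 < γ) (hΩo : IsOpen Ω)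
    (hΩb : Bornology.IsBounded Ω) :
    ∃ K : ℝ, 0 ≤ K ∧ ∀ v : H10 γ Ω, ‖toL2 v‖ ≤ K * ‖v‖ := by
  obtain ⟨K, hK, h⟩ := exists_sobolev (Ω := Ω) hn hm hγ hΩo
  have hs := critExp_gt_two hn hm hγ
  have := isFiniteMeasure_restrict hΩb
  -- The constant of Hölder's inequality between L² and L^(2*) on a set of finite measure: Poincaré
  -- is deduced from Sobolev.
  set c : ℝ≥0∞ := (volume.restrict Ω) univ ^
    (1 / (2 : ℝ≥0∞).toReal - 1 / (ENNReal.ofReal (critExp n m γ)).toReal) with hc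
  have hctop : c ≠ ⊤ := by
    refine ENNReal.rpow_ne_top_of_nonneg ?_ (measure_ne_top _ _)
    rw [ENNReal.toReal_ofReal (by linarith), sub_nonneg]
    simp only [ENNReal.toReal_ofNat]
    gcongr
  refine ⟨K * c.toReal, by positivity, fun v => ?_⟩
  have h1 := eLpNorm_le_eLpNorm_mul_rpow_measure_univ (p := 2)
    (q := ENNReal.ofReal (critExp n m γ)) (by
      rw [show (2 : ℝ≥0∞) = ENNReal.ofReal 2 by simp]; exact ENNReal.ofReal_le_ofReal hs.le)
    (aestronglyMeasurable v)
  have h2 : ‖toL2 v‖ₑ ≤ ENNReal.ofReal (K * c.toReal * ‖v‖) := by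
    rw [Lp.enorm_def]
    refine h1.trans ?_
    rw [ENNReal.ofReal_mul (by positivity), ENNReal.ofReal_mul hK, ENNReal.ofReal_toReal hctop,
      ofReal_norm]
    calc _ ≤ ENNReal.ofReal K * ‖v‖ₑ * c := by gcongr; exact h v
      _ = _ := by ring
  rw [← ofReal_norm] at h2
  exact (ENNReal.ofReal_le_ofReal_iff (by positivity)).1 h2

/-- Bounded sequences have subsequences that converge weakly, together with their classes in
`L²`. -/
lemma exists_subseq_weak (hn : 1 ≤ n) (hm : 1 ≤ m) (hγ : 0 < γ) (hΩo : IsOpen Ω)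
    (hΩb : Bornology.IsBounded Ω) {x : ℕ → H10 γ Ω} {C : ℝ} (hx : ∀ k, ‖x k‖ ≤ C) :
    ∃ (v : H10 γ Ω) (κ : ℕ → ℕ), StrictMono κ ∧
      (∀ w, Tendsto (fun k => inner ℝ (x (κ k)) w) atTop (𝓝 (inner ℝ v w))) ∧
      ∀ f : Lp ℝ 2 (volume.restrict Ω),
        Tendsto (fun k => inner ℝ (toL2 (x (κ k))) f) atTop (𝓝 (inner ℝ (toL2 v) f)) := by
  obtain ⟨K, hK, hP⟩ := exists_poincare (Ω := Ω) hn hm hγ hΩo hΩb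
  -- Functions and gradients are tracked together in one Hilbert space. Poincaré bounds the pairs
  -- there, and the graph closure, a closed subspace, contains the weak limit. Testing with (0, ∇w)
  -- and with (f, 0) separates the two claims.
  let E := WithLp 2 (Lp ℝ 2 (volume.restrict Ω) × Lp (Vec n m) 2 (volume.restrict Ω))
  let y : ℕ → E := fun k => WithLp.toLp 2 (toL2 (x k), grad (x k))
  have : SecondCountableTopology (Lp ℝ 2 (volume.restrict Ω)) := secondCountable_L2 _
  have : SecondCountableTopology (Lp (Vec n m) 2 (volume.restrict Ω)) := secondCountable_L2 _
  have : TopologicalSpace.SeparableSpace E := inferInstance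
  have hy : ∀ k, ‖y k‖ ≤ (K + 1) * C := by
    intro k
    have h1 : ‖y k‖ ^ 2 = ‖toL2 (x k)‖ ^ 2 + ‖grad (x k)‖ ^ 2 := WithLp.prod_norm_sq_eq_of_L2 _
    have h2 := hP (x k)
    have h3 : ‖grad (x k)‖ = ‖x k‖ := rfl
    have h4 : ‖y k‖ ≤ (K + 1) * ‖x k‖ := by
      refine le_of_sq_le_sq ?_ (by positivity)
      rw [h1, h3]
      nlinarith [norm_nonneg (toL2 (x k)), norm_nonneg (x k), mul_nonneg hK (sq_nonneg ‖x k‖)]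
    exact h4.trans (by gcongr; exact hx k)
  obtain ⟨q, κ, hκ, hq⟩ := exists_subseq_tendsto_inner hy
  let G : Submodule ℝ E := (graphClosure γ Ω).comap (WithLp.linearEquiv 2 ℝ _).toLinearMap
  have hG : IsClosed (G : Set E) :=
    (Submodule.isClosed_topologicalClosure _).preimage (WithLp.prod_continuous_ofLp 2 _ _)
  have hqG : q ∈ G := mem_of_tendsto_inner hG (fun k => (x (κ k)).2) hq
  refine ⟨⟨q.ofLp, hqG⟩, κ, hκ, fun w => ?_, fun f => ?_⟩
  · have h : Tendsto (fun k => inner ℝ (toL2 (x (κ k))) 0 + inner ℝ (grad (x (κ k))) (grad w)) atTop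
        (𝓝 (inner ℝ q.ofLp.1 0 + inner ℝ q.ofLp.2 (grad w))) := hq (WithLp.toLp 2 (0, grad w))
    simp only [inner_zero_right, zero_add] at h
    exact h
  · have h : Tendsto (fun k => inner ℝ (toL2 (x (κ k))) f + inner ℝ (grad (x (κ k))) 0) atTop
        (𝓝 (inner ℝ q.ofLp.1 f + inner ℝ q.ofLp.2 0)) := hq (WithLp.toLp 2 (f, 0))
    simp only [inner_zero_right, add_zero] at h
    exact h

end H10

end Grushin

namespace Grushin

/-! ### Compactness of the embedding into `L²` -/

lemma sq_lintegral_le {X : Type*} [MeasurableSpace X] {μ : Measure X} {f : X → ℝ≥0∞}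
    (hf : AEMeasurable f μ) : (∫⁻ x, f x ∂μ) ^ (2 : ℝ) ≤ μ univ * ∫⁻ x, f x ^ (2 : ℝ) ∂μ := by
  have h := ENNReal.lintegral_mul_le_Lp_mul_Lq μ Real.HolderConjugate.two_two
    (f := fun _ => (1 : ℝ≥0∞)) aemeasurable_const hf
  simp only [Pi.mul_apply, one_mul, ENNReal.one_rpow, lintegral_one] at h
  have h2 := ENNReal.rpow_le_rpow h (show (0 : ℝ) ≤ 2 by norm_num)
  rw [ENNReal.mul_rpow_of_nonneg _ _ (by norm_num), ← ENNReal.rpow_mul, ← ENNReal.rpow_mul] at h2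
  norm_num at h2 ⊢
  exact h2

variable {n m : ℕ} {γ : ℝ} {Ω : Set (Pt n m)} {φ : Pt n m → ℝ}

/-- Away from x = 0 the Grushin gradient controls the full differential, the y part at the price
ρ^(-γ). -/
lemma abs_fderiv_apply_le (hγ : 0 < γ) (hφ : Differentiable ℝ φ) {ρ : ℝ} (hρ : 0 < ρ)
    {w : Pt n m} (hw : ρ ≤ ‖w.1‖) (h : Pt n m) :
    ‖fderiv ℝ φ w h‖ ≤ (1 + ρ ^ (-γ)) * ‖h‖ * ‖gradTest γ φ w‖ := by
  have e : fderiv ℝ φ w h = fderiv ℝ (fun x => φ (x, w.2)) w.1 h.1 +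
      fderiv ℝ (fun y => φ (w.1, y)) w.2 h.2 := by
    rw [(hasFDerivAt_slice_fst (hφ w)).fderiv, (hasFDerivAt_slice_snd (hφ w)).fderiv,
      ContinuousLinearMap.comp_apply, ContinuousLinearMap.comp_apply, ← map_add]
    simp
  have h1 : ‖fderiv ℝ (fun x => φ (x, w.2)) w.1 h.1‖ ≤ ‖gradTest γ φ w‖ * ‖h‖ :=
    ((fderiv ℝ (fun x => φ (x, w.2)) w.1).le_opNorm _).trans
      (mul_le_mul (norm_fderiv_slice_fst_le φ w) (norm_fst_le h) (norm_nonneg _) (norm_nonneg _))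
  have h2 : ‖fderiv ℝ (fun y => φ (w.1, y)) w.2‖ ≤ ρ ^ (-γ) * ‖gradTest γ φ w‖ := by
    have h3 := norm_fderiv_slice_snd_le hγ φ w
    have h4 : ρ ^ γ * ‖fderiv ℝ (fun y => φ (w.1, y)) w.2‖ ≤ ‖gradTest γ φ w‖ :=
      le_trans (by gcongr) h3
    rw [Real.rpow_neg hρ.le, inv_mul_eq_div, le_div_iff₀ (by positivity)]
    linarith
  have h5 : ‖fderiv ℝ (fun y => φ (w.1, y)) w.2 h.2‖ ≤ ρ ^ (-γ) * ‖gradTest γ φ w‖ * ‖h‖ :=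
    ((fderiv ℝ (fun y => φ (w.1, y)) w.2).le_opNorm _).trans
      (mul_le_mul h2 (norm_snd_le h) (norm_nonneg _) (by positivity))
  rw [e]
  refine (norm_add_le _ _).trans ?_
  linarith

/-- Translation estimate at a point away from `x = 0`. -/
lemma enorm_translate_sub_sq_le (hγ : 0 < γ) (hφ : ContDiff ℝ ∞ φ) {ρ : ℝ} (hρ : 0 < ρ)
    {z h : Pt n m} (hz : 2 * ρ ≤ ‖z.1‖) (hh : ‖h‖ ≤ ρ) :
    ‖φ (z + h) - φ z‖ₑ ^ (2 : ℝ) ≤ ENNReal.ofReal ((1 + ρ ^ (-γ)) * ‖h‖) ^ (2 : ℝ) *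
      ∫⁻ t in Ioc (0 : ℝ) 1, ‖gradTest γ φ (z + t • h)‖ₑ ^ (2 : ℝ) := by
  have hd : ∀ t : ℝ, HasDerivAt (fun t : ℝ => φ (z + t • h)) (fderiv ℝ φ (z + t • h) h) t := by
    intro t
    have h1 : HasDerivAt (fun t : ℝ => z + t • h) h t := by
      simpa using ((hasDerivAt_id t).smul_const h).const_add z
    exact (hφ.differentiable (by simp) _).hasFDerivAt.comp_hasDerivAt t h1
  have hcont : Continuous fun t : ℝ => fderiv ℝ φ (z + t • h) h :=
    ((hφ.continuous_fderiv (by simp)).comp (by fun_prop)).clm_apply continuous_const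
  have hftc := intervalIntegral.integral_eq_sub_of_hasDerivAt (a := 0) (b := 1)
    (fun t _ => hd t) (hcont.intervalIntegrable _ _)
  simp only [one_smul, zero_smul, add_zero] at hftc
  have hgc : Continuous fun t : ℝ => gradTest γ φ (z + t • h) :=
    (continuous_gradTest hγ (hφ.of_le (by simp))).comp (by fun_prop)
  have h1 : ‖φ (z + h) - φ z‖ₑ ≤ ENNReal.ofReal ((1 + ρ ^ (-γ)) * ‖h‖) *
      ∫⁻ t in Ioc (0 : ℝ) 1, ‖gradTest γ φ (z + t • h)‖ₑ := by
    rw [← hftc, intervalIntegral.integral_of_le zero_le_one]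
    refine (enorm_integral_le_lintegral_enorm _).trans ?_
    rw [← lintegral_const_mul _ hgc.enorm.measurable]
    refine setLIntegral_mono' measurableSet_Ioc fun t ht => ?_
    rw [← ofReal_norm, ← ofReal_norm, ← ENNReal.ofReal_mul (by positivity)]
    apply ENNReal.ofReal_le_ofReal
    refine abs_fderiv_apply_le hγ (hφ.differentiable (by simp)) hρ ?_ h
    -- The segment from z to z + h stays in |x| ≥ ρ, because it starts in |x| ≥ 2ρ and has length at
    -- most ρ.
    have h3 : ‖(t • h).1‖ ≤ ρ := by
      refine (norm_fst_le _).trans ?_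
      rw [norm_smul, Real.norm_of_nonneg ht.1.le]
      exact (mul_le_of_le_one_left (norm_nonneg _) ht.2).trans hh
    have h4 : ‖z.1‖ ≤ ‖(z + t • h).1‖ + ‖(t • h).1‖ := by
      simpa using norm_sub_le (z.1 + (t • h).1) ((t • h).1)
    linarith
  refine (ENNReal.rpow_le_rpow h1 (by norm_num)).trans ?_
  rw [ENNReal.mul_rpow_of_nonneg _ _ (by norm_num)]
  gcongr
  have h2 := sq_lintegral_le (μ := volume.restrict (Ioc (0 : ℝ) 1))
    hgc.enorm.measurable.aemeasurable
  simpa using h2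

/-- Integrate the pointwise estimate in z, exchange the integrals and use translation invariance of
the measure. -/
lemma lintegral_translate_sub_sq_le (hγ : 0 < γ) (hφ : ContDiff ℝ ∞ φ) {ρ : ℝ} (hρ : 0 < ρ)
    {h : Pt n m} (hh : ‖h‖ ≤ ρ) :
    ∫⁻ z in {z : Pt n m | 2 * ρ ≤ ‖z.1‖}, ‖φ (z + h) - φ z‖ₑ ^ (2 : ℝ) ≤
      ENNReal.ofReal ((1 + ρ ^ (-γ)) * ‖h‖) ^ (2 : ℝ) *
        ∫⁻ z, ‖gradTest γ φ z‖ₑ ^ (2 : ℝ) := by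
  have hgc : Continuous (gradTest γ φ) := continuous_gradTest hγ (hφ.of_le (by simp))
  have hm2 : Measurable fun q : Pt n m × ℝ => ‖gradTest γ φ (q.1 + q.2 • h)‖ₑ ^ (2 : ℝ) :=
    (hgc.comp (by fun_prop : Continuous fun q : Pt n m × ℝ => q.1 + q.2 • h)).enorm.measurable.pow_const _
  have hms : MeasurableSet {z : Pt n m | 2 * ρ ≤ ‖z.1‖} :=
    measurableSet_le measurable_const measurable_fst.norm
  calc ∫⁻ z in {z : Pt n m | 2 * ρ ≤ ‖z.1‖}, ‖φ (z + h) - φ z‖ₑ ^ (2 : ℝ)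
      ≤ ∫⁻ z in {z : Pt n m | 2 * ρ ≤ ‖z.1‖}, ENNReal.ofReal ((1 + ρ ^ (-γ)) * ‖h‖) ^ (2 : ℝ) *
        ∫⁻ t in Ioc (0 : ℝ) 1, ‖gradTest γ φ (z + t • h)‖ₑ ^ (2 : ℝ) :=
        setLIntegral_mono' hms fun z hz => enorm_translate_sub_sq_le hγ hφ hρ hz hh
    _ ≤ ∫⁻ z, ENNReal.ofReal ((1 + ρ ^ (-γ)) * ‖h‖) ^ (2 : ℝ) *
        ∫⁻ t in Ioc (0 : ℝ) 1, ‖gradTest γ φ (z + t • h)‖ₑ ^ (2 : ℝ) :=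
        setLIntegral_le_lintegral _ _
    _ = ENNReal.ofReal ((1 + ρ ^ (-γ)) * ‖h‖) ^ (2 : ℝ) *
        ∫⁻ t in Ioc (0 : ℝ) 1, ∫⁻ z, ‖gradTest γ φ (z + t • h)‖ₑ ^ (2 : ℝ) := by
        rw [lintegral_const_mul _ hm2.lintegral_prod_right', lintegral_lintegral_swap hm2.aemeasurable]
    _ = _ := by
        congr 1
        have : (volume : Measure (Pt n m)).IsAddHaarMeasure := inferInstanceAs
          ((volume : Measure (EuclideanSpace ℝ (Fin n))).prod
            (volume : Measure (EuclideanSpace ℝ (Fin m)))).IsAddHaarMeasure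
        have : ∀ t : ℝ, ∫⁻ z, ‖gradTest γ φ (z + t • h)‖ₑ ^ (2 : ℝ) =
            ∫⁻ z, ‖gradTest γ φ z‖ₑ ^ (2 : ℝ) := fun t =>
          lintegral_add_right_eq_self (fun z => ‖gradTest γ φ z‖ₑ ^ (2 : ℝ)) (t • h)
        rw [lintegral_congr fun t => this t]
        simp

/-- Comparison of a test function with its local averages. -/
lemma lintegral_sq_le_averages (hγ : 0 < γ) (hφ : ContDiff ℝ ∞ φ) {ρ ε : ℝ} (hρ : 0 < ρ)
    (hερ : ε ≤ ρ) {A : Set (Pt n m)} (hAρ : A ⊆ {z | 2 * ρ ≤ ‖z.1‖}) :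
    volume (Metric.ball (0 : Pt n m) ε) ^ (2 : ℝ) * ∫⁻ z in A, ‖φ z‖ₑ ^ (2 : ℝ) ≤
      2 * volume (Metric.ball (0 : Pt n m) ε) ^ (2 : ℝ) *
        (ENNReal.ofReal ((1 + ρ ^ (-γ)) * ε) ^ (2 : ℝ) * ∫⁻ z, ‖gradTest γ φ z‖ₑ ^ (2 : ℝ)) +
      2 * ∫⁻ z in A, ‖∫ h in Metric.ball (0 : Pt n m) ε, φ (z + h)‖ₑ ^ (2 : ℝ) := by
  set B := Metric.ball (0 : Pt n m) ε with hB
  set b := volume B with hb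
  have hbtop : b ≠ ⊤ := measure_ball_lt_top.ne
  have hc2 : Continuous fun q : Pt n m × Pt n m => φ (q.1 + q.2) :=
    hφ.continuous.comp continuous_add
  have hS : Measurable fun z => ‖∫ h in B, φ (z + h)‖ₑ ^ (2 : ℝ) :=
    (hc2.stronglyMeasurable.integral_prod_right (ν := volume.restrict B)).measurable.enorm.pow_const _
  have hm3 : Measurable fun q : Pt n m × Pt n m => ‖φ (q.1 + q.2) - φ q.1‖ₑ ^ (2 : ℝ) :=
    (hc2.sub (hφ.continuous.comp continuous_fst)).enorm.measurable.pow_const _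
  -- Here b φ(z) is the integral of φ(z + h) over the ball minus that of φ(z + h) - φ(z). The second
  -- is squared by Cauchy–Schwarz.
  have hpt : ∀ z, b ^ (2 : ℝ) * ‖φ z‖ₑ ^ (2 : ℝ) ≤
      2 * (b * ∫⁻ h in B, ‖φ (z + h) - φ z‖ₑ ^ (2 : ℝ)) +
        2 * ‖∫ h in B, φ (z + h)‖ₑ ^ (2 : ℝ) := by
    intro z
    have hcz : Continuous fun h => φ (z + h) := hφ.continuous.comp (by fun_prop)
    have hint : IntegrableOn (fun h => φ (z + h)) B :=
      (hcz.continuousOn.integrableOn_compact (isCompact_closedBall 0 ε)).mono_set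
        Metric.ball_subset_closedBall
    have e1 : ∫ h in B, φ z = (∫ h in B, φ (z + h)) - ∫ h in B, (φ (z + h) - φ z) := by
      rw [integral_sub hint (integrableOn_const hbtop)]; ring
    have e2 : b * ‖φ z‖ₑ ≤ (∫⁻ h in B, ‖φ (z + h) - φ z‖ₑ) + ‖∫ h in B, φ (z + h)‖ₑ := by
      have : ‖∫ h in B, φ z‖ₑ = b * ‖φ z‖ₑ := by
        rw [setIntegral_const, enorm_smul, measureReal_def, Real.enorm_of_nonneg
          ENNReal.toReal_nonneg, ENNReal.ofReal_toReal hbtop]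
      rw [← this, e1, add_comm]
      refine (enorm_sub_le).trans ?_
      gcongr
      exact enorm_integral_le_lintegral_enorm _
    have e3 : (∫⁻ h in B, ‖φ (z + h) - φ z‖ₑ) ^ (2 : ℝ) ≤
        b * ∫⁻ h in B, ‖φ (z + h) - φ z‖ₑ ^ (2 : ℝ) := by
      have := sq_lintegral_le (μ := volume.restrict B) (f := fun h => ‖φ (z + h) - φ z‖ₑ)
        (hcz.sub continuous_const).enorm.measurable.aemeasurable
      simpa using this
    calc b ^ (2 : ℝ) * ‖φ z‖ₑ ^ (2 : ℝ) = (b * ‖φ z‖ₑ) ^ (2 : ℝ) :=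
          (ENNReal.mul_rpow_of_nonneg _ _ (by norm_num)).symm
      _ ≤ ((∫⁻ h in B, ‖φ (z + h) - φ z‖ₑ) + ‖∫ h in B, φ (z + h)‖ₑ) ^ (2 : ℝ) := by gcongr
      _ ≤ 2 ^ ((2 : ℝ) - 1) * ((∫⁻ h in B, ‖φ (z + h) - φ z‖ₑ) ^ (2 : ℝ) +
            ‖∫ h in B, φ (z + h)‖ₑ ^ (2 : ℝ)) :=
          ENNReal.rpow_add_le_mul_rpow_add_rpow _ _ (by norm_num)
      _ ≤ _ := by
          norm_num only [ENNReal.rpow_one]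
          rw [mul_add]
          gcongr
  have hswap : ∫⁻ z in A, ∫⁻ h in B, ‖φ (z + h) - φ z‖ₑ ^ (2 : ℝ) ≤
      b * (ENNReal.ofReal ((1 + ρ ^ (-γ)) * ε) ^ (2 : ℝ) *
        ∫⁻ z, ‖gradTest γ φ z‖ₑ ^ (2 : ℝ)) := by
    rw [lintegral_lintegral_swap hm3.aemeasurable]
    calc _ ≤ ∫⁻ _ in B, ENNReal.ofReal ((1 + ρ ^ (-γ)) * ε) ^ (2 : ℝ) *
          ∫⁻ z, ‖gradTest γ φ z‖ₑ ^ (2 : ℝ) := by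
          refine setLIntegral_mono' measurableSet_ball fun h hh => ?_
          have hh' : ‖h‖ < ε := by simpa [hB] using hh
          refine (lintegral_mono_set hAρ).trans
            ((lintegral_translate_sub_sq_le hγ hφ hρ (hh'.le.trans hερ)).trans ?_)
          gcongr
      _ = _ := by rw [setLIntegral_const, mul_comm]
  calc b ^ (2 : ℝ) * ∫⁻ z in A, ‖φ z‖ₑ ^ (2 : ℝ)
      = ∫⁻ z in A, b ^ (2 : ℝ) * ‖φ z‖ₑ ^ (2 : ℝ) := by
        rw [lintegral_const_mul _ (hφ.continuous.enorm.measurable.pow_const _)]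
    _ ≤ ∫⁻ z in A, (2 * (b * ∫⁻ h in B, ‖φ (z + h) - φ z‖ₑ ^ (2 : ℝ)) +
        2 * ‖∫ h in B, φ (z + h)‖ₑ ^ (2 : ℝ)) := lintegral_mono hpt
    _ = 2 * (b * ∫⁻ z in A, ∫⁻ h in B, ‖φ (z + h) - φ z‖ₑ ^ (2 : ℝ)) +
        2 * ∫⁻ z in A, ‖∫ h in B, φ (z + h)‖ₑ ^ (2 : ℝ) := by
        have hm4 : Measurable fun z => ∫⁻ h in B, ‖φ (z + h) - φ z‖ₑ ^ (2 : ℝ) :=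
          hm3.lintegral_prod_right'
        rw [lintegral_add_right _ (hS.const_mul 2), lintegral_const_mul _ (hm4.const_mul b),
          lintegral_const_mul _ hm4, lintegral_const_mul _ hS]
    _ ≤ 2 * (b * (b * (ENNReal.ofReal ((1 + ρ ^ (-γ)) * ε) ^ (2 : ℝ) *
        ∫⁻ z, ‖gradTest γ φ z‖ₑ ^ (2 : ℝ)))) +
        2 * ∫⁻ z in A, ‖∫ h in B, φ (z + h)‖ₑ ^ (2 : ℝ) := by gcongr
    _ = _ := by
        have : b ^ (2 : ℝ) = b * b := by rw [ENNReal.rpow_two, sq]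
        rw [this]; ring

end Grushin

/-! ### Rellich's theorem for the degenerate gradient -/

namespace Grushin
namespace H10

variable {n m : ℕ} {γ : ℝ} {Ω : Set (Pt n m)}

/-- The strips decrease to a part of {x = 0}, which is a null set because n ≥ 1. -/
lemma tendsto_volume_strip (hn : 1 ≤ n) (hΩo : IsOpen Ω) (hΩb : Bornology.IsBounded Ω) :
    Tendsto (fun j : ℕ => volume (Ω ∩ {z : Pt n m | ‖z.1‖ < 2 * (1 / ((j : ℝ) + 1))})) atTop
      (𝓝 0) := by
  have : Nonempty (Fin n) := ⟨⟨0, hn⟩⟩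
  have hm : ∀ j : ℕ, MeasurableSet (Ω ∩ {z : Pt n m | ‖z.1‖ < 2 * (1 / ((j : ℝ) + 1))}) := fun j =>
    hΩo.measurableSet.inter (measurableSet_lt measurable_fst.norm measurable_const)
  have hanti : Antitone fun j : ℕ => Ω ∩ {z : Pt n m | ‖z.1‖ < 2 * (1 / ((j : ℝ) + 1))} := by
    intro i j hij z hz
    have h1 : ‖z.1‖ < 2 * (1 / ((j : ℝ) + 1)) := hz.2
    have h2 : (i : ℝ) ≤ j := by exact_mod_cast hij
    have h3 : 2 * (1 / ((j : ℝ) + 1)) ≤ 2 * (1 / ((i : ℝ) + 1)) := by gcongr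
    exact ⟨hz.1, show ‖z.1‖ < 2 * (1 / ((i : ℝ) + 1)) from lt_of_lt_of_le h1 h3⟩
  have h := tendsto_measure_iInter_atTop (μ := volume) (fun j => (hm j).nullMeasurableSet) hanti
    ⟨0, ((measure_mono inter_subset_left).trans_lt hΩb.measure_lt_top).ne⟩
  suffices h0 : volume (⋂ j : ℕ, Ω ∩ {z : Pt n m | ‖z.1‖ < 2 * (1 / ((j : ℝ) + 1))}) = 0 by
    rw [h0] at h
    exact h
  refine measure_mono_null (t := ({0} : Set (EuclideanSpace ℝ (Fin n))) ×ˢ univ) ?_ ?_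
  · intro z hz
    rw [mem_iInter] at hz
    refine ⟨?_, mem_univ _⟩
    rw [mem_singleton_iff, ← norm_eq_zero]
    refine le_antisymm ?_ (norm_nonneg _)
    have h1 : Tendsto (fun j : ℕ => 2 * (1 / ((j : ℝ) + 1))) atTop (𝓝 (2 * 0)) :=
      tendsto_one_div_add_atTop_nhds_zero_nat.const_mul 2
    rw [mul_zero] at h1
    exact ge_of_tendsto' h1 fun j => (hz j).2.le
  · rw [Measure.volume_eq_prod, Measure.prod_prod, measure_singleton, zero_mul]

/-- Local integrals are pairings with fixed L² functions, so weak convergence in L² makes them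
converge at every point. -/
lemma IsClass.inner_indicator {Φ : H10 γ Ω} {φ : Pt n m → ℝ}
    (h : IsClass Φ φ) (z : Pt n m) {ε : ℝ} (hfin : (volume.restrict Ω) (Metric.ball z ε) ≠ ⊤) :
    inner ℝ (toL2 Φ) (indicatorConstLp 2 (measurableSet_ball (x := z) (ε := ε)) hfin (1 : ℝ)) =
      ∫ w in Metric.ball (0 : Pt n m) ε, φ (z + w) := by
  have : (volume : Measure (Pt n m)).IsAddHaarMeasure := inferInstanceAs
    ((volume : Measure (EuclideanSpace ℝ (Fin n))).prod
      (volume : Measure (EuclideanSpace ℝ (Fin m)))).IsAddHaarMeasure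
  rw [real_inner_comm, L2.inner_indicatorConstLp_one,
    integral_congr_ae (ae_restrict_of_ae h.coe_eq), Measure.restrict_restrict measurableSet_ball,
    ← setIntegral_eq_of_subset_of_forall_sdiff_eq_zero (t := Metric.ball z ε) measurableSet_ball
      inter_subset_left fun w hw => h.isTest.eq_zero fun h' => hw.2 ⟨hw.1, h'⟩,
    ← integral_indicator measurableSet_ball, ← integral_indicator measurableSet_ball,
    ← integral_add_left_eq_self _ z]
  congr 1
  ext w
  by_cases hw : w ∈ Metric.ball (0 : Pt n m) ε
  · rw [indicator_of_mem hw, indicator_of_mem]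
    simpa [dist_eq_norm] using hw
  · rw [indicator_of_notMem hw, indicator_of_notMem]
    simpa [dist_eq_norm] using hw

/-- Rellich's theorem, for classes of test functions. -/
lemma tendsto_lintegral_of_weak_test (hn : 1 ≤ n) (hm : 1 ≤ m) (hγ : 0 < γ) (hΩo : IsOpen Ω)
    (hΩb : Bornology.IsBounded Ω) {Φ : ℕ → H10 γ Ω} {φ : ℕ → Pt n m → ℝ}
    (hΦ : ∀ k, IsClass (Φ k) (φ k)) {C : ℝ} (hC : ∀ k, ‖Φ k‖ ≤ C)
    (hw : ∀ f : Lp ℝ 2 (volume.restrict Ω),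
      Tendsto (fun k => inner ℝ (toL2 (Φ k)) f) atTop (𝓝 0)) :
    Tendsto (fun k => ∫⁻ z in Ω, ‖φ k z‖ₑ ^ (2 : ℝ)) atTop (𝓝 0) := by
  obtain ⟨K, hK, hS⟩ := exists_sobolev (Ω := Ω) hn hm hγ hΩo
  obtain ⟨P, hP, hPo⟩ := exists_poincare (Ω := Ω) hn hm hγ hΩo hΩb
  have hfinm := isFiniteMeasure_restrict hΩb
  have hs := critExp_gt_two hn hm hγ
  set s := critExp n m γ with hsdef
  have hC0 : 0 ≤ C := (norm_nonneg _).trans (hC 0)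
  have hCe : ∀ k, ‖Φ k‖ₑ ≤ ENNReal.ofReal C := fun k => by
    rw [← ofReal_norm]; exact ENNReal.ofReal_le_ofReal (hC k)
  rw [ENNReal.tendsto_nhds_zero]
  intro η hη
  -- One third each for the strip around x = 0, the translation error and the local averages.
  obtain ⟨η', hη', hη3⟩ : ∃ η' : ℝ≥0∞, 0 < η' ∧ η' + (η' + η') ≤ η := by
    refine ⟨η / 3, ENNReal.div_pos hη.ne' (by simp), ?_⟩
    rw [← add_assoc, ENNReal.add_thirds]
  -- the strip around the degenerate set
  have hstrip : Tendsto (fun j : ℕ => (ENNReal.ofReal K * ENNReal.ofReal C *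
      volume (Ω ∩ {z : Pt n m | ‖z.1‖ < 2 * (1 / ((j : ℝ) + 1))}) ^ (1 / 2 - 1 / s)) ^ (2 : ℝ))
      atTop (𝓝 0) := by
    have he : 0 < 1 / 2 - 1 / s := by
      rw [sub_pos]; gcongr
    have h1 := ((ENNReal.continuous_rpow_const (y := 1 / 2 - 1 / s)).tendsto _).comp
      (tendsto_volume_strip hn hΩo hΩb)
    rw [ENNReal.zero_rpow_of_pos he] at h1
    have h2 := ENNReal.Tendsto.const_mul (a := ENNReal.ofReal K * ENNReal.ofReal C) h1
      (Or.inr (ENNReal.mul_ne_top ENNReal.ofReal_ne_top ENNReal.ofReal_ne_top))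
    rw [mul_zero] at h2
    have h3 := ((ENNReal.continuous_rpow_const (y := 2)).tendsto _).comp h2
    rwa [ENNReal.zero_rpow_of_pos (by norm_num)] at h3
  obtain ⟨j, hj⟩ := (((ENNReal.tendsto_nhds_zero.1 hstrip) η' hη').exists)
  set ρ : ℝ := 1 / ((j : ℝ) + 1) with hρ
  have hρ0 : 0 < ρ := by positivity
  set A₁ := Ω ∩ {z : Pt n m | ‖z.1‖ < 2 * ρ} with hA₁
  set A₂ := Ω ∩ {z : Pt n m | 2 * ρ ≤ ‖z.1‖} with hA₂
  -- No translation estimate is available on the strip; the uniform L^(2*) bound and Hölder make the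
  -- L² mass there small with its volume.
  have hA₁b : ∀ k, ∫⁻ z in A₁, ‖φ k z‖ₑ ^ (2 : ℝ) ≤ η' := by
    intro k
    refine le_trans ?_ hj
    have h1 := eLpNorm_le_eLpNorm_mul_rpow_measure_univ (μ := volume.restrict A₁) (p := 2)
      (q := ENNReal.ofReal s) (f := φ k) (by
        rw [show (2 : ℝ≥0∞) = ENNReal.ofReal 2 by simp]; exact ENNReal.ofReal_le_ofReal hs.le)
      (hΦ k).isTest.contDiff.continuous.aestronglyMeasurable
    have h2 : eLpNorm (φ k) (ENNReal.ofReal s) (volume.restrict A₁) ≤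
        ENNReal.ofReal K * ENNReal.ofReal C := by
      calc _ ≤ eLpNorm (φ k) (ENNReal.ofReal s) (volume.restrict Ω) :=
            eLpNorm_mono_measure _ (Measure.restrict_mono inter_subset_left le_rfl)
        _ = eLpNorm (Φ k) (ENNReal.ofReal s) (volume.restrict Ω) :=
            (eLpNorm_congr_ae (hΦ k).coe_eq).symm
        _ ≤ ENNReal.ofReal K * ‖Φ k‖ₑ := hS _
        _ ≤ _ := by gcongr; exact hCe k
    rw [ENNReal.toReal_ofReal (by linarith), Measure.restrict_apply_univ, ENNReal.toReal_ofNat] at h1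
    have h3 : ∫⁻ z in A₁, ‖φ k z‖ₑ ^ (2 : ℝ) =
        eLpNorm (φ k) 2 (volume.restrict A₁) ^ (2 : ℝ) := by
      rw [eLpNorm_eq_lintegral_rpow_enorm_toReal (by simp) (by simp), ← ENNReal.rpow_mul]
      norm_num
    rw [h3]
    gcongr
    exact h1.trans (by gcongr)
  -- the scale of averaging
  set M : ℝ := 1 + ρ ^ (-γ) with hM
  have hMpos : 0 < M := by positivity
  obtain ⟨ε, hε0, hερ, hεη⟩ : ∃ ε : ℝ, 0 < ε ∧ ε ≤ ρ ∧
      2 * (ENNReal.ofReal (M * ε) ^ (2 : ℝ) * ENNReal.ofReal C ^ (2 : ℝ)) ≤ η' := by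
    have h1 : Tendsto (fun ε : ℝ =>
        2 * (ENNReal.ofReal (M * ε) ^ (2 : ℝ) * ENNReal.ofReal C ^ (2 : ℝ))) (𝓝[>] 0) (𝓝 0) := by
      have h2 : Tendsto (fun ε : ℝ => ENNReal.ofReal (M * ε) ^ (2 : ℝ)) (𝓝[>] 0) (𝓝 0) := by
        have h3 : Continuous fun ε : ℝ => ENNReal.ofReal (M * ε) ^ (2 : ℝ) :=
          (ENNReal.continuous_rpow_const).comp (ENNReal.continuous_ofReal.comp (by fun_prop))
        have h4 := h3.tendsto 0
        rw [mul_zero, ENNReal.ofReal_zero, ENNReal.zero_rpow_of_pos (by norm_num)] at h4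
        exact h4.mono_left nhdsWithin_le_nhds
      have h5 := ENNReal.Tendsto.mul_const (b := ENNReal.ofReal C ^ (2 : ℝ)) h2
        (Or.inr (ENNReal.rpow_ne_top_of_nonneg (by norm_num) ENNReal.ofReal_ne_top))
      rw [zero_mul] at h5
      have h6 := ENNReal.Tendsto.const_mul (a := 2) h5 (Or.inr (by simp))
      rwa [mul_zero] at h6
    obtain ⟨ε, h2, h3⟩ := (((ENNReal.tendsto_nhds_zero.1 h1) η' hη').and
      (Ioc_mem_nhdsGT hρ0)).exists
    exact ⟨ε, h3.1, h3.2, h2⟩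
  set b := volume (Metric.ball (0 : Pt n m) ε) with hb
  have hb0 : b ^ (2 : ℝ) ≠ 0 :=
    (ENNReal.rpow_pos (Metric.measure_ball_pos _ _ hε0) measure_ball_lt_top.ne).ne'
  have hbtop : b ^ (2 : ℝ) ≠ ⊤ := ENNReal.rpow_ne_top_of_nonneg (by norm_num) measure_ball_lt_top.ne
  set T : ℕ → ℝ≥0∞ := fun k => ∫⁻ z in Ω, ‖∫ h in Metric.ball (0 : Pt n m) ε, φ k (z + h)‖ₑ ^ (2 : ℝ)
    with hT
  -- At fixed radius the averages tend to 0 pointwise and are uniformly bounded by Poincaré, so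
  -- dominated convergence applies.
  have hTlim : Tendsto T atTop (𝓝 0) := by
    have hfin : ∀ z : Pt n m, (volume.restrict Ω) (Metric.ball z ε) ≠ ⊤ := fun z => measure_ne_top _ _
    have hlim : ∀ z : Pt n m, Tendsto (fun k => ‖∫ h in Metric.ball (0 : Pt n m) ε, φ k (z + h)‖ₑ ^ (2 : ℝ))
        atTop (𝓝 0) := by
      intro z
      have h1 := hw (indicatorConstLp 2 (measurableSet_ball (x := z) (ε := ε)) (hfin z) 1)
      simp only [fun k => (hΦ k).inner_indicator z (hfin z)] at h1
      have h2 := ((ENNReal.continuous_rpow_const (y := 2)).tendsto _).comp h1.enorm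
      simpa [Function.comp_def] using h2
    have hbd : ∀ k (z : Pt n m), ‖∫ h in Metric.ball (0 : Pt n m) ε, φ k (z + h)‖ₑ ^ (2 : ℝ) ≤
        ENNReal.ofReal (P * C * (volume.restrict Ω).real univ ^ (1 / 2 : ℝ)) ^ (2 : ℝ) := by
      intro k z
      gcongr
      rw [← (hΦ k).inner_indicator z (hfin z), ← ofReal_norm]
      apply ENNReal.ofReal_le_ofReal
      refine (norm_inner_le_norm _ _).trans ?_
      rw [norm_indicatorConstLp (by simp) (by simp)]
      simp only [norm_one, one_mul, ENNReal.toReal_ofNat]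
      gcongr
      · exact (hPo _).trans (by gcongr; exact hC k)
      · exact measure_ne_top _ _
      · exact subset_univ _
    have hmeas : ∀ k, Measurable fun z : Pt n m =>
        ‖∫ h in Metric.ball (0 : Pt n m) ε, φ k (z + h)‖ₑ ^ (2 : ℝ) := fun k => by
      have hc : Continuous fun q : Pt n m × Pt n m => φ k (q.1 + q.2) :=
        (hΦ k).isTest.contDiff.continuous.comp continuous_add
      exact (hc.stronglyMeasurable.integral_prod_right'
        (ν := volume.restrict (Metric.ball (0 : Pt n m) ε))).measurable.enorm.pow_const _
    have h := tendsto_lintegral_of_dominated_convergence (μ := volume.restrict Ω) (f := fun _ => 0)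
      (fun _ => ENNReal.ofReal (P * C * (volume.restrict Ω).real univ ^ (1 / 2 : ℝ)) ^ (2 : ℝ))
      hmeas (fun k => Eventually.of_forall (hbd k)) (by
        rw [lintegral_const]
        exact ENNReal.mul_ne_top (ENNReal.rpow_ne_top_of_nonneg (by norm_num) ENNReal.ofReal_ne_top)
          (measure_ne_top _ _)) (Eventually.of_forall hlim)
    simp only [lintegral_zero] at h
    exact h
  have hTlim2 : Tendsto (fun k => 2 * ((b ^ (2 : ℝ))⁻¹ * T k)) atTop (𝓝 0) := by
    have h1 := ENNReal.Tendsto.const_mul (a := (b ^ (2 : ℝ))⁻¹) hTlim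
      (Or.inr (ENNReal.inv_ne_top.2 hb0))
    rw [mul_zero] at h1
    have h2 := ENNReal.Tendsto.const_mul (a := 2) h1 (Or.inr (by simp))
    rwa [mul_zero] at h2
  filter_upwards [(ENNReal.tendsto_nhds_zero.1 hTlim2) η' hη'] with k hk
  have hA₂b : ∫⁻ z in A₂, ‖φ k z‖ₑ ^ (2 : ℝ) ≤ η' + η' := by
    have h1 := lintegral_sq_le_averages hγ (hΦ k).isTest.contDiff hρ0 hερ (A := A₂) inter_subset_right
    rw [(hΦ k).lintegral_grad hΩo] at h1
    have h2 : b ^ (2 : ℝ) * ∫⁻ z in A₂, ‖φ k z‖ₑ ^ (2 : ℝ) ≤ b ^ (2 : ℝ) *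
        (2 * (ENNReal.ofReal (M * ε) ^ (2 : ℝ) * ENNReal.ofReal C ^ (2 : ℝ)) +
          2 * ((b ^ (2 : ℝ))⁻¹ * T k)) := by
      refine h1.trans ?_
      rw [mul_add]
      refine add_le_add ?_ ?_
      · rw [mul_comm 2 (b ^ (2 : ℝ)), mul_assoc]
        gcongr
        exact hCe k
      · rw [mul_left_comm, ← mul_assoc (b ^ (2 : ℝ)), ENNReal.mul_inv_cancel hb0 hbtop, one_mul]
        gcongr
        exact lintegral_mono_set inter_subset_left
    exact ((ENNReal.mul_le_mul_iff_right hb0 hbtop).1 h2).trans (add_le_add hεη hk)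
  have hcov : Ω ⊆ A₁ ∪ A₂ := fun z hz => by
    by_cases h : ‖z.1‖ < 2 * ρ
    · exact Or.inl ⟨hz, h⟩
    · exact Or.inr ⟨hz, not_lt.1 h⟩
  calc ∫⁻ z in Ω, ‖φ k z‖ₑ ^ (2 : ℝ) ≤ ∫⁻ z in A₁ ∪ A₂, ‖φ k z‖ₑ ^ (2 : ℝ) :=
        lintegral_mono_set hcov
    _ ≤ (∫⁻ z in A₁, ‖φ k z‖ₑ ^ (2 : ℝ)) + ∫⁻ z in A₂, ‖φ k z‖ₑ ^ (2 : ℝ) :=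
        lintegral_union_le _ _ _
    _ ≤ η' + (η' + η') := add_le_add (hA₁b k) hA₂b
    _ ≤ η := hη3

/-- Rellich's theorem: bounded sequences in `H10` that converge weakly to `0` in `L²` converge
strongly in `L²`. -/
theorem tendsto_norm_toL2_of_weak (hn : 1 ≤ n) (hm : 1 ≤ m) (hγ : 0 < γ) (hΩo : IsOpen Ω)
    (hΩb : Bornology.IsBounded Ω) {x : ℕ → H10 γ Ω} {C : ℝ} (hC : ∀ k, ‖x k‖ ≤ C)
    (hw : ∀ f : Lp ℝ 2 (volume.restrict Ω),
      Tendsto (fun k => inner ℝ (toL2 (x k)) f) atTop (𝓝 0)) :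
    Tendsto (fun k => ‖toL2 (x k)‖) atTop (𝓝 0) := by
  -- A test function within 1 / (k + 1) of x k in the graph norm has the same weak and strong limits
  -- in L².
  have happrox : ∀ k : ℕ, ∃ (Φ : H10 γ Ω) (φ : Pt n m → ℝ), IsClass Φ φ ∧
      ‖toL2 Φ - toL2 (x k)‖ < 1 / ((k : ℝ) + 1) ∧ ‖grad Φ - grad (x k)‖ < 1 / ((k : ℝ) + 1) := by
    intro k
    obtain ⟨Φ, φ, hΦ, h1, h2⟩ := exists_tendsto (x k)
    have hpos : (0 : ℝ) < 1 / ((k : ℝ) + 1) := by positivity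
    obtain ⟨j, hj1, hj2⟩ := ((Metric.tendsto_nhds.1 h1 _ hpos).and
      (Metric.tendsto_nhds.1 h2 _ hpos)).exists
    exact ⟨Φ j, φ j, hΦ j, by rwa [← dist_eq_norm], by rwa [← dist_eq_norm]⟩
  choose Φ φ hΦ h1 h2 using happrox
  have hdiff : Tendsto (fun k => toL2 (Φ k) - toL2 (x k)) atTop (𝓝 0) :=
    squeeze_zero_norm (fun k => (h1 k).le) tendsto_one_div_add_atTop_nhds_zero_nat
  have hΦC : ∀ k, ‖Φ k‖ ≤ C + 1 := by
    intro k
    have h3 : ‖grad (Φ k)‖ ≤ ‖grad (Φ k) - grad (x k)‖ + ‖grad (x k)‖ := by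
      simpa using norm_add_le (grad (Φ k) - grad (x k)) (grad (x k))
    have h4 : 1 / ((k : ℝ) + 1) ≤ 1 := by
      rw [div_le_one (by positivity)]; linarith [(Nat.cast_nonneg k : (0 : ℝ) ≤ k)]
    have h5 := hC k
    rw [norm_def] at h5 ⊢
    linarith [h2 k]
  have hwΦ : ∀ f : Lp ℝ 2 (volume.restrict Ω),
      Tendsto (fun k => inner ℝ (toL2 (Φ k)) f) atTop (𝓝 0) := by
    intro f
    have h3 : Tendsto (fun k => inner ℝ (toL2 (Φ k) - toL2 (x k)) f) atTop (𝓝 (inner ℝ 0 f)) :=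
      hdiff.inner tendsto_const_nhds
    have h4 := h3.add (hw f)
    simpa [inner_sub_left] using h4
  have h3 := tendsto_lintegral_of_weak_test hn hm hγ hΩo hΩb hΦ hΦC hwΦ
  have h4 : Tendsto (fun k => ‖toL2 (Φ k)‖) atTop (𝓝 0) := by
    have h5 : ∀ k, ‖toL2 (Φ k)‖ = ((∫⁻ z in Ω, ‖φ k z‖ₑ ^ (2 : ℝ)) ^ (1 / 2 : ℝ)).toReal := by
      intro k
      rw [Lp.norm_def, eLpNorm_congr_ae (hΦ k).coe_eq,
        eLpNorm_eq_lintegral_rpow_enorm_toReal (by simp) (by simp)]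
      simp
    simp only [h5]
    have h6 := ((ENNReal.continuous_rpow_const (y := 1 / 2)).tendsto _).comp h3
    rw [ENNReal.zero_rpow_of_pos (by norm_num)] at h6
    exact (ENNReal.tendsto_toReal ENNReal.zero_ne_top).comp h6
  refine squeeze_zero (fun _ => norm_nonneg _) (fun k => ?_)
    (g := fun k => ‖toL2 (Φ k)‖ + ‖toL2 (Φ k) - toL2 (x k)‖) (by simpa using h4.add hdiff.norm)
  have := norm_sub_le (toL2 (Φ k)) (toL2 (Φ k) - toL2 (x k))
  simpa using this

/-- Bounded sequences in `H10` have subsequences that converge weakly in `H10`, strongly in `L²`,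
and almost everywhere. -/
theorem exists_subseq_compact (hn : 1 ≤ n) (hm : 1 ≤ m) (hγ : 0 < γ) (hΩo : IsOpen Ω)
    (hΩb : Bornology.IsBounded Ω) {x : ℕ → H10 γ Ω} {C : ℝ} (hC : ∀ k, ‖x k‖ ≤ C) :
    ∃ (v : H10 γ Ω) (κ : ℕ → ℕ), StrictMono κ ∧
      (∀ w, Tendsto (fun k => inner ℝ (x (κ k)) w) atTop (𝓝 (inner ℝ v w))) ∧
      Tendsto (fun k => toL2 (x (κ k))) atTop (𝓝 (toL2 v)) ∧
      ∀ᵐ z ∂volume.restrict Ω, Tendsto (fun k => x (κ k) z) atTop (𝓝 (v z)) := by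
  obtain ⟨v, κ, hκ, h1, h2⟩ := exists_subseq_weak hn hm hγ hΩo hΩb hC
  have h3 : Tendsto (fun k => ‖toL2 (x (κ k) - v)‖) atTop (𝓝 0) := by
    refine tendsto_norm_toL2_of_weak hn hm hγ hΩo hΩb (x := fun k => x (κ k) - v) (C := C + ‖v‖)
      (fun k => (norm_sub_le _ _).trans (by gcongr; exact hC _)) fun f => ?_
    have h4 := (h2 f).sub_const (inner ℝ (toL2 v) f)
    simpa only [map_sub, inner_sub_left, sub_self] using h4
  have h5 : Tendsto (fun k => toL2 (x (κ k))) atTop (𝓝 (toL2 v)) := by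
    rw [tendsto_iff_norm_sub_tendsto_zero]
    simpa only [map_sub] using h3
  obtain ⟨κ', hκ', hae⟩ := exists_subseq_ae (Φ := fun k => x (κ k)) h5
  exact ⟨v, κ ∘ κ', hκ.comp hκ', fun w => (h1 w).comp hκ'.tendsto_atTop,
    h5.comp hκ'.tendsto_atTop, hae⟩

end H10
end Grushin

namespace Grushin
namespace H10

variable {n m : ℕ} {γ : ℝ} {Ω : Set (Pt n m)}

/-! ### The gradient is determined by the function -/

/-- The field E is chosen so that pairing ∇_γ φ with it gives θ ∂_d φ. Integration by parts turns
this into minus the pairing of φ with ∂_d θ, which survives in the graph closure and vanishes when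
the function does. -/
lemma integral_inner_grad_eq_zero {v : H10 γ Ω} (hv : toL2 v = 0)
    {E : Pt n m → Vec n m} (hE : Continuous E) (hEc : HasCompactSupport E) {θ : Pt n m → ℝ}
    (hθ : ContDiff ℝ ∞ θ) (hθc : HasCompactSupport θ) (d : Pt n m)
    (h : ∀ φ : Pt n m → ℝ, IsTest Ω φ → ∀ z,
      inner ℝ (gradTest γ φ z) (E z) = θ z * fderiv ℝ φ z d) :
    ∫ z in Ω, inner ℝ (v.grad z) (E z) = 0 := by
  have : (volume : Measure (Pt n m)).IsAddHaarMeasure := inferInstanceAs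
    ((volume : Measure (EuclideanSpace ℝ (Fin n))).prod
      (volume : Measure (EuclideanSpace ℝ (Fin m)))).IsAddHaarMeasure
  obtain ⟨Φ, φ, hΦ, h1, h2⟩ := exists_tendsto v
  have hEm : MemLp E 2 (volume.restrict Ω) := hE.memLp_of_hasCompactSupport hEc
  have hdc : Continuous fun z => fderiv ℝ θ z d :=
    (hθ.continuous_fderiv (by simp)).clm_apply continuous_const
  have hds : HasCompactSupport fun z => fderiv ℝ θ z d := hθc.fderiv_apply ℝ d
  have hdm : MemLp (fun z => fderiv ℝ θ z d) 2 (volume.restrict Ω) :=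
    hdc.memLp_of_hasCompactSupport hds
  have hparts : ∀ k, inner ℝ (grad (Φ k)) (hEm.toLp E) = - inner ℝ (toL2 (Φ k)) (hdm.toLp fun z => fderiv ℝ θ z d) := by
    intro k
    have hφ := (hΦ k).isTest
    have hφd : Continuous fun z => fderiv ℝ (φ k) z d :=
      (hφ.contDiff.continuous_fderiv (by simp)).clm_apply continuous_const
    have e1 : inner ℝ (grad (Φ k)) (hEm.toLp E) = ∫ z, θ z * fderiv ℝ (φ k) z d := by
      refine Eq.trans (b := ∫ z in Ω, θ z * fderiv ℝ (φ k) z d) ?_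
        (setIntegral_eq_integral_of_forall_compl_eq_zero ?_)
      · rw [L2.inner_def]
        refine integral_congr_ae ?_
        filter_upwards [(hΦ k).grad_eq, hEm.coeFn_toLp] with z e1 e2
        rw [e1, e2, h _ hφ]
      · intro z hz
        rw [image_eq_zero_of_notMem_tsupport fun h' => hz
          (hφ.tsupport_subset (tsupport_fderiv_apply_subset ℝ d h')), mul_zero]
    have e2 : inner ℝ (toL2 (Φ k)) (hdm.toLp fun z => fderiv ℝ θ z d) = ∫ z, fderiv ℝ θ z d * φ k z := by
      refine Eq.trans (b := ∫ z in Ω, fderiv ℝ θ z d * φ k z) ?_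
        (setIntegral_eq_integral_of_forall_compl_eq_zero ?_)
      · rw [L2.inner_def]
        refine integral_congr_ae ?_
        filter_upwards [(hΦ k).coe_eq, hdm.coeFn_toLp] with z e1 e2
        rw [e1, e2]
        rfl
      · intro z hz
        rw [hφ.eq_zero hz, mul_zero]
    rw [e1, e2]
    exact integral_mul_fderiv_eq_neg_fderiv_mul_of_integrable
      ((hdc.mul hφ.contDiff.continuous).integrable_of_hasCompactSupport hds.mul_right)
      ((hθ.continuous.mul hφd).integrable_of_hasCompactSupport hθc.mul_right)
      ((hθ.continuous.mul hφ.contDiff.continuous).integrable_of_hasCompactSupport hθc.mul_right)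
      (fun z _ => hθ.differentiable (by simp) z) (fun z _ => hφ.differentiable z)
  have hl1 : Tendsto (fun k => inner ℝ (grad (Φ k)) (hEm.toLp E)) atTop
      (𝓝 (inner ℝ (grad v) (hEm.toLp E))) := h2.inner tendsto_const_nhds
  have hl2 : Tendsto (fun k => - inner ℝ (toL2 (Φ k)) (hdm.toLp fun z => fderiv ℝ θ z d)) atTop (𝓝 (-0)) := by
    refine Tendsto.neg ?_
    rw [hv] at h1
    simpa using h1.inner (tendsto_const_nhds (x := hdm.toLp fun z => fderiv ℝ θ z d))
  simp only [hparts] at hl1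
  have h3 := tendsto_nhds_unique hl1 hl2
  rw [neg_zero, L2.inner_def] at h3
  rw [← h3]
  refine integral_congr_ae ?_
  filter_upwards [hEm.coeFn_toLp] with z e
  rw [e]

lemma inner_gradTest (φ : Pt n m → ℝ) (hφ : Differentiable ℝ φ) (z : Pt n m)
    (a : EuclideanSpace ℝ (Fin n)) (b : EuclideanSpace ℝ (Fin m)) :
    inner ℝ (gradTest γ φ z) (WithLp.toLp 2 (a, b)) =
      fderiv ℝ φ z (a, 0) + (1 + γ) * ‖z.1‖ ^ γ * fderiv ℝ φ z (0, b) := by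
  rw [gradTest_eq (hφ z), WithLp.prod_inner_apply]
  simp [gradOfFDeriv, inner_smul_left, mul_assoc]

lemma integral_smul_eq_zero {U : Set (Pt n m)} (hUo : IsOpen U) (hUΩ : U ⊆ Ω) {F : Type*}
    [NormedAddCommGroup F] [InnerProductSpace ℝ F] [CompleteSpace F] {f : Pt n m → F}
    (hf : LocallyIntegrableOn f U) {θ : Pt n m → ℝ} (hθ : Continuous θ)
    (hθc : HasCompactSupport θ) (hθU : tsupport θ ⊆ U)
    (h : ∀ a : F, ∫ z in Ω, θ z * inner ℝ a (f z) = 0) : ∫ z, θ z • f z = 0 := by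
  have hi : IntegrableOn (fun z => θ z • f z) (tsupport θ) :=
    ((locallyIntegrableOn_iff hUo.isLocallyClosed).1 hf _ hθU hθc).continuousOn_smul
      hθ.continuousOn hθc
  have hi' : Integrable fun z => θ z • f z := by
    rw [← integrableOn_iff_integrable_of_support_subset (s := tsupport θ)]
    · exact hi
    · exact (Function.support_smul_subset_left _ _).trans (subset_tsupport θ)
  refine ext_inner_left ℝ fun a => ?_
  have h1 : ∫ z, inner ℝ a (θ z • f z) = ∫ z in Ω, θ z * inner ℝ a (f z) := by
    simp only [inner_smul_right]
    refine (setIntegral_eq_integral_of_forall_compl_eq_zero fun z hz => ?_).symm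
    rw [image_eq_zero_of_notMem_tsupport fun h' => hz (hUΩ (hθU h')), zero_mul]
  rw [inner_zero_right, ← integral_inner hi', h1, h a]

/-- The gradient is determined by the function. -/
theorem grad_eq_zero (hn : 1 ≤ n) (hγ : 0 < γ) (hΩo : IsOpen Ω) {v : H10 γ Ω}
    (hv : toL2 v = 0) : grad v = 0 := by
  have : Nonempty (Fin n) := ⟨⟨0, hn⟩⟩
  have : (volume : Measure (Pt n m)).IsAddHaarMeasure := inferInstanceAs
    ((volume : Measure (EuclideanSpace ℝ (Fin n))).prod
      (volume : Measure (EuclideanSpace ℝ (Fin m)))).IsAddHaarMeasure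
  -- On U the weight (1 + γ)|x| ^ γ is positive and can be divided out of the y component. What is
  -- removed is a null set.
  set U : Set (Pt n m) := Ω ∩ {z | z.1 ≠ 0} with hU
  have hUo : IsOpen U := hΩo.inter (isOpen_ne_fun continuous_fst continuous_const)
  have hgl : LocallyIntegrableOn (v.grad : Pt n m → Vec n m) Ω := by
    rw [locallyIntegrableOn_iff hΩo.isLocallyClosed]
    intro K hK hKc
    have : IsFiniteMeasure (volume.restrict K) := ⟨by simpa using hKc.measure_lt_top⟩
    exact ((Lp.memLp v.grad).mono_measure (Measure.restrict_mono hK le_rfl)).integrable (by simp)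
  have hG1 : LocallyIntegrableOn (fun z => (v.grad z).fst) U := by
    intro z hz
    obtain ⟨s, hs, hi⟩ := (hgl.mono_set inter_subset_left) z hz
    exact ⟨s, hs, (WithLp.fstL 2 ℝ (EuclideanSpace ℝ (Fin n))
      (EuclideanSpace ℝ (Fin m))).integrable_comp hi⟩
  have hG2' : LocallyIntegrableOn (fun z => (v.grad z).snd) U := by
    intro z hz
    obtain ⟨s, hs, hi⟩ := (hgl.mono_set inter_subset_left) z hz
    exact ⟨s, hs, (WithLp.sndL 2 ℝ (EuclideanSpace ℝ (Fin n))
      (EuclideanSpace ℝ (Fin m))).integrable_comp hi⟩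
  set c : Pt n m → ℝ := fun z => ((1 + γ) * ‖z.1‖ ^ γ)⁻¹ with hc
  have hpos : ∀ z ∈ U, 0 < (1 + γ) * ‖z.1‖ ^ γ := fun z hz => by
    have : 0 < ‖z.1‖ := norm_pos_iff.2 hz.2
    positivity
  have hcc : ContinuousOn c U := by
    refine ContinuousOn.inv₀ (Continuous.continuousOn ?_) fun z hz => (hpos z hz).ne'
    exact continuous_const.mul (continuous_fst.norm.rpow_const fun _ => Or.inr hγ.le)
  have hG2 : LocallyIntegrableOn (fun z => c z • (v.grad z).snd) U :=
    hG2'.continuousOn_smul hUo.isLocallyClosed hcc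
  have h1 : ∀ᵐ z, z ∈ U → (v.grad z).fst = 0 := by
    refine hUo.ae_eq_zero_of_integral_contDiff_smul_eq_zero hG1 fun θ hθ hθc hθU =>
      integral_smul_eq_zero hUo inter_subset_left hG1 hθ.continuous hθc hθU fun a => ?_
    have h2 := integral_inner_grad_eq_zero hv (E := fun z => θ z • WithLp.toLp 2 (a, 0))
      (hθ.continuous.smul continuous_const) hθc.smul_right hθ hθc (a, 0) fun φ hφ z => by
        rw [inner_smul_right, inner_gradTest φ hφ.differentiable, Prod.mk_zero_zero, map_zero,
          mul_zero, add_zero]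
    rw [← h2]
    refine integral_congr_ae (Eventually.of_forall fun z => ?_)
    simp only [inner_smul_right, WithLp.prod_inner_apply, inner_zero_right, add_zero]
    rw [real_inner_comm]
    rfl
  have h2 : ∀ᵐ z, z ∈ U → c z • (v.grad z).snd = 0 := by
    refine hUo.ae_eq_zero_of_integral_contDiff_smul_eq_zero hG2 fun θ hθ hθc hθU =>
      integral_smul_eq_zero hUo inter_subset_left hG2 hθ.continuous hθc hθU fun b => ?_
    -- The reciprocal weight c is continuous only on U, but the support of θ lies there. In
    -- `integral_inner_grad_eq_zero` the smooth factor remains θ, since c cancels the weight.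
    have hθc' : Continuous fun z => θ z * c z := by
      refine ((hθ.continuous.continuousOn).mul hcc).continuous_of_tsupport_subset hUo ?_
      exact (tsupport_mul_subset_left (f := θ) (g := c)).trans hθU
    have hcs : HasCompactSupport fun z => θ z * c z := hθc.mul_right
    have h2 := integral_inner_grad_eq_zero hv
      (E := fun z => (θ z * c z) • WithLp.toLp 2 (0, b))
      (hθc'.smul continuous_const) hcs.smul_right hθ hθc (0, b)
      fun φ hφ z => by
        rw [inner_smul_right, inner_gradTest φ hφ.differentiable, Prod.mk_zero_zero, map_zero,
          zero_add]
        by_cases hz : z ∈ U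
        · have := (hpos z hz).ne'
          rw [hc, mul_assoc, ← mul_assoc _⁻¹, inv_mul_cancel₀ this, one_mul]
        · rw [image_eq_zero_of_notMem_tsupport fun h' => hz (hθU h')]
          simp
    rw [← h2]
    refine integral_congr_ae (Eventually.of_forall fun z => ?_)
    simp only [inner_smul_right, WithLp.prod_inner_apply, inner_zero_right, zero_add]
    rw [real_inner_comm, mul_assoc]
    rfl
  have h0 : ∀ᵐ z : Pt n m, z.1 ≠ 0 := by
    have : volume {z : Pt n m | ¬ z.1 ≠ 0} = 0 := by
      refine measure_mono_null (t := ({0} : Set (EuclideanSpace ℝ (Fin n))) ×ˢ univ)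
        (fun z hz => ⟨not_not.1 hz, mem_univ _⟩) ?_
      rw [Measure.volume_eq_prod, Measure.prod_prod, measure_singleton, zero_mul]
    exact this
  refine (Lp.eq_zero_iff_ae_eq_zero).2 ?_
  filter_upwards [ae_restrict_of_ae h0, ae_restrict_of_ae h1, ae_restrict_of_ae h2,
    ae_restrict_mem hΩo.measurableSet] with z e0 e1 e2 e3
  have hzU : z ∈ U := ⟨e3, e0⟩
  have e4 := (smul_eq_zero.1 (e2 hzU)).resolve_left (inv_ne_zero (hpos z hzU).ne')
  refine (WithLp.ofLp_injective 2) (Prod.ext (e1 hzU) e4)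

lemma inner_congr_left (hn : 1 ≤ n) (hγ : 0 < γ) (hΩo : IsOpen Ω) {v w : H10 γ Ω}
    (h : v =ᵐ[volume.restrict Ω] w) (x : H10 γ Ω) : inner ℝ x v = inner ℝ x w := by
  have h1 : toL2 (v - w) = 0 := by
    rw [map_sub, sub_eq_zero]
    exact Lp.ext h
  have h2 := grad_eq_zero hn hγ hΩo h1
  rw [map_sub, sub_eq_zero] at h2
  rw [inner_def, inner_def, h2]

end H10
end Grushin

namespace Grushin

/-! ### Nonnegative elements of `H10` as test functions -/

/-- A smooth substitute for the minimum of two nonnegative numbers, equal to `a` for `a = b` up to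
the regularization by `ε`. -/
noncomputable def mix (ε a b : ℝ) : ℝ := 2 * a ^ 2 * b / (a ^ 2 + b ^ 2 + ε)

/-- This bound and the next serve two limits. With a test function as first argument, this one gives
domination of compact support; with the limit function as second argument, the next one gives
domination by that function. -/
lemma abs_mix_le_left {ε : ℝ} (hε : 0 < ε) (a b : ℝ) : |mix ε a b| ≤ |a| := by
  rw [mix, abs_div, abs_of_pos (by positivity : 0 < a ^ 2 + b ^ 2 + ε), div_le_iff₀ (by positivity),
    abs_mul, abs_mul, abs_two, abs_pow]
  have h : 0 ≤ |a| * ((|a| - |b|) ^ 2 + ε) := by positivity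
  nlinarith [sq_abs a, sq_abs b]

lemma abs_mix_le_right {ε : ℝ} (hε : 0 < ε) (a b : ℝ) : |mix ε a b| ≤ 2 * |b| := by
  rw [mix, abs_div, abs_of_pos (by positivity : 0 < a ^ 2 + b ^ 2 + ε), div_le_iff₀ (by positivity),
    abs_mul, abs_mul, abs_two, abs_pow]
  have h : 0 ≤ |b| * (b ^ 2 + ε) := by positivity
  nlinarith [sq_abs a, sq_abs b]

lemma tendsto_mix_right {ε a b : ℝ} (hε : 0 < ε) {x : ℕ → ℝ} (hx : Tendsto x atTop (𝓝 b)) :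
    Tendsto (fun k => mix ε a (x k)) atTop (𝓝 (mix ε a b)) := by
  unfold mix
  exact (hx.const_mul _).div ((tendsto_const_nhds.add (hx.pow 2)).add tendsto_const_nhds)
    (by positivity)

lemma tendsto_mix_self {a : ℝ} {x e : ℕ → ℝ} (he0 : ∀ k, 0 < e k)
    (hx : Tendsto x atTop (𝓝 a)) (he : Tendsto e atTop (𝓝 0)) :
    Tendsto (fun k => mix (e k) (x k) a) atTop (𝓝 a) := by
  rcases eq_or_ne a 0 with rfl | ha
  · refine squeeze_zero_norm (fun k => ?_) (a := fun _ => 0) tendsto_const_nhds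
    simpa using abs_mix_le_right (he0 k) (x k) 0
  · have h : Tendsto (fun k => mix (e k) (x k) a) atTop
        (𝓝 (2 * a ^ 2 * a / (a ^ 2 + a ^ 2 + 0))) := by
      unfold mix
      exact (((hx.pow 2).const_mul 2).mul_const a).div (((hx.pow 2).add_const _).add he)
        (by positivity)
    convert h using 2
    field_simp
    ring

variable {n m : ℕ} {γ : ℝ} {Ω : Set (Pt n m)}

lemma IsTest.mix {φ ψ : Pt n m → ℝ} (hφ : IsTest Ω φ) (hψ : IsTest Ω ψ) {ε : ℝ} (hε : 0 < ε) :
    IsTest Ω fun z => mix ε (φ z) (ψ z) := by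
  have hs : Function.support (fun z => Grushin.mix ε (φ z) (ψ z)) ⊆ Function.support φ := by
    intro z hz h
    apply hz
    simp only [Grushin.mix, h]
    simp
  refine ⟨?_, hφ.hasCompactSupport.mono hs, (closure_mono hs).trans hφ.tsupport_subset⟩
  unfold Grushin.mix
  exact ((contDiff_const.mul (hφ.contDiff.pow 2)).mul hψ.contDiff).div
    (((hφ.contDiff.pow 2).add (hψ.contDiff.pow 2)).add contDiff_const) fun z => by positivity

/-- Both partial derivatives of `mix` are bounded by 2, uniformly in ε, so mixing bounded sequences
of test functions gives bounded sequences in `H10`. -/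
lemma norm_gradTest_mix_le {φ ψ : Pt n m → ℝ} (hφ : Differentiable ℝ φ)
    (hψ : Differentiable ℝ ψ) {ε : ℝ} (hε : 0 < ε) (z : Pt n m) :
    ‖gradTest γ (fun w => mix ε (φ w) (ψ w)) z‖ ≤
      2 * ‖gradTest γ φ z‖ + 2 * ‖gradTest γ ψ z‖ := by
  set a := φ z with ha
  set b := ψ z with hb
  set D := a ^ 2 + b ^ 2 + ε with hD
  have hDpos : 0 < D := by positivity
  have h : HasFDerivAt (fun w => mix ε (φ w) (ψ w))
      ((4 * a * b * (b ^ 2 + ε) / D ^ 2) • fderiv ℝ φ z +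
        (2 * a ^ 2 * (a ^ 2 + ε - b ^ 2) / D ^ 2) • fderiv ℝ ψ z) z := by
    have h1 := (hφ z).hasFDerivAt
    have h2 := (hψ z).hasFDerivAt
    have hden : HasFDerivAt (fun w => φ w ^ 2 + ψ w ^ 2 + ε)
        ((2 * a) • fderiv ℝ φ z + (2 * b) • fderiv ℝ ψ z) z := by
      have h3 := (HasFDerivAt.fun_add (h1.pow 2) (h2.pow 2)).add_const ε
      refine h3.congr_fderiv (ContinuousLinearMap.ext fun w => ?_)
      simp [ha, hb]
    have hnum : HasFDerivAt (fun w => 2 * φ w ^ 2 * ψ w)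
        ((4 * a * b) • fderiv ℝ φ z + (2 * a ^ 2) • fderiv ℝ ψ z) z := by
      have h3 := ((h1.pow 2).const_mul 2).fun_mul h2
      refine h3.congr_fderiv (ContinuousLinearMap.ext fun w => ?_)
      simp [ha, hb]
      ring
    have hinv : HasFDerivAt (fun w => (φ w ^ 2 + ψ w ^ 2 + ε)⁻¹)
        ((-(D ^ 2)⁻¹) • ((2 * a) • fderiv ℝ φ z + (2 * b) • fderiv ℝ ψ z)) z :=
      (hasDerivAt_inv hDpos.ne').comp_hasFDerivAt z hden
    have hfun : (fun w => mix ε (φ w) (ψ w)) =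
        fun w => 2 * φ w ^ 2 * ψ w * (φ w ^ 2 + ψ w ^ 2 + ε)⁻¹ :=
      funext fun w => div_eq_mul_inv _ _
    rw [hfun]
    refine (HasFDerivAt.fun_mul hnum hinv).congr_fderiv (ContinuousLinearMap.ext fun w => ?_)
    simp only [add_apply, smul_apply, smul_eq_mul, ← ha, ← hb, ← hD]
    field_simp
    rw [hD]
    ring
  rw [gradTest_eq h.differentiableAt, h.fderiv, map_add, map_smul, map_smul, ← gradTest_eq (hφ z),
    ← gradTest_eq (hψ z)]
  have hab : 2 * |a| * |b| ≤ D := by nlinarith [sq_nonneg (|a| - |b|), sq_abs a, sq_abs b]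
  refine (norm_add_le _ _).trans (add_le_add ?_ ?_)
  · rw [norm_smul]
    gcongr
    rw [Real.norm_eq_abs, abs_div, abs_of_pos (by positivity : 0 < D ^ 2), div_le_iff₀ (by positivity),
      abs_mul, abs_mul, abs_mul, abs_of_pos (by positivity : 0 < b ^ 2 + ε)]
    have h5 : |(4 : ℝ)| = 4 := by norm_num
    rw [h5]
    have h6 : b ^ 2 + ε ≤ D := by rw [hD]; nlinarith [sq_nonneg a]
    calc 4 * |a| * |b| * (b ^ 2 + ε) = 2 * (2 * |a| * |b|) * (b ^ 2 + ε) := by ring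
      _ ≤ 2 * D * D := by gcongr
      _ = 2 * D ^ 2 := by ring
  · rw [norm_smul]
    gcongr
    rw [Real.norm_eq_abs, abs_div, abs_of_pos (by positivity : 0 < D ^ 2), div_le_iff₀ (by positivity),
      abs_mul, abs_of_nonneg (by positivity : 0 ≤ 2 * a ^ 2)]
    have h6 : a ^ 2 ≤ D := by rw [hD]; nlinarith [sq_nonneg b]
    have h7 : |a ^ 2 + ε - b ^ 2| ≤ D := by
      rw [abs_le, hD]; constructor <;> nlinarith [sq_nonneg b, sq_nonneg a]
    calc 2 * a ^ 2 * |a ^ 2 + ε - b ^ 2| ≤ 2 * D * D := by gcongr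
      _ = 2 * D ^ 2 := by ring

namespace H10

lemma IsClass.norm_mix_le {Φ Ψ X : H10 γ Ω} {φ ψ : Pt n m → ℝ} (hΦ : IsClass Φ φ)
    (hΨ : IsClass Ψ ψ) {ε : ℝ} (hε : 0 < ε) (hX : IsClass X fun z => mix ε (φ z) (ψ z)) :
    ‖X‖ ≤ 2 * ‖Φ‖ + 2 * ‖Ψ‖ := by
  have h1 : eLpNorm (X.grad) 2 (volume.restrict Ω) ≤
      eLpNorm (fun z => (2 : ℝ) * ‖Φ.grad z‖ + (2 : ℝ) * ‖Ψ.grad z‖) 2 (volume.restrict Ω) := by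
    refine eLpNorm_mono_ae_real ?_
    filter_upwards [hX.grad_eq, hΦ.grad_eq, hΨ.grad_eq] with z e1 e2 e3
    rw [e1, e2, e3]
    exact norm_gradTest_mix_le hΦ.isTest.differentiable hΨ.isTest.differentiable hε z
  have h2 : ∀ Y : H10 γ Ω, eLpNorm (fun z => (2 : ℝ) * ‖Y.grad z‖) 2 (volume.restrict Ω) =
      ENNReal.ofReal (2 * ‖Y‖) := by
    intro Y
    have := eLpNorm_const_smul (2 : ℝ) (fun z => ‖Y.grad z‖) 2 (volume.restrict Ω)
    rw [eLpNorm_norm, ← Lp.enorm_def, ← ofReal_norm, ← ofReal_norm, ← norm_def,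
      ← ENNReal.ofReal_mul (norm_nonneg _), Real.norm_two] at this
    exact this
  have h3 : ∀ Y : H10 γ Ω, AEStronglyMeasurable (fun z => (2 : ℝ) * ‖Y.grad z‖)
      (volume.restrict Ω) := fun Y => (Lp.aestronglyMeasurable _).norm.const_mul 2
  have h4 := h1.trans (eLpNorm_add_le (h3 Φ) (h3 Ψ) (by norm_num))
  rw [h2, h2, ← Lp.enorm_def, ← ofReal_norm, ← norm_def, ← ENNReal.ofReal_add (by positivity)
    (by positivity)] at h4
  exact (ENNReal.ofReal_le_ofReal_iff (by positivity)).1 h4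

lemma norm_le_of_tendsto_inner {E : Type*} [SeminormedAddCommGroup E] [InnerProductSpace ℝ E]
    {x : ℕ → E} {v : E} {C : ℝ} (hC : ∀ k, ‖x k‖ ≤ C)
    (hx : ∀ w, Tendsto (fun k => inner ℝ (x k) w) atTop (𝓝 (inner ℝ v w))) : ‖v‖ ≤ C := by
  have h : inner ℝ v v ≤ C * ‖v‖ := by
    refine le_of_tendsto' (hx v) fun k => (real_inner_le_norm _ _).trans ?_
    gcongr
    exact hC k
  rw [real_inner_self_eq_norm_sq] at h
  rcases (norm_nonneg v).eq_or_lt with h0 | h0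
  · rw [← h0]; exact (norm_nonneg _).trans (hC 0)
  · nlinarith

/-- An equation in the sense of distributions may be tested with the nonnegative elements of
`H10`. -/
theorem integrable_and_equation_of_nonneg (hn : 1 ≤ n) (hm : 1 ≤ m) (hγ : 0 < γ) (hΩo : IsOpen Ω)
    (hΩb : Bornology.IsBounded Ω) {u : H10 γ Ω} {h F : Pt n m → ℝ}
    (hh : ∀ᵐ z ∂volume.restrict Ω, 0 ≤ h z) (hloc : LocallyIntegrableOn h Ω)
    (hF : ∀ w : H10 γ Ω, Integrable (fun z => F z * w z) (volume.restrict Ω))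
    (heq : ∀ φ : Pt n m → ℝ, IsTest Ω φ →
      (∫ z in Ω, inner ℝ (u.grad z) (gradTest γ φ z)) + ∫ z in Ω, h z * φ z =
        ∫ z in Ω, F z * φ z)
    {w : H10 γ Ω} (hw : ∀ᵐ z ∂volume.restrict Ω, 0 ≤ w z) :
    Integrable (fun z => h z * w z) (volume.restrict Ω) ∧
      inner ℝ u w + ∫ z in Ω, h z * w z = ∫ z in Ω, F z * w z := by
  have hclass : ∀ {X : H10 γ Ω} {φ : Pt n m → ℝ}, IsClass X φ →
      inner ℝ u X + ∫ z in Ω, h z * φ z = ∫ z in Ω, F z * φ z := by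
    intro X φ hX
    rw [← heq φ hX.isTest, inner_def, L2.inner_def]
    congr 1
    refine integral_congr_ae ?_
    filter_upwards [hX.grad_eq] with z e
    rw [e]
  have hhφ : ∀ {φ : Pt n m → ℝ}, IsTest Ω φ → Integrable (fun z => h z * φ z)
      (volume.restrict Ω) := by
    intro φ hφ
    have h1 : IntegrableOn (fun z => φ z • h z) (tsupport φ) :=
      ((locallyIntegrableOn_iff hΩo.isLocallyClosed).1 hloc _ hφ.tsupport_subset
        hφ.hasCompactSupport).continuousOn_smul hφ.contDiff.continuous.continuousOn
        hφ.hasCompactSupport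
    have h2 : Integrable (fun z => φ z • h z) := by
      rw [← integrableOn_iff_integrable_of_support_subset (s := tsupport φ)]
      · exact h1
      · exact (Function.support_smul_subset_left _ _).trans (subset_tsupport φ)
    simp only [smul_eq_mul] at h2
    exact h2.integrableOn.integrable.congr (Eventually.of_forall fun z => mul_comm _ _)
  obtain ⟨Φ', φ', hΦ', h1', h2'⟩ := exists_tendsto w
  obtain ⟨κ, hκ, hae⟩ := exists_subseq_ae h1'
  obtain ⟨C, hC⟩ : ∃ C, ∀ k, ‖Φ' k‖ ≤ C := by
    obtain ⟨C, hC⟩ := (Metric.isBounded_range_of_tendsto _ h2').exists_norm_le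
    exact ⟨C, fun k => hC _ (mem_range_self k)⟩
  set Φ := fun k => Φ' (κ k) with hΦdef
  set φ := fun k => φ' (κ k) with hφdef
  have hΦ : ∀ k, IsClass (Φ k) (φ k) := fun k => hΦ' _
  have hae' : ∀ᵐ z ∂volume.restrict Ω, Tendsto (fun k => φ k z) atTop (𝓝 (w z)) := by
    filter_upwards [hae, ae_all_iff.2 fun k => (hΦ k).coe_eq] with z e1 e2
    simpa only [← e2] using e1
  set e : ℕ → ℝ := fun j => 1 / ((j : ℝ) + 1) with he
  have he0 : ∀ j, 0 < e j := fun j => by positivity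
  -- the inner limit
  have hstep : ∀ j, ∃ W : H10 γ Ω, ‖W‖ ≤ 4 * C ∧
      (W =ᵐ[volume.restrict Ω] fun z => mix (e j) (φ j z) (w z)) ∧
      Integrable (fun z => h z * mix (e j) (φ j z) (w z)) (volume.restrict Ω) ∧
      inner ℝ u W + ∫ z in Ω, h z * mix (e j) (φ j z) (w z) =
        ∫ z in Ω, F z * mix (e j) (φ j z) (w z) := by
    intro j
    -- With j fixed and i → ∞, every mix (φ_j, φ_i) is at most |φ_j|, so |h φ_j| dominates even
    -- though h is only locally integrable.
    choose X hX using fun i => exists_isClass hγ ((hΦ j).isTest.mix (hΦ i).isTest (he0 j))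
    have hXC : ∀ i, ‖X i‖ ≤ 4 * C := fun i => by
      have h1 := (hΦ j).norm_mix_le (hΦ i) (he0 j) (hX i)
      have h2 := hC (κ j)
      have h3 := hC (κ i)
      simp only [hΦdef] at h1
      linarith
    obtain ⟨W, ι, hι, hweak, -, hWae⟩ := exists_subseq_compact hn hm hγ hΩo hΩb hXC
    have hmix : ∀ᵐ z ∂volume.restrict Ω, Tendsto (fun i => mix (e j) (φ j z) (φ (ι i) z)) atTop
        (𝓝 (mix (e j) (φ j z) (w z))) := by
      filter_upwards [hae'] with z e1
      exact tendsto_mix_right (he0 j) (e1.comp hι.tendsto_atTop)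
    have hW : W =ᵐ[volume.restrict Ω] fun z => mix (e j) (φ j z) (w z) := by
      filter_upwards [hmix, hWae, ae_all_iff.2 fun i => (hX i).coe_eq] with z e1 e2 e3
      simp only [e3] at e2
      exact tendsto_nhds_unique e2 e1
    have hmeas : ∀ i, AEStronglyMeasurable (fun z => mix (e j) (φ j z) (φ (ι i) z))
        (volume.restrict Ω) := fun i =>
      (hX (ι i)).isTest.contDiff.continuous.aestronglyMeasurable
    have hhm : AEStronglyMeasurable h (volume.restrict Ω) := hloc.aestronglyMeasurable
    have hFj : Integrable (fun z => F z * φ j z) (volume.restrict Ω) :=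
      (hF (Φ j)).congr ((hΦ j).coe_eq.mono fun z hz => by simp only [hz])
    have hlh := tendsto_integral_of_dominated_convergence (μ := volume.restrict Ω)
      (F := fun i z => h z * mix (e j) (φ j z) (φ (ι i) z))
      (f := fun z => h z * mix (e j) (φ j z) (w z)) (fun z => ‖h z * φ j z‖)
      (fun i => hhm.mul (hmeas i)) (hhφ (hΦ j).isTest).norm
      (fun i => Eventually.of_forall fun z => by
        rw [norm_mul, norm_mul]
        gcongr
        exact abs_mix_le_left (he0 j) _ _)
      (hmix.mono fun z hz => hz.const_mul _)
    have hlF := tendsto_integral_of_dominated_convergence (μ := volume.restrict Ω)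
      (F := fun i z => F z * mix (e j) (φ j z) (φ (ι i) z))
      (f := fun z => F z * mix (e j) (φ j z) (w z)) (fun z => ‖F z * φ j z‖)
      (fun i => ((hF (X (ι i))).congr ((hX (ι i)).coe_eq.mono fun z hz => by
        simp only [hz])).aestronglyMeasurable) hFj.norm
      (fun i => Eventually.of_forall fun z => by
        rw [norm_mul, norm_mul]
        gcongr
        exact abs_mix_le_left (he0 j) _ _)
      (hmix.mono fun z hz => hz.const_mul _)
    refine ⟨W, norm_le_of_tendsto_inner (fun k => hXC _) hweak, hW, ?_, ?_⟩
    · refine (hhφ (hΦ j).isTest).mono (hhm.mul ((aestronglyMeasurable W).congr hW))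
        (Eventually.of_forall fun z => ?_)
      rw [norm_mul, norm_mul]
      gcongr
      exact abs_mix_le_left (he0 j) _ _
    · have h3 : Tendsto (fun i => inner ℝ u (X (ι i))) atTop (𝓝 (inner ℝ u W)) := by
        simpa only [real_inner_comm] using hweak u
      have h4 := h3.add hlh
      simp only [fun i => hclass (hX (ι i))] at h4
      exact tendsto_nhds_unique h4 hlF
  -- The outer limit j → ∞, with regularization 1 / (j + 1): mix (φ_j, w) tends to w a.e. and is at
  -- most 2|w|.
  choose W hWC hW hWi hWeq using hstep
  obtain ⟨V, ι, hι, hweak, -, hVae⟩ := exists_subseq_compact hn hm hγ hΩo hΩb hWC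
  have hmix : ∀ᵐ z ∂volume.restrict Ω,
      Tendsto (fun i => mix (e (ι i)) (φ (ι i) z) (w z)) atTop (𝓝 (w z)) := by
    filter_upwards [hae'] with z e1
    exact tendsto_mix_self (fun _ => he0 _) (e1.comp hι.tendsto_atTop)
      (tendsto_one_div_add_atTop_nhds_zero_nat.comp hι.tendsto_atTop)
  have hV : V =ᵐ[volume.restrict Ω] w := by
    filter_upwards [hmix, hVae, ae_all_iff.2 hW] with z e1 e2 e3
    simp only [e3] at e2
    exact tendsto_nhds_unique e2 e1
  have hweak' : Tendsto (fun i => inner ℝ u (W (ι i))) atTop (𝓝 (inner ℝ u w)) := by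
    rw [← inner_congr_left hn hγ hΩo hV u]
    simpa only [real_inner_comm] using hweak u
  have hlF : Tendsto (fun i => ∫ z in Ω, F z * mix (e (ι i)) (φ (ι i) z) (w z)) atTop
      (𝓝 (∫ z in Ω, F z * w z)) := by
    refine tendsto_integral_of_dominated_convergence (μ := volume.restrict Ω)
      (fun z => 2 * ‖F z * w z‖)
      (fun i => ((hF (W (ι i))).congr ((hW (ι i)).mono fun z hz => by
        simp only [hz])).aestronglyMeasurable) ((hF w).norm.const_mul 2)
      (fun i => Eventually.of_forall fun z => ?_) (hmix.mono fun z hz => hz.const_mul _)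
    rw [norm_mul, norm_mul, mul_left_comm]
    gcongr
    exact abs_mix_le_right (he0 _) _ _
  have hhm : AEStronglyMeasurable h (volume.restrict Ω) := hloc.aestronglyMeasurable
  -- Here the signs enter: h and mix (φ_j, w) are nonnegative and the equation makes their integrals
  -- converge, so Fatou yields integrability of h w. Only then is 2|h w| available for domination.
  have hi : Integrable (fun z => h z * w z) (volume.restrict Ω) := by
    refine ⟨hhm.mul (aestronglyMeasurable w), ?_⟩
    have hlim : Tendsto (fun i => ∫ z in Ω, h z * mix (e (ι i)) (φ (ι i) z) (w z)) atTop
        (𝓝 ((∫ z in Ω, F z * w z) - inner ℝ u w)) := by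
      refine (hlF.sub hweak').congr fun i => ?_
      linarith [hWeq (ι i)]
    have h5 : ∀ i, ∫⁻ z in Ω, ‖h z * mix (e (ι i)) (φ (ι i) z) (w z)‖ₑ =
        ENNReal.ofReal (∫ z in Ω, h z * mix (e (ι i)) (φ (ι i) z) (w z)) := by
      intro i
      have h6 : ∀ᵐ z ∂volume.restrict Ω, 0 ≤ h z * mix (e (ι i)) (φ (ι i) z) (w z) := by
        filter_upwards [hh, hw] with z e1 e2
        have := he0 (ι i)
        unfold mix
        positivity
      rw [ofReal_integral_eq_lintegral_ofReal (hWi _) h6]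
      refine lintegral_congr_ae (h6.mono fun z hz => ?_)
      exact Real.enorm_of_nonneg hz
    calc ∫⁻ z in Ω, ‖h z * w z‖ₑ ≤
          ∫⁻ z in Ω, liminf (fun i => ‖h z * mix (e (ι i)) (φ (ι i) z) (w z)‖ₑ) atTop := by
          refine lintegral_mono_ae (hmix.mono fun z hz => ?_)
          exact (hz.const_mul (h z)).enorm.liminf_eq.ge
      _ ≤ liminf (fun i => ∫⁻ z in Ω, ‖h z * mix (e (ι i)) (φ (ι i) z) (w z)‖ₑ) atTop :=
          lintegral_liminf_le' fun i => (hWi _).aestronglyMeasurable.enorm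
      _ = ENNReal.ofReal ((∫ z in Ω, F z * w z) - inner ℝ u w) := by
          simp only [h5]
          exact (ENNReal.tendsto_ofReal hlim).liminf_eq
      _ < ⊤ := ENNReal.ofReal_lt_top
  refine ⟨hi, ?_⟩
  have hlh : Tendsto (fun i => ∫ z in Ω, h z * mix (e (ι i)) (φ (ι i) z) (w z)) atTop
      (𝓝 (∫ z in Ω, h z * w z)) := by
    refine tendsto_integral_of_dominated_convergence (μ := volume.restrict Ω)
      (fun z => 2 * ‖h z * w z‖) (fun i => (hWi _).aestronglyMeasurable) (hi.norm.const_mul 2)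
      (fun i => Eventually.of_forall fun z => ?_) (hmix.mono fun z hz => hz.const_mul _)
    rw [norm_mul, norm_mul, mul_left_comm]
    gcongr
    exact abs_mix_le_right (he0 _) _ _
  have h7 := hweak'.add hlh
  simp only [hWeq] at h7
  exact tendsto_nhds_unique h7 hlF

end H10
end Grushin

namespace Grushin

/-! ### The singular term along functions -/

/-- Rescaling to a fixed interval turns G into a parameter integral, whence its joint measurability.
-/
lemma GReal_eq_mul (δ a s : ℝ) : GReal δ a s = s * ∫ x in (0 : ℝ)..1, gReal δ a (s * x) := by
  rw [GReal, ← smul_eq_mul, intervalIntegral.smul_integral_comp_mul_left, mul_zero, mul_one]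

lemma measurable_GReal (δ : ℝ) : Measurable fun q : ℝ × ℝ => GReal δ q.1 q.2 := by
  simp only [GReal_eq_mul, intervalIntegral.integral_of_le zero_le_one]
  refine measurable_snd.mul ?_
  have h : Measurable fun r : (ℝ × ℝ) × ℝ => gReal δ r.1.1 (r.1.2 * r.2) := by
    unfold gReal
    fun_prop
  exact (h.stronglyMeasurable.integral_prod_right' (ν := volume.restrict (Ioc 0 1))).measurable

lemma measurable_gReal (δ : ℝ) : Measurable fun q : ℝ × ℝ => gReal δ q.1 q.2 := by
  unfold gReal
  fun_prop

variable {n m : ℕ} {γ : ℝ} {Ω : Set (Pt n m)}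

lemma toReal_gFun {δ : ℝ} {u₀ : Pt n m → ℝ} {z : Pt n m} {s : ℝ} (h : 0 < s + u₀ z) :
    (gFun δ u₀ z s).toReal = gReal δ (u₀ z) s := by
  rw [gFun, if_pos h, EReal.toReal_coe, gReal]

lemma GFun_eq {δ : ℝ} (hδ : 0 < δ) {u₀ : Pt n m → ℝ} {z : Pt n m} {s : ℝ} (h : 0 < u₀ z)
    (hs : 0 ≤ s) : GFun δ u₀ z s = ENNReal.ofReal (GReal δ (u₀ z) s) := by
  have hi : IntegrableOn (gReal δ (u₀ z)) (Ioc 0 s) :=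
    (intervalIntegrable_iff_integrableOn_Ioc_of_le hs).1
      (intervalIntegrable_gReal h le_rfl hs)
  rw [GFun, if_pos hs, GReal, intervalIntegral.integral_of_le hs,
    ofReal_integral_eq_lintegral_ofReal hi]
  · refine setLIntegral_congr_fun measurableSet_Ioc fun τ hτ => ?_
    have : 0 < τ + u₀ z := add_pos hτ.1 h
    simp only [gFun, if_pos this, EReal.real_coe_toENNReal, gReal]
  · exact ae_restrict_of_forall_mem measurableSet_Ioc fun τ hτ => gReal_nonneg hδ h hτ.1.le

/-- The common hypotheses on the data of the translated problem. -/
structure Setting (δ lam p : ℝ) (u₀ : Pt n m → ℝ) (u : H10 γ Ω) : Prop where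
  one_le_n : 1 ≤ n
  one_le_m : 1 ≤ m
  γ_pos : 0 < γ
  δ_pos : 0 < δ
  lam_pos : 0 < lam
  one_le_p : 1 ≤ p
  le_critExp : p + 1 ≤ critExp n m γ
  isOpen : IsOpen Ω
  isBounded : Bornology.IsBounded Ω
  singular : IsSingularSolution γ δ Ω u₀
  solution : IsPositiveWeakSolution δ lam p u₀ u

namespace Setting

variable {δ lam p : ℝ} {u₀ : Pt n m → ℝ} {u : H10 γ Ω}

lemma q_pos (h : Setting δ lam p u₀ u) : 0 < p + 1 := by linarith [h.one_le_p]

lemma ae_pos_u₀ (h : Setting δ lam p u₀ u) : ∀ᵐ z ∂volume.restrict Ω, 0 < u₀ z :=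
  ae_restrict_of_forall_mem h.isOpen.measurableSet h.singular.pos

lemma aestronglyMeasurable_u₀ (h : Setting δ lam p u₀ u) :
    AEStronglyMeasurable u₀ (volume.restrict Ω) :=
  h.singular.continuousOn.aestronglyMeasurable h.isOpen.measurableSet

/-- Only the functions (u₀ - ε)⁺ are assumed to lie in the space, but u₀ ≤ (u₀ - 1)⁺ + 1 on a set of
finite measure. -/
lemma memLp_u₀ (h : Setting δ lam p u₀ u) :
    MemLp u₀ (ENNReal.ofReal (critExp n m γ)) (volume.restrict Ω) := by
  have := H10.isFiniteMeasure_restrict h.isBounded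
  obtain ⟨w, hw⟩ := h.singular.boundary 1 one_pos
  have h1 := (H10.memLp_critExp h.one_le_n h.one_le_m h.γ_pos h.isOpen w).add
    (memLp_const (1 : ℝ))
  refine h1.mono h.aestronglyMeasurable_u₀ ?_
  filter_upwards [hw, h.ae_pos_u₀] with z e1 e2
  rw [Pi.add_apply, e1, Real.norm_of_nonneg e2.le, Real.norm_of_nonneg]
  · linarith [le_max_left (u₀ z - 1) 0]
  · linarith [le_max_right (u₀ z - 1) 0]

lemma memLp_add (h : Setting δ lam p u₀ u) (v : H10 γ Ω) :
    MemLp (fun z => v z + u₀ z) (ENNReal.ofReal (critExp n m γ)) (volume.restrict Ω) :=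
  (H10.memLp_critExp h.one_le_n h.one_le_m h.γ_pos h.isOpen v).add h.memLp_u₀

lemma integrable_rpow_of_memLp (h : Setting δ lam p u₀ u) {f : Pt n m → ℝ} {r : ℝ} (hr : 0 < r)
    (hrc : r ≤ critExp n m γ)
    (hf : MemLp f (ENNReal.ofReal (critExp n m γ)) (volume.restrict Ω)) :
    Integrable (fun z => |f z| ^ r) (volume.restrict Ω) := by
  have := H10.isFiniteMeasure_restrict h.isBounded
  have h1 := (hf.mono_exponent (ENNReal.ofReal_le_ofReal hrc)).integrable_norm_rpow
    (by simpa using hr) ENNReal.ofReal_ne_top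
  simpa only [ENNReal.toReal_ofReal hr.le, Real.norm_eq_abs] using h1

lemma integrable_rpow (h : Setting δ lam p u₀ u) (v : H10 γ Ω) :
    Integrable (fun z => |v z| ^ (p + 1)) (volume.restrict Ω) :=
  h.integrable_rpow_of_memLp h.q_pos h.le_critExp
    (H10.memLp_critExp h.one_le_n h.one_le_m h.γ_pos h.isOpen v)

lemma integrable_add_rpow (h : Setting δ lam p u₀ u) (v : H10 γ Ω) :
    Integrable (fun z => |v z + u₀ z| ^ (p + 1)) (volume.restrict Ω) :=
  h.integrable_rpow_of_memLp h.q_pos h.le_critExp (h.memLp_add v)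

lemma aemeasurable (_h : Setting δ lam p u₀ u) (v : H10 γ Ω) :
    AEMeasurable v (volume.restrict Ω) := (H10.aestronglyMeasurable v).aemeasurable

lemma integrable_rpow_mul (h : Setting δ lam p u₀ u) (v w : H10 γ Ω) :
    Integrable (fun z => |v z + u₀ z| ^ p * w z) (volume.restrict Ω) := by
  have hm : AEMeasurable (fun z => |v z + u₀ z| ^ p * w z) (volume.restrict Ω) :=
    (((h.aemeasurable v).add h.aestronglyMeasurable_u₀.aemeasurable).norm.pow_const p).mul
      (h.aemeasurable w)
  refine ((h.integrable_add_rpow v).add (h.integrable_rpow w)).mono' hm.aestronglyMeasurable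
    (Eventually.of_forall fun z => ?_)
  have := rpow_mul_le_add (p := p) (by linarith [h.one_le_p]) one_pos (abs_nonneg (v z + u₀ z))
    (abs_nonneg (w z))
  rw [norm_mul, Real.norm_eq_abs, Real.norm_eq_abs, abs_of_nonneg (by positivity)]
  simpa using this

lemma aemeasurable_GReal (h : Setting δ lam p u₀ u) (v : H10 γ Ω) :
    AEMeasurable (fun z => GReal δ (u₀ z) (v z)) (volume.restrict Ω) :=
  (measurable_GReal δ).comp_aemeasurable
    (h.aestronglyMeasurable_u₀.aemeasurable.prodMk (h.aemeasurable v))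

lemma aemeasurable_gReal (h : Setting δ lam p u₀ u) (v : H10 γ Ω) :
    AEMeasurable (fun z => gReal δ (u₀ z) (v z)) (volume.restrict Ω) :=
  (measurable_gReal δ).comp_aemeasurable
    (h.aestronglyMeasurable_u₀.aemeasurable.prodMk (h.aemeasurable v))

/-- The equation tested with the nonnegative elements of `H10`. -/
lemma equation (h : Setting δ lam p u₀ u) {w : H10 γ Ω}
    (hw : ∀ᵐ z ∂volume.restrict Ω, 0 ≤ w z) :
    Integrable (fun z => gReal δ (u₀ z) (u z) * w z) (volume.restrict Ω) ∧
      inner ℝ u w + ∫ z in Ω, gReal δ (u₀ z) (u z) * w z =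
        lam * ∫ z in Ω, |u z + u₀ z| ^ p * w z := by
  have hg : (fun z => (gFun δ u₀ z (u z)).toReal) =ᵐ[volume.restrict Ω]
      fun z => gReal δ (u₀ z) (u z) := by
    filter_upwards [h.solution.pos, h.ae_pos_u₀] with z e1 e2
    exact toReal_gFun (add_pos e1 e2)
  have hgw : (fun z => (gFun δ u₀ z (u z)).toReal * w z) =ᵐ[volume.restrict Ω]
      fun z => gReal δ (u₀ z) (u z) * w z := hg.mono fun z hz => by simp only [hz]
  have h1 := H10.integrable_and_equation_of_nonneg h.one_le_n h.one_le_m h.γ_pos h.isOpen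
    h.isBounded (u := u) (h := fun z => (gFun δ u₀ z (u z)).toReal)
    (F := fun z => lam * |u z + u₀ z| ^ p) (w := w) ?_ h.solution.locallyIntegrable ?_ ?_ hw
  · refine ⟨h1.1.congr hgw, ?_⟩
    rw [← integral_congr_ae hgw, h1.2, ← integral_const_mul]
    simp only [mul_assoc]
  · filter_upwards [hg, h.solution.pos, h.ae_pos_u₀] with z e1 e2 e3
    rw [e1]
    exact gReal_nonneg h.δ_pos e3 e2.le
  · intro w
    simpa only [mul_assoc] using (h.integrable_rpow_mul u w).const_mul lam
  · intro φ hφ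
    rw [h.solution.equation φ hφ, ← integral_const_mul]
    refine integral_congr_ae ?_
    filter_upwards [h.solution.pos, h.ae_pos_u₀] with z e1 e2
    rw [abs_of_pos (add_pos e1 e2), mul_assoc]

end Setting

end Grushin

namespace Grushin

/-! ### The constrained energy -/

variable {n m : ℕ} {γ : ℝ} {Ω : Set (Pt n m)}

/-- The effective domain of the constrained energy. -/
structure IsDom (δ : ℝ) (u₀ : Pt n m → ℝ) (u v : H10 γ Ω) : Prop where
  above : ∀ᵐ z ∂volume.restrict Ω, u z ≤ v z
  integrable : Integrable (fun z => GReal δ (u₀ z) (v z)) (volume.restrict Ω)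

/-- The real-valued energy. -/
noncomputable def realEnergy (δ lam p : ℝ) (u₀ : Pt n m → ℝ) (v : H10 γ Ω) : ℝ :=
  1 / 2 * ‖v‖ ^ 2 + (∫ z in Ω, GReal δ (u₀ z) (v z)) -
    lam / (p + 1) * ∫ z in Ω, |v z + u₀ z| ^ (p + 1)

namespace Setting

variable {δ lam p : ℝ} {u₀ : Pt n m → ℝ} {u : H10 γ Ω}

lemma ae_pos (h : Setting δ lam p u₀ u) {v : H10 γ Ω}
    (hv : ∀ᵐ z ∂volume.restrict Ω, u z ≤ v z) : ∀ᵐ z ∂volume.restrict Ω, 0 < v z := by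
  filter_upwards [hv, h.solution.pos] with z e1 e2
  exact e2.trans_le e1

lemma lintegral_GFun (h : Setting δ lam p u₀ u) {v : H10 γ Ω}
    (hv : ∀ᵐ z ∂volume.restrict Ω, u z ≤ v z) :
    ∫⁻ z in Ω, GFun δ u₀ z (v z) = ∫⁻ z in Ω, ENNReal.ofReal (GReal δ (u₀ z) (v z)) := by
  refine lintegral_congr_ae ?_
  filter_upwards [h.ae_pos hv, h.ae_pos_u₀] with z e1 e2
  exact GFun_eq h.δ_pos e2 e1.le

lemma ae_GReal_nonneg (h : Setting δ lam p u₀ u) {v : H10 γ Ω}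
    (hv : ∀ᵐ z ∂volume.restrict Ω, u z ≤ v z) :
    ∀ᵐ z ∂volume.restrict Ω, 0 ≤ GReal δ (u₀ z) (v z) := by
  filter_upwards [h.ae_pos hv, h.ae_pos_u₀] with z e1 e2
  exact GReal_nonneg h.δ_pos e2 e1.le

lemma integrable_GReal_iff (h : Setting δ lam p u₀ u) {v : H10 γ Ω}
    (hv : ∀ᵐ z ∂volume.restrict Ω, u z ≤ v z) :
    Integrable (fun z => GReal δ (u₀ z) (v z)) (volume.restrict Ω) ↔
      ∫⁻ z in Ω, ENNReal.ofReal (GReal δ (u₀ z) (v z)) < ⊤ := by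
  rw [← hasFiniteIntegral_iff_ofReal (h.ae_GReal_nonneg hv)]
  exact ⟨fun hi => hi.2, fun hi => ⟨(h.aemeasurable_GReal v).aestronglyMeasurable, hi⟩⟩

/-- By Sobolev and p + 1 ≤ 2*, membership in L^(p+1) is automatic, so finiteness of the energy is
governed by the constraint and G alone. -/
lemma constrainedEnergy_eq (h : Setting δ lam p u₀ u) {v : H10 γ Ω} (hv : IsDom δ u₀ u v) :
    constrainedEnergy δ lam p u₀ (aboveSet u) v = (realEnergy δ lam p u₀ v : ℝ) := by
  have := H10.isFiniteMeasure_restrict h.isBounded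
  have h1 : v ∈ aboveSet u := hv.above
  have h2 := (h.integrable_GReal_iff hv.above).1 hv.integrable
  rw [← h.lintegral_GFun hv.above] at h2
  have h3 : MemLp v (ENNReal.ofReal (p + 1)) (volume.restrict Ω) :=
    (H10.memLp_critExp h.one_le_n h.one_le_m h.γ_pos h.isOpen v).mono_exponent
      (ENNReal.ofReal_le_ofReal h.le_critExp)
  rw [constrainedEnergy, if_pos h1, energy, if_pos ⟨h2, h3⟩, h.lintegral_GFun hv.above,
    ← integral_eq_lintegral_of_nonneg_ae (h.ae_GReal_nonneg hv.above)
      hv.integrable.aestronglyMeasurable, realEnergy]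

lemma isDom_of_lt_top (h : Setting δ lam p u₀ u) {v : H10 γ Ω}
    (hv : constrainedEnergy δ lam p u₀ (aboveSet u) v < ⊤) : IsDom δ u₀ u v := by
  rw [constrainedEnergy] at hv
  split_ifs at hv with h1
  · rw [energy] at hv
    split_ifs at hv with h2
    · refine ⟨h1, (h.integrable_GReal_iff h1).2 ?_⟩
      rw [← h.lintegral_GFun h1]
      exact h2.1
    · exact absurd hv (lt_irrefl _)
  · exact absurd hv (lt_irrefl _)

/-- G(u) ≤ g(u) u, and the right side is integrable by the equation tested with u itself. -/
lemma isDom_self (h : Setting δ lam p u₀ u) : IsDom δ u₀ u u := by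
  refine ⟨Eventually.of_forall fun _ => le_rfl, ?_⟩
  refine (h.equation (w := u) (h.solution.pos.mono fun _ hz => hz.le)).1.mono'
    (h.aemeasurable_GReal u).aestronglyMeasurable ?_
  filter_upwards [h.solution.pos, h.ae_pos_u₀] with z e1 e2
  rw [Real.norm_of_nonneg (GReal_nonneg h.δ_pos e2 e1.le)]
  exact GReal_le_gReal_mul h.δ_pos e2 e1.le

lemma isProper (h : Setting δ lam p u₀ u) :
    IsProper (constrainedEnergy δ lam p u₀ (aboveSet u)) := by
  refine ⟨fun v => ?_, u, ?_⟩
  · by_cases hv : constrainedEnergy δ lam p u₀ (aboveSet u) v < ⊤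
    · rw [h.constrainedEnergy_eq (h.isDom_of_lt_top hv)]
      exact EReal.coe_ne_bot _
    · rw [not_lt, top_le_iff] at hv
      rw [hv]
      exact top_ne_bot
  · show constrainedEnergy δ lam p u₀ (aboveSet u) u < ⊤
    rw [h.constrainedEnergy_eq h.isDom_self]
    exact EReal.coe_lt_top _

lemma tendsto_GReal (h : Setting δ lam p u₀ u) {a b : ℝ} (ha : 0 < a) (hb : 0 < b) {x : ℕ → ℝ}
    (hx : Tendsto x atTop (𝓝 b)) :
    Tendsto (fun k => GReal δ a (x k)) atTop (𝓝 (GReal δ a b)) := by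
  have hpos : ∀ᶠ k in atTop, 0 < x k ∧ x k < b + 1 :=
    hx.eventually ((lt_mem_nhds hb).and (gt_mem_nhds (lt_add_one b)))
  rw [tendsto_iff_norm_sub_tendsto_zero]
  have hlim : Tendsto (fun k => gReal δ a (b + 1) * |x k - b|) atTop (𝓝 0) := by
    have := ((hx.sub_const b).abs).const_mul (gReal δ a (b + 1))
    simpa using this
  refine squeeze_zero' (Eventually.of_forall fun _ => norm_nonneg _) ?_ hlim
  filter_upwards [hpos] with k hk
  have hg0 := gReal_nonneg h.δ_pos ha hk.1.le
  have hg := gReal_mono h.δ_pos ha hk.1.le hk.2.le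
  have hg0' := gReal_nonneg h.δ_pos ha hb.le
  have hg' := gReal_mono h.δ_pos ha hb.le (lt_add_one b).le
  rw [Real.norm_eq_abs]
  rcases le_total b (x k) with hc | hc
  · have h1 := GReal_sub_le h.δ_pos ha hb.le hc
    have h2 := GReal_mono h.δ_pos ha hb.le hc
    rw [abs_of_nonneg (by linarith), abs_of_nonneg (by linarith)]
    exact h1.trans (by gcongr)
  · have h1 := GReal_sub_le h.δ_pos ha hk.1.le hc
    have h2 := GReal_mono h.δ_pos ha hk.1.le hc
    rw [abs_of_nonpos (by linarith), abs_of_nonpos (by linarith), neg_sub, neg_sub]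
    exact h1.trans (by gcongr)

/-- Fatou's lemma for the singular part of the energy. -/
lemma isDom_of_tendsto (h : Setting δ lam p u₀ u) {x : ℕ → H10 γ Ω} {v : H10 γ Ω}
    (hx : ∀ k, IsDom δ u₀ u (x k))
    (hae : ∀ᵐ z ∂volume.restrict Ω, Tendsto (fun k => x k z) atTop (𝓝 (v z)))
    {t : ℕ → ℝ} {t' : ℝ} (ht : ∀ k, ∫ z in Ω, GReal δ (u₀ z) (x k z) ≤ t k)
    (htt : Tendsto t atTop (𝓝 t')) :
    IsDom δ u₀ u v ∧ ∫ z in Ω, GReal δ (u₀ z) (v z) ≤ t' := by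
  have habove : ∀ᵐ z ∂volume.restrict Ω, u z ≤ v z := by
    filter_upwards [hae, ae_all_iff.2 fun k => (hx k).above] with z e1 e2
    exact ge_of_tendsto' e1 e2
  have ht0 : ∀ k, 0 ≤ t k := fun k =>
    (integral_nonneg_of_ae (h.ae_GReal_nonneg (hx k).above)).trans (ht k)
  have hle : ∫⁻ z in Ω, ENNReal.ofReal (GReal δ (u₀ z) (v z)) ≤ ENNReal.ofReal t' := by
    calc ∫⁻ z in Ω, ENNReal.ofReal (GReal δ (u₀ z) (v z)) ≤
          ∫⁻ z in Ω, liminf (fun k => ENNReal.ofReal (GReal δ (u₀ z) (x k z))) atTop := by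
          refine lintegral_mono_ae ?_
          filter_upwards [hae, h.ae_pos habove, h.ae_pos_u₀] with z e1 e2 e3
          exact (ENNReal.tendsto_ofReal (h.tendsto_GReal e3 e2 e1)).liminf_eq.ge
      _ ≤ liminf (fun k => ∫⁻ z in Ω, ENNReal.ofReal (GReal δ (u₀ z) (x k z))) atTop :=
          lintegral_liminf_le' fun k => (h.aemeasurable_GReal (x k)).ennreal_ofReal
      _ ≤ liminf (fun k => ENNReal.ofReal (t k)) atTop := by
          refine liminf_le_liminf (Eventually.of_forall fun k => ?_)
          rw [← ofReal_integral_eq_lintegral_ofReal (hx k).integrable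
            (h.ae_GReal_nonneg (hx k).above)]
          exact ENNReal.ofReal_le_ofReal (ht k)
      _ = ENNReal.ofReal t' := (ENNReal.tendsto_ofReal htt).liminf_eq
  have hi := (h.integrable_GReal_iff habove).2 (hle.trans_lt ENNReal.ofReal_lt_top)
  refine ⟨⟨habove, hi⟩, ?_⟩
  rw [← ofReal_integral_eq_lintegral_ofReal hi (h.ae_GReal_nonneg habove)] at hle
  exact (ENNReal.ofReal_le_ofReal_iff (ge_of_tendsto' htt ht0)).1 hle

/-- The Sobolev inequality, in terms of integrals. -/
lemma exists_integral_rpow_le (h : Setting δ lam p u₀ u) {r : ℝ} (hr : 0 < r)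
    (hrc : r ≤ critExp n m γ) :
    ∃ C : ℝ, 0 ≤ C ∧ ∀ v : H10 γ Ω, ∫ z in Ω, |v z| ^ r ≤ C * ‖v‖ ^ r := by
  have hfin := H10.isFiniteMeasure_restrict h.isBounded
  obtain ⟨K, hK, hS⟩ := H10.exists_sobolev (Ω := Ω) h.one_le_n h.one_le_m h.γ_pos h.isOpen
  set s := critExp n m γ with hs
  set c : ℝ≥0∞ := (volume.restrict Ω) univ ^ (1 / r - 1 / s) with hc
  have hctop : c ≠ ⊤ := by
    refine ENNReal.rpow_ne_top_of_nonneg ?_ (measure_ne_top _ _)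
    rw [sub_nonneg]
    gcongr
  refine ⟨(K * c.toReal) ^ r, by positivity, fun v => ?_⟩
  have hmem : MemLp v (ENNReal.ofReal r) (volume.restrict Ω) :=
    (H10.memLp_critExp h.one_le_n h.one_le_m h.γ_pos h.isOpen v).mono_exponent
      (ENNReal.ofReal_le_ofReal hrc)
  have h1 := eLpNorm_le_eLpNorm_mul_rpow_measure_univ (p := ENNReal.ofReal r)
    (q := ENNReal.ofReal s) (ENNReal.ofReal_le_ofReal hrc) (H10.aestronglyMeasurable v)
  rw [ENNReal.toReal_ofReal hr.le, ENNReal.toReal_ofReal (hr.le.trans hrc)] at h1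
  have h2 : eLpNorm v (ENNReal.ofReal r) (volume.restrict Ω) ≤
      ENNReal.ofReal (K * c.toReal * ‖v‖) := by
    refine h1.trans ?_
    rw [ENNReal.ofReal_mul (by positivity), ENNReal.ofReal_mul hK, ENNReal.ofReal_toReal hctop,
      ofReal_norm]
    calc _ ≤ ENNReal.ofReal K * ‖v‖ₑ * c := by gcongr; exact hS v
      _ = _ := by ring
  rw [hmem.eLpNorm_eq_integral_rpow_norm (by simpa using hr) ENNReal.ofReal_ne_top,
    ENNReal.toReal_ofReal hr.le] at h2
  have h3 := (ENNReal.ofReal_le_ofReal_iff (by positivity)).1 h2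
  have h4 : 0 ≤ ∫ z in Ω, ‖v z‖ ^ r := integral_nonneg fun z => by positivity
  have h5 := Real.rpow_le_rpow (by positivity) h3 hr.le
  rw [← Real.rpow_mul h4, inv_mul_cancel₀ hr.ne', Real.rpow_one,
    Real.mul_rpow (by positivity) (norm_nonneg _)] at h5
  exact h5

/-- Continuity of the superlinear part of the energy. -/
lemma tendsto_integral_rpow (h : Setting δ lam p u₀ u) {x : ℕ → H10 γ Ω} {v : H10 γ Ω}
    (hx : Tendsto x atTop (𝓝 v)) :
    Tendsto (fun k => ∫ z in Ω, |x k z + u₀ z| ^ (p + 1)) atTop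
      (𝓝 (∫ z in Ω, |v z + u₀ z| ^ (p + 1))) := by
  obtain ⟨K, hK, hS⟩ := h.exists_integral_rpow_le h.q_pos h.le_critExp
  set A := ∫ z in Ω, |v z + u₀ z| ^ (p + 1) with hA
  have hA0 : 0 ≤ A := integral_nonneg fun z => by positivity
  have hr : Tendsto (fun k => K * ‖x k - v‖ ^ (p + 1)) atTop (𝓝 0) := by
    have h1 : Tendsto (fun k => ‖x k - v‖) atTop (𝓝 0) := tendsto_iff_norm_sub_tendsto_zero.1 hx
    have h2 := (h1.rpow_const (p := p + 1) (Or.inr h.q_pos.le)).const_mul K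
    rwa [Real.zero_rpow h.q_pos.ne', mul_zero] at h2
  rw [Metric.tendsto_atTop']
  intro η hη
  -- The small coefficient multiplies the fixed integral A and the large one multiplies ∫ |x_k - v|
  -- ^ (p + 1), which tends to 0 by Sobolev.
  obtain ⟨C, hC, hCb⟩ := exists_abs_rpow_add_sub_le (q := p + 1) (ε := η / (2 * (A + 1)))
    (by linarith [h.one_le_p]) (by positivity)
  have hr2 : Tendsto (fun k => C * (K * ‖x k - v‖ ^ (p + 1))) atTop (𝓝 0) := by
    simpa using hr.const_mul C
  obtain ⟨N, hN⟩ := eventually_atTop.1 (hr2.eventually (gt_mem_nhds (half_pos hη)))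
  refine ⟨N, fun k hk => ?_⟩
  rw [Real.dist_eq, hA, ← integral_sub (h.integrable_add_rpow _) (h.integrable_add_rpow _)]
  have hpt : ∀ᵐ z ∂volume.restrict Ω, |(|x k z + u₀ z| ^ (p + 1) - |v z + u₀ z| ^ (p + 1))| ≤
      η / (2 * (A + 1)) * |v z + u₀ z| ^ (p + 1) + C * |(x k - v) z| ^ (p + 1) := by
    filter_upwards [H10.coe_sub (x k) v] with z e1
    have := hCb (v z + u₀ z) ((x k - v) z)
    rwa [e1, show v z + u₀ z + (x k z - v z) = x k z + u₀ z by ring, ← e1] at this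
  have hi1 := (h.integrable_add_rpow v).const_mul (η / (2 * (A + 1)))
  have hi2 := (h.integrable_rpow (x k - v)).const_mul C
  calc |∫ z in Ω, (|x k z + u₀ z| ^ (p + 1) - |v z + u₀ z| ^ (p + 1))| ≤
        ∫ z in Ω, |(|x k z + u₀ z| ^ (p + 1) - |v z + u₀ z| ^ (p + 1))| :=
        abs_integral_le_integral_abs
    _ ≤ ∫ z in Ω, (η / (2 * (A + 1)) * |v z + u₀ z| ^ (p + 1) + C * |(x k - v) z| ^ (p + 1)) :=
        integral_mono_ae ((h.integrable_add_rpow _).sub (h.integrable_add_rpow _)).abs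
          (hi1.add hi2) hpt
    _ = η / (2 * (A + 1)) * A + C * ∫ z in Ω, |(x k - v) z| ^ (p + 1) := by
        rw [integral_add hi1 hi2, integral_const_mul, integral_const_mul]
    _ ≤ η / (2 * (A + 1)) * A + C * (K * ‖x k - v‖ ^ (p + 1)) := by
        gcongr
        exact hS _
    _ < η / 2 + η / 2 := by
        refine add_lt_add_of_le_of_lt ?_ (hN k hk.le)
        rw [div_mul_eq_mul_div, div_le_div_iff₀ (by positivity) two_pos]
        nlinarith
    _ = η := add_halves η

/-- The quadratic and power terms are continuous. For the singular term, norm convergence gives L²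
convergence by Poincaré, hence a.e. convergence of a subsequence, and Fatou applies. -/
lemma lowerSemicontinuous (h : Setting δ lam p u₀ u) :
    LowerSemicontinuous (constrainedEnergy δ lam p u₀ (aboveSet u)) := by
  intro v y hy
  by_contra hcon
  obtain ⟨x, hx, hxy⟩ := exists_seq_forall_of_frequently (not_eventually.1 hcon)
  simp only [not_lt] at hxy
  have hytop : y < ⊤ := hy.trans_le le_top
  have hxd : ∀ k, IsDom δ u₀ u (x k) := fun k => h.isDom_of_lt_top ((hxy k).trans_lt hytop)
  obtain ⟨P, hP, hPo⟩ := H10.exists_poincare (Ω := Ω) h.one_le_n h.one_le_m h.γ_pos h.isOpen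
    h.isBounded
  have hx0 : Tendsto (fun k => ‖x k - v‖) atTop (𝓝 0) := tendsto_iff_norm_sub_tendsto_zero.1 hx
  have hL2 : Tendsto (fun k => H10.toL2 (x k)) atTop (𝓝 (H10.toL2 v)) := by
    rw [tendsto_iff_norm_sub_tendsto_zero]
    refine squeeze_zero (fun _ => norm_nonneg _) (fun k => ?_) (by simpa using hx0.const_mul P)
    rw [← map_sub]
    exact hPo _
  obtain ⟨κ, hκ, hae⟩ := H10.exists_subseq_ae hL2
  have hxκ := hx.comp hκ.tendsto_atTop
  have hybot : y ≠ ⊥ := by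
    intro hb
    have := hxy 0
    rw [h.constrainedEnergy_eq (hxd 0), hb, le_bot_iff] at this
    exact EReal.coe_ne_bot _ this
  lift y to ℝ using ⟨hytop.ne, hybot⟩
  have hE : ∀ k, realEnergy δ lam p u₀ (x k) ≤ y := fun k => by
    have := hxy k
    rwa [h.constrainedEnergy_eq (hxd k), EReal.coe_le_coe_iff] at this
  have hlim : Tendsto (fun k => y - 1 / 2 * ‖x (κ k)‖ ^ 2 +
      lam / (p + 1) * ∫ z in Ω, |x (κ k) z + u₀ z| ^ (p + 1)) atTop
      (𝓝 (y - 1 / 2 * ‖v‖ ^ 2 + lam / (p + 1) * ∫ z in Ω, |v z + u₀ z| ^ (p + 1))) :=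
    (tendsto_const_nhds.sub ((hxκ.norm.pow 2).const_mul _)).add
      ((h.tendsto_integral_rpow hxκ).const_mul _)
  obtain ⟨hvd, hvG⟩ := h.isDom_of_tendsto (fun k => hxd (κ k)) hae (fun k => by
    have := hE (κ k)
    rw [realEnergy] at this
    linarith) hlim
  rw [h.constrainedEnergy_eq hvd, gt_iff_lt, EReal.coe_lt_coe_iff, realEnergy] at hy
  linarith

end Setting

end Grushin

namespace Grushin

/-! ### Consequences of subdifferentiability -/

/-- Insert v + θ h in the definition, divide by θ and let θ decrease to 0; the quadratic term and
the tolerance ε‖h‖ are each made at most η / 2. -/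
lemma inner_le_of_mem_frechetSubdiff {H : Type*} [SeminormedAddCommGroup H]
    [InnerProductSpace ℝ H] {J : H → EReal} {v h α : H} {e a b : ℝ}
    (hα : α ∈ frechetSubdiff J v) (he : J v = e)
    (hJ : ∀ θ : ℝ, 0 < θ → θ ≤ 1 → J (v + θ • h) ≤ ((e + θ * a + θ ^ 2 * b : ℝ) : EReal)) :
    inner ℝ α h ≤ a := by
  refine le_of_forall_pos_le_add fun η hη => ?_
  have h1 := hα.2 (η / (2 * (‖h‖ + 1))) (by positivity)
  have hlim : Tendsto (fun θ : ℝ => v + θ • h) (𝓝[>] 0) (𝓝 v) := by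
    have hc : Continuous fun θ : ℝ => v + θ • h := by fun_prop
    have := hc.tendsto 0
    rw [zero_smul, add_zero] at this
    exact this.mono_left nhdsWithin_le_nhds
  have hb : Tendsto (fun θ : ℝ => θ * b) (𝓝[>] 0) (𝓝 0) := by
    have hc : Continuous fun θ : ℝ => θ * b := by fun_prop
    have := hc.tendsto 0
    rw [zero_mul] at this
    exact this.mono_left nhdsWithin_le_nhds
  obtain ⟨θ, ⟨h2, h3⟩, h4, h5⟩ := (((hlim.eventually h1).and
    (hb.eventually (gt_mem_nhds (half_pos hη)))).and (Ioc_mem_nhdsGT one_pos)).exists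
  have h6 := h2.trans (hJ θ h4 h5)
  rw [he, EReal.toReal_coe, EReal.coe_le_coe_iff, add_sub_cancel_left, inner_smul_right, norm_smul,
    Real.norm_of_nonneg h4.le] at h6
  have h7 : η / (2 * (‖h‖ + 1)) * ‖h‖ ≤ η / 2 := by
    rw [div_mul_eq_mul_div, div_le_div_iff₀ (by positivity) two_pos]
    nlinarith [norm_nonneg h]
  have h8 : θ * inner ℝ α h ≤ θ * (a + θ * b + η / (2 * (‖h‖ + 1)) * ‖h‖) := by
    linear_combination h6
  have h9 := (mul_le_mul_iff_right₀ h4).1 h8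
  linarith

variable {n m : ℕ} {γ : ℝ} {Ω : Set (Pt n m)}

namespace Setting

variable {δ lam p : ℝ} {u₀ : Pt n m → ℝ} {u : H10 γ Ω}

lemma coe_add_smul (v h : H10 γ Ω) (θ : ℝ) :
    (v + θ • h : H10 γ Ω) =ᵐ[volume.restrict Ω] fun z => v z + θ * h z := by
  filter_upwards [H10.coe_add v (θ • h), H10.coe_smul θ h] with z e1 e2
  rw [e1, e2]

/-- The energy along a segment, up to its singular part. -/
lemma realEnergy_add_smul_le (h : Setting δ lam p u₀ u) {v w : H10 γ Ω} {θ : ℝ}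
    (hv : ∀ᵐ z ∂volume.restrict Ω, u z ≤ v z)
    (hw : ∀ᵐ z ∂volume.restrict Ω, u z ≤ (v + θ • w) z) :
    realEnergy δ lam p u₀ (v + θ • w) ≤ realEnergy δ lam p u₀ v +
      θ * (inner ℝ v w - lam * ∫ z in Ω, |v z + u₀ z| ^ p * w z) + θ ^ 2 * (1 / 2 * ‖w‖ ^ 2) +
      ((∫ z in Ω, GReal δ (u₀ z) ((v + θ • w) z)) - ∫ z in Ω, GReal δ (u₀ z) (v z)) := by
  have hq := h.q_pos
  have hnorm : ‖v + θ • w‖ ^ 2 = ‖v‖ ^ 2 + 2 * (θ * inner ℝ v w) + θ ^ 2 * ‖w‖ ^ 2 := by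
    rw [norm_add_sq_real, inner_smul_right, norm_smul, mul_pow, Real.norm_eq_abs, sq_abs]
  -- The power term enters the energy with a minus sign, so its lying above tangents bounds the
  -- energy from above.
  have hint : (∫ z in Ω, |v z + u₀ z| ^ (p + 1)) + (p + 1) * θ *
      (∫ z in Ω, |v z + u₀ z| ^ p * w z) ≤ ∫ z in Ω, |(v + θ • w) z + u₀ z| ^ (p + 1) := by
    have hi := (h.integrable_rpow_mul v w).const_mul ((p + 1) * θ)
    rw [← integral_const_mul, ← integral_add (h.integrable_add_rpow v) hi]
    refine integral_mono_ae ((h.integrable_add_rpow v).add hi) (h.integrable_add_rpow _) ?_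
    filter_upwards [h.ae_pos hv, h.ae_pos hw, h.ae_pos_u₀, coe_add_smul v w θ] with z e1 e2 e3 e4
    have := rpow_tangent_le (q := p + 1) (by linarith [h.one_le_p]) (add_pos e1 e3).le
      (add_pos e2 e3).le
    rw [abs_of_pos (add_pos e1 e3), abs_of_pos (add_pos e2 e3)]
    refine le_trans (le_of_eq ?_) this
    rw [e4, add_sub_cancel_right]
    ring
  have hlam : lam / (p + 1) * ((∫ z in Ω, |v z + u₀ z| ^ (p + 1)) + (p + 1) * θ *
      (∫ z in Ω, |v z + u₀ z| ^ p * w z)) ≤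
      lam / (p + 1) * ∫ z in Ω, |(v + θ • w) z + u₀ z| ^ (p + 1) :=
    mul_le_mul_of_nonneg_left hint (div_nonneg h.lam_pos.le hq.le)
  have hexp : lam / (p + 1) * ((∫ z in Ω, |v z + u₀ z| ^ (p + 1)) + (p + 1) * θ *
      (∫ z in Ω, |v z + u₀ z| ^ p * w z)) = lam / (p + 1) * (∫ z in Ω, |v z + u₀ z| ^ (p + 1)) +
      θ * (lam * ∫ z in Ω, |v z + u₀ z| ^ p * w z) := by
    field_simp
  rw [hexp] at hlam
  rw [realEnergy, realEnergy, hnorm]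
  linarith

lemma isDom_add_smul (h : Setting δ lam p u₀ u) {v w : H10 γ Ω} (hv : IsDom δ u₀ u v)
    (hw : IsDom δ u₀ u w) {θ : ℝ} (h0 : 0 ≤ θ) (h1 : θ ≤ 1) :
    IsDom δ u₀ u (v + θ • (w - v)) ∧
      (∫ z in Ω, GReal δ (u₀ z) ((v + θ • (w - v)) z)) ≤ (∫ z in Ω, GReal δ (u₀ z) (v z)) +
        θ * ((∫ z in Ω, GReal δ (u₀ z) (w z)) - ∫ z in Ω, GReal δ (u₀ z) (v z)) := by
  have hcoe : ∀ᵐ z ∂volume.restrict Ω, (v + θ • (w - v)) z = v z + θ * (w z - v z) := by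
    filter_upwards [coe_add_smul v (w - v) θ, H10.coe_sub w v] with z e1 e2
    rw [e1, e2]
  have habove : ∀ᵐ z ∂volume.restrict Ω, u z ≤ (v + θ • (w - v)) z := by
    filter_upwards [hcoe, hv.above, hw.above] with z e1 e2 e3
    rw [e1]
    nlinarith
  have hle : ∀ᵐ z ∂volume.restrict Ω, GReal δ (u₀ z) ((v + θ • (w - v)) z) ≤
      GReal δ (u₀ z) (v z) + θ * (GReal δ (u₀ z) (w z) - GReal δ (u₀ z) (v z)) := by
    filter_upwards [hcoe, h.ae_pos hv.above, h.ae_pos hw.above, h.ae_pos_u₀] with z e1 e2 e3 e4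
    rw [e1]
    exact GReal_convex h.δ_pos e4 e2.le e3.le h0 h1
  have hi : Integrable (fun z => GReal δ (u₀ z) (v z) +
      θ * (GReal δ (u₀ z) (w z) - GReal δ (u₀ z) (v z))) (volume.restrict Ω) :=
    hv.integrable.add ((hw.integrable.sub hv.integrable).const_mul θ)
  have hd : IsDom δ u₀ u (v + θ • (w - v)) := by
    refine ⟨habove, hi.mono' (h.aemeasurable_GReal _).aestronglyMeasurable ?_⟩
    filter_upwards [hle, h.ae_GReal_nonneg habove] with z e1 e2
    rwa [Real.norm_of_nonneg e2]
  refine ⟨hd, (integral_mono_ae hd.integrable hi hle).trans_eq ?_⟩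
  have h2 := integral_add hv.integrable ((hw.integrable.sub hv.integrable).const_mul θ)
  simp only [Pi.sub_apply] at h2
  rw [h2, integral_const_mul, integral_sub hw.integrable hv.integrable]

/-- The variational inequality satisfied by a subgradient. -/
lemma inner_subgradient_le (h : Setting δ lam p u₀ u) {v w α : H10 γ Ω} (hv : IsDom δ u₀ u v)
    (hα : α ∈ frechetSubdiff (constrainedEnergy δ lam p u₀ (aboveSet u)) v)
    (hw : IsDom δ u₀ u w) :
    inner ℝ α (w - v) ≤ inner ℝ v (w - v) - lam * (∫ z in Ω, |v z + u₀ z| ^ p * (w - v) z) +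
      ((∫ z in Ω, GReal δ (u₀ z) (w z)) - ∫ z in Ω, GReal δ (u₀ z) (v z)) := by
  refine inner_le_of_mem_frechetSubdiff (b := 1 / 2 * ‖w - v‖ ^ 2) hα (h.constrainedEnergy_eq hv)
    fun θ h0 h1 => ?_
  obtain ⟨h2, h3⟩ := h.isDom_add_smul hv hw h0.le h1
  rw [h.constrainedEnergy_eq h2, EReal.coe_le_coe_iff]
  have h4 := h.realEnergy_add_smul_le hv.above h2.above
  linarith

/-- 0 ≤ g(v)(v - u) ≤ g(v) v ≤ 2 G(v), and G(v) is integrable. -/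
lemma integrable_gReal_mul_sub (h : Setting δ lam p u₀ u) {v : H10 γ Ω} (hv : IsDom δ u₀ u v) :
    Integrable (fun z => gReal δ (u₀ z) (v z) * (v - u) z) (volume.restrict Ω) := by
  refine (hv.integrable.const_mul 2).mono'
    ((h.aemeasurable_gReal v).mul (h.aemeasurable (v - u))).aestronglyMeasurable ?_
  filter_upwards [H10.coe_sub v u, hv.above, h.solution.pos, h.ae_pos_u₀] with z e1 e2 e3 e4
  have hg := gReal_nonneg h.δ_pos e4 (e3.le.trans e2)
  rw [e1, Real.norm_of_nonneg (mul_nonneg hg (sub_nonneg.2 e2))]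
  refine le_trans ?_ (gReal_mul_self_le h.δ_pos e4 (e3.le.trans e2))
  gcongr
  linarith

/-- A subgradient tested with the direction `v - u`, in which the energy is differentiable. -/
lemma inner_subgradient_sub_le (h : Setting δ lam p u₀ u) {v α : H10 γ Ω} (hv : IsDom δ u₀ u v)
    (hα : α ∈ frechetSubdiff (constrainedEnergy δ lam p u₀ (aboveSet u)) v) :
    inner ℝ α (v - u) ≤ inner ℝ v (v - u) - lam * (∫ z in Ω, |v z + u₀ z| ^ p * (v - u) z) +
      ∫ z in Ω, gReal δ (u₀ z) (v z) * (v - u) z := by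
  set A := ∫ z in Ω, gReal δ (u₀ z) (v z) * (v - u) z with hA
  refine inner_le_of_mem_frechetSubdiff (b := 1 / 2 * ‖v - u‖ ^ 2 + A) hα
    (h.constrainedEnergy_eq hv) fun θ h0 h1 => ?_
  have hcoe : ∀ᵐ z ∂volume.restrict Ω, (v + θ • (v - u)) z = v z + θ * (v - u) z :=
    coe_add_smul v (v - u) θ
  have habove : ∀ᵐ z ∂volume.restrict Ω, u z ≤ (v + θ • (v - u)) z := by
    filter_upwards [hcoe, H10.coe_sub v u, hv.above] with z e1 e2 e3
    rw [e1, e2]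
    nlinarith
  -- Since 0 ≤ v - u ≤ v, the growth estimate for G applies; it also shows that v + θ (v - u) stays
  -- in the effective domain.
  have hle : ∀ᵐ z ∂volume.restrict Ω, GReal δ (u₀ z) ((v + θ • (v - u)) z) ≤
      GReal δ (u₀ z) (v z) + θ * (1 + θ) * (gReal δ (u₀ z) (v z) * (v - u) z) := by
    filter_upwards [hcoe, H10.coe_sub v u, hv.above, h.solution.pos, h.ae_pos_u₀]
      with z e1 e2 e3 e4 e5
    rw [e1, e2]
    exact GReal_add_le h.δ_pos e5 (sub_nonneg.2 e3) (by linarith) h0.le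
  have hi1 := (h.integrable_gReal_mul_sub hv).const_mul (θ * (1 + θ))
  have hi := hv.integrable.add hi1
  have hd : IsDom δ u₀ u (v + θ • (v - u)) := by
    refine ⟨habove, hi.mono' (h.aemeasurable_GReal _).aestronglyMeasurable ?_⟩
    filter_upwards [hle, h.ae_GReal_nonneg habove] with z e1 e2
    rwa [Real.norm_of_nonneg e2]
  have hG := integral_mono_ae hd.integrable hi hle
  simp only [Pi.add_apply] at hG
  rw [integral_add hv.integrable hi1, integral_const_mul, ← hA] at hG
  rw [h.constrainedEnergy_eq hd, EReal.coe_le_coe_iff]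
  have h4 := h.realEnergy_add_smul_le hv.above habove
  linarith

/-- The error of the trapezoid rule for the singular term between `u` and `v`. -/
noncomputable def singularGap (δ : ℝ) (u₀ : Pt n m → ℝ) (u v : H10 γ Ω) (z : Pt n m) : ℝ :=
  GReal δ (u₀ z) (v z) - GReal δ (u₀ z) (u z) -
    1 / 2 * (gReal δ (u₀ z) (u z) + gReal δ (u₀ z) (v z)) * (v z - u z)

/-- The error of the trapezoid rule for the power term between `u` and `v`. -/
noncomputable def powerGap (p : ℝ) (u₀ : Pt n m → ℝ) (u v : H10 γ Ω) (z : Pt n m) : ℝ :=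
  1 / 2 * (|v z + u₀ z| ^ p + |u z + u₀ z| ^ p) * (v z - u z) -
    (|v z + u₀ z| ^ (p + 1) - |u z + u₀ z| ^ (p + 1)) / (p + 1)

lemma ae_singularGap_nonneg (h : Setting δ lam p u₀ u) {v : H10 γ Ω}
    (hv : ∀ᵐ z ∂volume.restrict Ω, u z ≤ v z) :
    ∀ᵐ z ∂volume.restrict Ω, 0 ≤ singularGap δ u₀ u v z := by
  filter_upwards [hv, h.solution.pos, h.ae_pos_u₀] with z e1 e2 e3
  exact sub_nonneg.2 (GReal_trapezoid h.δ_pos e3 e2.le e1)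

lemma ae_powerGap_nonneg (h : Setting δ lam p u₀ u) {v : H10 γ Ω}
    (hv : ∀ᵐ z ∂volume.restrict Ω, u z ≤ v z) :
    ∀ᵐ z ∂volume.restrict Ω, 0 ≤ powerGap p u₀ u v z := by
  filter_upwards [hv, h.solution.pos, h.ae_pos_u₀] with z e1 e2 e3
  have hU : 0 < u z + u₀ z := add_pos e2 e3
  have hUV : u z + u₀ z ≤ v z + u₀ z := by linarith
  have := rpow_trapezoid h.one_le_p hU.le hUV
  rw [powerGap, abs_of_pos hU, abs_of_pos (hU.trans_le hUV), sub_nonneg]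
  linarith

lemma integrable_singularGap_eq (h : Setting δ lam p u₀ u) {v : H10 γ Ω} (hv : IsDom δ u₀ u v) :
    Integrable (singularGap δ u₀ u v) (volume.restrict Ω) ∧
      ∫ z in Ω, singularGap δ u₀ u v z = (∫ z in Ω, GReal δ (u₀ z) (v z)) -
        (∫ z in Ω, GReal δ (u₀ z) (u z)) -
        1 / 2 * ((∫ z in Ω, gReal δ (u₀ z) (u z) * (v - u) z) +
          ∫ z in Ω, gReal δ (u₀ z) (v z) * (v - u) z) := by
  have hnn : ∀ᵐ z ∂volume.restrict Ω, 0 ≤ (v - u) z := by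
    filter_upwards [H10.coe_sub v u, hv.above] with z e1 e2
    rw [e1]
    linarith
  have i1 := (h.equation hnn).1
  have i2 := h.integrable_gReal_mul_sub hv
  have i3 := hv.integrable
  have i4 := h.isDom_self.integrable
  have heq : singularGap δ u₀ u v =ᵐ[volume.restrict Ω] fun z =>
      GReal δ (u₀ z) (v z) - GReal δ (u₀ z) (u z) -
        1 / 2 * (gReal δ (u₀ z) (u z) * (v - u) z + gReal δ (u₀ z) (v z) * (v - u) z) := by
    filter_upwards [H10.coe_sub v u] with z e1
    rw [singularGap, e1]
    ring
  have i5 := (i1.add i2).const_mul (1 / 2)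
  refine ⟨((i3.sub i4).sub i5).congr heq.symm, ?_⟩
  rw [integral_congr_ae heq]
  have h1 := integral_sub (i3.sub i4) i5
  simp only [Pi.add_apply, Pi.sub_apply] at h1
  rw [h1, integral_const_mul, integral_sub i3 i4, integral_add i1 i2]

lemma integrable_powerGap_eq (h : Setting δ lam p u₀ u) (v : H10 γ Ω) :
    Integrable (powerGap p u₀ u v) (volume.restrict Ω) ∧
      ∫ z in Ω, powerGap p u₀ u v z =
        1 / 2 * ((∫ z in Ω, |v z + u₀ z| ^ p * (v - u) z) +
          ∫ z in Ω, |u z + u₀ z| ^ p * (v - u) z) -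
        1 / (p + 1) * ((∫ z in Ω, |v z + u₀ z| ^ (p + 1)) -
          ∫ z in Ω, |u z + u₀ z| ^ (p + 1)) := by
  have i1 := h.integrable_rpow_mul v (v - u)
  have i2 := h.integrable_rpow_mul u (v - u)
  have i3 := h.integrable_add_rpow v
  have i4 := h.integrable_add_rpow u
  have heq : powerGap p u₀ u v =ᵐ[volume.restrict Ω] fun z =>
      1 / 2 * (|v z + u₀ z| ^ p * (v - u) z + |u z + u₀ z| ^ p * (v - u) z) -
        1 / (p + 1) * (|v z + u₀ z| ^ (p + 1) - |u z + u₀ z| ^ (p + 1)) := by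
    filter_upwards [H10.coe_sub v u] with z e1
    rw [powerGap, e1]
    ring
  have i5 := (i1.add i2).const_mul (1 / 2)
  have i6 := (i3.sub i4).const_mul (1 / (p + 1))
  refine ⟨(i5.sub i6).congr heq.symm, ?_⟩
  rw [integral_congr_ae heq]
  have h1 := integral_sub i5 i6
  simp only [Pi.add_apply, Pi.sub_apply] at h1
  rw [h1, integral_const_mul, integral_const_mul, integral_add i1 i2, integral_sub i3 i4]

/-- The energy gap between `v` and `u`, for subgradients at `v`. -/
lemma gap_le (h : Setting δ lam p u₀ u) {v α : H10 γ Ω} (hv : IsDom δ u₀ u v)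
    (hα : α ∈ frechetSubdiff (constrainedEnergy δ lam p u₀ (aboveSet u)) v) :
    (∫ z in Ω, singularGap δ u₀ u v z) + lam * (∫ z in Ω, powerGap p u₀ u v z) +
      1 / 2 * inner ℝ α (v - u) ≤ realEnergy δ lam p u₀ v - realEnergy δ lam p u₀ u := by
  have hnn : ∀ᵐ z ∂volume.restrict Ω, 0 ≤ (v - u) z := by
    filter_upwards [H10.coe_sub v u, hv.above] with z e1 e2
    rw [e1]
    linarith
  have h1 := (h.equation hnn).2
  have h2 := h.inner_subgradient_sub_le hv hα
  -- The trapezoid rule is exact for the quadratic part. The final combination is half the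
  -- subgradient inequality at v minus half the equation at u.
  have h3 : inner ℝ v (v - u) + inner ℝ u (v - u) = ‖v‖ ^ 2 - ‖u‖ ^ 2 := by
    rw [inner_sub_right, inner_sub_right, real_inner_self_eq_norm_sq, real_inner_self_eq_norm_sq,
      real_inner_comm u v]
    ring
  rw [(h.integrable_singularGap_eq hv).2, (h.integrable_powerGap_eq v).2, realEnergy, realEnergy]
  have h4 : lam / (p + 1) = lam * (1 / (p + 1)) := by ring
  rw [h4]
  linear_combination 1 / 2 * h2 - 1 / 2 * h1 + 1 / 2 * h3

end Setting

end Grushin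

namespace Grushin

/-! ### Boundedness of Cerami sequences -/

/-- Convergence of integrals of functions that are dominated up to small multiples of functions
bounded in `L¹`. -/
lemma tendsto_integral_of_approx_dominated {X : Type*} [MeasurableSpace X] {μ : Measure X}
    {F A : ℕ → X → ℝ} {f : X → ℝ} {M : ℝ} (hF : ∀ k, Integrable (F k) μ) (hf : Integrable f μ)
    (hA : ∀ k, Integrable (A k) μ) (hA0 : ∀ k, ∀ᵐ z ∂μ, 0 ≤ A k z) (hM : ∀ k, ∫ z, A k z ∂μ ≤ M)
    (hlim : ∀ᵐ z ∂μ, Tendsto (fun k => F k z) atTop (𝓝 (f z)))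
    (hb : ∀ ε : ℝ, 0 < ε → ∃ B : X → ℝ, Integrable B μ ∧
      ∀ k, ∀ᵐ z ∂μ, |F k z| ≤ ε * A k z + B z) :
    Tendsto (fun k => ∫ z, F k z ∂μ) atTop (𝓝 (∫ z, f z ∂μ)) := by
  have hM0 : 0 ≤ M := (integral_nonneg_of_ae (hA0 0)).trans (hM 0)
  rw [Metric.tendsto_atTop']
  intro η hη
  set ε := η / (2 * (M + 1)) with hε
  have hε0 : 0 < ε := by positivity
  obtain ⟨B, hB, hFB⟩ := hb ε hε0
  -- The excess of |F_k - f| over ε A_k is dominated by |B| + |f| and tends to 0 a.e.; what was cut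
  -- off has integral at most ε M.
  set D : ℕ → X → ℝ := fun k z => max (|F k z - f z| - ε * A k z) 0 with hD
  have hDi : ∀ k, Integrable (D k) μ := fun k =>
    (((hF k).sub hf).abs.sub ((hA k).const_mul ε)).pos_part
  have hDlim : Tendsto (fun k => ∫ z, D k z ∂μ) atTop (𝓝 (∫ _, (0 : ℝ) ∂μ)) := by
    refine tendsto_integral_of_dominated_convergence (fun z => ‖B z‖ + ‖f z‖)
      (fun k => (hDi k).aestronglyMeasurable) (hB.norm.add hf.norm) (fun k => ?_) ?_
    · filter_upwards [hFB k] with z e1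
      rw [Real.norm_of_nonneg (le_max_right _ _)]
      refine max_le ?_ (by positivity)
      have h1 := abs_sub (F k z) (f z)
      have h2 := le_abs_self (B z)
      simp only [Real.norm_eq_abs]
      linarith
    · filter_upwards [hlim, ae_all_iff.2 hA0] with z e1 e2
      have h1 : Tendsto (fun k => |F k z - f z|) atTop (𝓝 0) := by
        simpa using (e1.sub_const (f z)).abs
      refine squeeze_zero (fun k => le_max_right _ _) (fun k => ?_) h1
      refine max_le ?_ (abs_nonneg _)
      linarith [mul_nonneg hε0.le (e2 k)]
  rw [integral_zero] at hDlim
  obtain ⟨N, hN⟩ := eventually_atTop.1 (hDlim.eventually (gt_mem_nhds (half_pos hη)))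
  refine ⟨N, fun k hk => ?_⟩
  rw [Real.dist_eq, ← integral_sub (hF k) hf]
  calc |∫ z, (F k z - f z) ∂μ| ≤ ∫ z, |F k z - f z| ∂μ := abs_integral_le_integral_abs
    _ ≤ ∫ z, (D k z + ε * A k z) ∂μ := by
        refine integral_mono ((hF k).sub hf).abs ((hDi k).add ((hA k).const_mul ε)) fun z => ?_
        have : |F k z - f z| - ε * A k z ≤ D k z := le_max_left _ _
        linarith
    _ = (∫ z, D k z ∂μ) + ε * ∫ z, A k z ∂μ := by
        rw [integral_add (hDi k) ((hA k).const_mul ε), integral_const_mul]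
    _ < η / 2 + η / 2 := by
        refine add_lt_add_of_lt_of_le (hN k hk.le) ?_
        calc ε * ∫ z, A k z ∂μ ≤ ε * M := by gcongr; exact hM k
          _ ≤ η / 2 := by
            rw [hε, div_mul_eq_mul_div, div_le_div_iff₀ (by positivity) two_pos]
            nlinarith
    _ = η := add_halves η

lemma exists_forall_le_of_tendsto {x : ℕ → ℝ} {c : ℝ} (h : Tendsto x atTop (𝓝 c)) :
    ∃ M, 0 ≤ M ∧ ∀ k, |x k| ≤ M := by
  obtain ⟨M, hM⟩ := (Metric.isBounded_range_of_tendsto _ h).exists_norm_le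
  exact ⟨M, (norm_nonneg _).trans (hM _ (mem_range_self 0)), fun k => hM _ (mem_range_self k)⟩

variable {n m : ℕ} {γ : ℝ} {Ω : Set (Pt n m)}

namespace Setting

variable {δ lam p : ℝ} {u₀ : Pt n m → ℝ} {u : H10 γ Ω}

/-- A Cerami sequence with a choice of subgradients. -/
structure IsCerami (δ lam p : ℝ) (u₀ : Pt n m → ℝ) (u : H10 γ Ω) (c : ℝ)
    (v α : ℕ → H10 γ Ω) : Prop where
  isDom : ∀ k, IsDom δ u₀ u (v k)
  mem : ∀ k, α k ∈ frechetSubdiff (constrainedEnergy δ lam p u₀ (aboveSet u)) (v k)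
  energy : Tendsto (fun k => realEnergy δ lam p u₀ (v k)) atTop (𝓝 c)
  slope : Tendsto (fun k => (1 + ‖v k‖) * ‖α k‖) atTop (𝓝 0)

lemma IsCerami.comp {c : ℝ} {v α : ℕ → H10 γ Ω} (hc : IsCerami δ lam p u₀ u c v α)
    {κ : ℕ → ℕ} (hκ : StrictMono κ) :
    IsCerami δ lam p u₀ u c (fun k => v (κ k)) (fun k => α (κ k)) :=
  ⟨fun _ => hc.isDom _, fun _ => hc.mem _, hc.energy.comp hκ.tendsto_atTop,
    hc.slope.comp hκ.tendsto_atTop⟩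

/-- This is the use of the weight 1 + ‖v_k‖ in the Cerami condition: no bound on v_k is known yet.
-/
lemma IsCerami.tendsto_inner {c : ℝ} {v α : ℕ → H10 γ Ω} (hc : IsCerami δ lam p u₀ u c v α)
    (w : H10 γ Ω) : Tendsto (fun k => inner ℝ (α k) (v k - w)) atTop (𝓝 0) := by
  have h1 := hc.slope.const_mul (1 + ‖w‖)
  rw [mul_zero] at h1
  refine squeeze_zero_norm (fun k => ?_) h1
  refine (norm_inner_le_norm _ _).trans ?_
  have h2 := norm_sub_le (v k) w
  have h3 := norm_nonneg (α k)
  have h4 := norm_nonneg w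
  have h5 := norm_nonneg (v k)
  calc ‖α k‖ * ‖v k - w‖ ≤ ‖α k‖ * (‖v k‖ + ‖w‖) := by gcongr
    _ ≤ ‖α k‖ * ((1 + ‖w‖) * (1 + ‖v k‖)) := by gcongr; nlinarith
    _ = _ := by ring

/-- Both gaps are nonnegative and their sum is bounded by `gap_le`, so each is bounded. -/
lemma IsCerami.exists_gap_le (h : Setting δ lam p u₀ u) {c : ℝ} {v α : ℕ → H10 γ Ω}
    (hc : IsCerami δ lam p u₀ u c v α) :
    ∃ M : ℝ, 0 ≤ M ∧ ∀ k, (∫ z in Ω, singularGap δ u₀ u (v k) z) ≤ M ∧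
      lam * (∫ z in Ω, powerGap p u₀ u (v k) z) ≤ M ∧ realEnergy δ lam p u₀ (v k) ≤ M := by
  obtain ⟨M, hM0, hM⟩ := exists_forall_le_of_tendsto hc.energy
  obtain ⟨M', hM0', hM'⟩ := exists_forall_le_of_tendsto (hc.tendsto_inner u)
  refine ⟨M + |realEnergy δ lam p u₀ u| + M', by positivity, fun k => ?_⟩
  have h1 := h.gap_le (hc.isDom k) (hc.mem k)
  have h2 := integral_nonneg_of_ae (h.ae_singularGap_nonneg (hc.isDom k).above)
  have h3 := mul_nonneg h.lam_pos.le
    (integral_nonneg_of_ae (h.ae_powerGap_nonneg (hc.isDom k).above))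
  have h4 := (abs_le.1 (hM k)).2
  have h5 := (abs_le.1 (hM' k)).1
  have h6 := neg_abs_le (realEnergy δ lam p u₀ u)
  have h7 := abs_nonneg (realEnergy δ lam p u₀ u)
  refine ⟨?_, ?_, ?_⟩ <;> linarith

/-- The leading coefficient of the gap is 1/2 - 1/(p + 1), positive exactly when p > 1; the cross
term V ^ p U is split by Young's inequality with parameter η. -/
lemma le_powerGap (h : Setting δ lam p u₀ u) {v : H10 γ Ω} {z : Pt n m} (h1 : 0 < u₀ z)
    (h2 : 0 < u z) (h3 : u z ≤ v z) {η : ℝ} (hη : 0 < η) :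
    (1 / 2 - 1 / (p + 1) - η / 2) * |v z + u₀ z| ^ (p + 1) -
      1 / 2 * (η⁻¹ ^ p + 1) * |u z + u₀ z| ^ (p + 1) ≤ powerGap p u₀ u v z := by
  have hp := h.one_le_p
  have hq := h.q_pos
  set V := v z + u₀ z with hV
  set U := u z + u₀ z with hU
  have hU0 : 0 < U := add_pos h2 h1
  have hV0 : 0 < V := by linarith
  have h4 := rpow_mul_le_add (p := p) (by linarith) hη hV0.le hU0.le
  have h5 : 0 ≤ U ^ p * V := by positivity
  have h6 : 0 ≤ 1 / (p + 1) * U ^ (p + 1) := by positivity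
  have e1 : V ^ (p + 1) = V ^ p * V := Real.rpow_add_one hV0.ne' p
  have e2 : U ^ (p + 1) = U ^ p * U := Real.rpow_add_one hU0.ne' p
  have e3 : v z - u z = V - U := by rw [hV, hU]; ring
  rw [powerGap, ← hV, ← hU, abs_of_pos hU0, abs_of_pos hV0, e3]
  have e4 : (V ^ (p + 1) - U ^ (p + 1)) / (p + 1) =
      1 / (p + 1) * V ^ (p + 1) - 1 / (p + 1) * U ^ (p + 1) := by ring
  rw [e4]
  linear_combination 1 / 2 * h4 + 1 / 2 * h5 + h6 + 1 / 2 * e1 - 1 / 2 * e2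

lemma half_norm_sq_le (h : Setting δ lam p u₀ u) {v : H10 γ Ω} (hv : IsDom δ u₀ u v) :
    1 / 2 * ‖v‖ ^ 2 ≤ realEnergy δ lam p u₀ v +
      lam / (p + 1) * ∫ z in Ω, |v z + u₀ z| ^ (p + 1) := by
  have := integral_nonneg_of_ae (h.ae_GReal_nonneg hv.above)
  rw [realEnergy]
  linarith

lemma IsCerami.exists_norm_le_of_one_lt (h : Setting δ lam p u₀ u) (hp : 1 < p) {c : ℝ}
    {v α : ℕ → H10 γ Ω} (hc : IsCerami δ lam p u₀ u c v α) : ∃ C, ∀ k, ‖v k‖ ≤ C := by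
  obtain ⟨M, hM0, hM⟩ := hc.exists_gap_le h
  have hlam := h.lam_pos
  -- The leading coefficient itself serves as the parameter in Young's inequality, so that half of
  -- it is left over.
  set η := 1 / 2 - 1 / (p + 1) with hη
  have hη0 : 0 < η := by
    rw [hη, sub_pos, div_lt_div_iff₀ (by linarith) two_pos]
    linarith
  set N := ∫ z in Ω, |u z + u₀ z| ^ (p + 1) with hN
  set b := 1 / 2 * (η⁻¹ ^ p + 1) with hb
  set M' := (M / lam + b * N) / (η / 2) with hM'
  have hbound : ∀ k, ∫ z in Ω, |v k z + u₀ z| ^ (p + 1) ≤ M' := by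
    intro k
    have i1 := (h.integrable_add_rpow (v k)).const_mul (η / 2)
    have i2 := (h.integrable_add_rpow u).const_mul b
    have h1 : ∫ z in Ω, (η / 2 * |v k z + u₀ z| ^ (p + 1) - b * |u z + u₀ z| ^ (p + 1)) ≤
        ∫ z in Ω, powerGap p u₀ u (v k) z := by
      refine integral_mono_ae (i1.sub i2) (h.integrable_powerGap_eq (v k)).1 ?_
      filter_upwards [h.ae_pos_u₀, h.solution.pos, (hc.isDom k).above] with z e1 e2 e3
      have := h.le_powerGap e1 e2 e3 hη0
      refine le_trans (le_of_eq ?_) this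
      rw [hb]
      ring
    rw [integral_sub i1 i2, integral_const_mul, integral_const_mul, ← hN] at h1
    have h2 : ∫ z in Ω, powerGap p u₀ u (v k) z ≤ M / lam := by
      rw [le_div_iff₀ hlam, mul_comm]
      exact (hM k).2.1
    rw [hM', le_div_iff₀ (by positivity)]
    linarith
  refine ⟨1 + 2 * (M + lam / (p + 1) * M'), fun k => ?_⟩
  have h1 := h.half_norm_sq_le (hc.isDom k)
  have h2 : lam / (p + 1) * ∫ z in Ω, |v k z + u₀ z| ^ (p + 1) ≤ lam / (p + 1) * M' :=
    mul_le_mul_of_nonneg_left (hbound k) (div_nonneg hlam.le h.q_pos.le)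
  have h3 := (hM k).2.2
  nlinarith [sq_nonneg (‖v k‖ - 1)]

/-- For p = 1 the power gap vanishes identically, so the linear growth of the singular gap must take
its place, applied to a normalized sequence whose norms would tend to infinity. -/
lemma IsCerami.exists_norm_le_of_one_eq (h : Setting δ lam 1 u₀ u) {c : ℝ}
    {v α : ℕ → H10 γ Ω} (hc : IsCerami δ lam 1 u₀ u c v α) : ∃ C, ∀ k, ‖v k‖ ≤ C := by
  by_contra hcon
  push Not at hcon
  obtain ⟨M, hM0, hM⟩ := hc.exists_gap_le h
  have hlam := h.lam_pos
  choose k₀ hk₀ using fun j : ℕ => hcon (j + 1)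
  have hnorm : ∀ j, ‖(‖v (k₀ j)‖⁻¹ • v (k₀ j) : H10 γ Ω)‖ ≤ 1 := fun j => by
    rw [norm_smul, norm_inv, norm_norm]
    exact inv_mul_le_one
  obtain ⟨w, κ, hκ, -, hL2, hae⟩ := H10.exists_subseq_compact h.one_le_n h.one_le_m h.γ_pos
    h.isOpen h.isBounded hnorm
  set x : ℕ → H10 γ Ω := fun j => v (k₀ (κ j)) with hx
  set s : ℕ → ℝ := fun j => ‖x j‖ with hs
  have hsj : ∀ j : ℕ, (j : ℝ) < s j := fun j => by
    have h1 := hk₀ (κ j)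
    have h2 : (j : ℝ) ≤ κ j := by exact_mod_cast hκ.le_apply
    show (j : ℝ) < ‖v (k₀ (κ j))‖
    linarith
  have hs0 : ∀ j, 0 < s j := fun j => (Nat.cast_nonneg j).trans_lt (hsj j)
  have hs_atTop : Tendsto s atTop atTop :=
    tendsto_atTop_mono (fun j => (hsj j).le) tendsto_natCast_atTop_atTop
  have hsinv : Tendsto (fun j => (s j)⁻¹) atTop (𝓝 0) := tendsto_inv_atTop_zero.comp hs_atTop
  have hcoe : ∀ j, ((s j)⁻¹ • x j : H10 γ Ω) =ᵐ[volume.restrict Ω] fun z => (s j)⁻¹ * x j z :=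
    fun j => H10.coe_smul _ _
  have hdom : ∀ j, IsDom δ u₀ u (x j) := fun j => hc.isDom _
  have hae' : ∀ᵐ z ∂volume.restrict Ω, Tendsto (fun j => (s j)⁻¹ * x j z) atTop (𝓝 (w z)) := by
    filter_upwards [hae, ae_all_iff.2 hcoe] with z e1 e2
    simpa only [← e2] using e1
  -- the weak limit vanishes
  have hw0 : ∀ᵐ z ∂volume.restrict Ω, w z = 0 := by
    set c₁ : ℝ := 4 * 4 ^ (1 / δ) with hc₁
    -- The linear lower bound of `le_GReal_sub_trapezoid`, divided by the norm s_j. It tends to (u +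
    -- u₀)^(-δ) w / 4, while the divided gaps have integrals at most M / s_j.
    set f : ℕ → Pt n m → ℝ := fun j z => 1 / 4 * (u z + u₀ z) ^ (-δ) *
      ((s j)⁻¹ * x j z - (s j)⁻¹ * u z - c₁ * (s j)⁻¹ * (u z + u₀ z)) with hf
    have hUm : AEMeasurable (fun z => u z + u₀ z) (volume.restrict Ω) :=
      (h.aemeasurable u).add h.aestronglyMeasurable_u₀.aemeasurable
    have hfm : ∀ j, AEMeasurable (f j) (volume.restrict Ω) := fun j =>
      ((hUm.pow_const (-δ)).const_mul (1 / 4)).mul ((((h.aemeasurable (x j)).const_mul _).sub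
        ((h.aemeasurable u).const_mul _)).sub (hUm.const_mul _))
    have hfle : ∀ j, ∀ᵐ z ∂volume.restrict Ω, f j z ≤ (s j)⁻¹ * singularGap δ u₀ u (x j) z := by
      intro j
      filter_upwards [h.ae_pos_u₀, h.solution.pos, (hdom j).above] with z e1 e2 e3
      have h1 := le_GReal_sub_trapezoid h.δ_pos e1 e2.le e3
      have h2 := mul_le_mul_of_nonneg_left h1 (inv_nonneg.2 (hs0 j).le)
      refine le_trans (le_of_eq ?_) h2
      simp only [hf, hc₁]
      ring
    have hlimf : ∀ᵐ z ∂volume.restrict Ω, Tendsto (fun j => ENNReal.ofReal (f j z)) atTop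
        (𝓝 (ENNReal.ofReal (1 / 4 * (u z + u₀ z) ^ (-δ) * w z))) := by
      filter_upwards [hae'] with z e1
      refine ENNReal.tendsto_ofReal ?_
      have h1 := ((e1.sub (hsinv.mul_const (u z))).sub
        ((hsinv.const_mul c₁).mul_const (u z + u₀ z))).const_mul
        (1 / 4 * (u z + u₀ z) ^ (-δ))
      rw [zero_mul, sub_zero, mul_zero, zero_mul, sub_zero] at h1
      exact h1
    have hzero : ∫⁻ z in Ω, ENNReal.ofReal (1 / 4 * (u z + u₀ z) ^ (-δ) * w z) = 0 := by
      refine le_antisymm ?_ bot_le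
      have hb : Tendsto (fun j => ENNReal.ofReal ((s j)⁻¹ * M)) atTop (𝓝 0) := by
        have h1 := ENNReal.tendsto_ofReal (hsinv.mul_const M)
        simpa using h1
      calc ∫⁻ z in Ω, ENNReal.ofReal (1 / 4 * (u z + u₀ z) ^ (-δ) * w z) ≤
            ∫⁻ z in Ω, liminf (fun j => ENNReal.ofReal (f j z)) atTop :=
            lintegral_mono_ae (hlimf.mono fun z hz => hz.liminf_eq.ge)
        _ ≤ liminf (fun j => ∫⁻ z in Ω, ENNReal.ofReal (f j z)) atTop :=
            lintegral_liminf_le' fun j => (hfm j).ennreal_ofReal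
        _ ≤ liminf (fun j => ENNReal.ofReal ((s j)⁻¹ * M)) atTop := by
            refine liminf_le_liminf (Eventually.of_forall fun j => ?_)
            have i1 := ((h.integrable_singularGap_eq (hdom j)).1).const_mul (s j)⁻¹
            calc ∫⁻ z in Ω, ENNReal.ofReal (f j z) ≤
                  ∫⁻ z in Ω, ENNReal.ofReal ((s j)⁻¹ * singularGap δ u₀ u (x j) z) :=
                  lintegral_mono_ae ((hfle j).mono fun z hz => ENNReal.ofReal_le_ofReal hz)
              _ = ENNReal.ofReal (∫ z in Ω, (s j)⁻¹ * singularGap δ u₀ u (x j) z) := by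
                  rw [ofReal_integral_eq_lintegral_ofReal i1]
                  filter_upwards [h.ae_singularGap_nonneg (hdom j).above] with z e1
                  exact mul_nonneg (inv_nonneg.2 (hs0 j).le) e1
              _ ≤ ENNReal.ofReal ((s j)⁻¹ * M) := by
                  rw [integral_const_mul]
                  exact ENNReal.ofReal_le_ofReal (mul_le_mul_of_nonneg_left (hM _).1
                    (inv_nonneg.2 (hs0 j).le))
        _ = 0 := hb.liminf_eq
    have hm : AEMeasurable (fun z => 1 / 4 * (u z + u₀ z) ^ (-δ) * w z) (volume.restrict Ω) :=
      ((hUm.pow_const (-δ)).const_mul (1 / 4)).mul (h.aemeasurable w)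
    rw [lintegral_eq_zero_iff' hm.ennreal_ofReal] at hzero
    filter_upwards [hzero, hae', ae_all_iff.2 fun j => (hdom j).above, h.ae_pos_u₀, h.solution.pos]
      with z e1 e2 e3 e4 e5
    have h1 := ENNReal.ofReal_eq_zero.1 e1
    have h2 : 0 < 1 / 4 * (u z + u₀ z) ^ (-δ) := by
      have : 0 < u z + u₀ z := add_pos e5 e4
      positivity
    refine le_antisymm (nonpos_of_mul_nonpos_right h1 h2) (ge_of_tendsto' e2 fun j => ?_)
    exact mul_nonneg (inv_nonneg.2 (hs0 j).le) (e5.le.trans (e3 j))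
  have hw : H10.toL2 w = 0 := (Lp.eq_zero_iff_ae_eq_zero).2 hw0
  rw [hw] at hL2
  -- the energy inequality, divided by the square of the norm
  set N₀ := ∫ z in Ω, |u₀ z| ^ ((1 : ℝ) + 1) with hN₀
  have hsq : ∀ a : ℝ, |a| ^ ((1 : ℝ) + 1) = a ^ 2 := fun a => by
    rw [one_add_one_eq_two, Real.rpow_two, sq_abs]
  have hkey : ∀ j, 1 / 2 ≤ (M + lam * N₀) * (s j)⁻¹ ^ 2 +
      lam * ‖H10.toL2 ((s j)⁻¹ • x j : H10 γ Ω)‖ ^ 2 := by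
    intro j
    have h1 := h.half_norm_sq_le (hdom j)
    have h2 := (hM (k₀ (κ j))).2.2
    have i0 := h.integrable_rpow_of_memLp h.q_pos h.le_critExp h.memLp_u₀
    have h3 : ∫ z in Ω, |x j z + u₀ z| ^ ((1 : ℝ) + 1) ≤
        2 * (∫ z in Ω, |x j z| ^ ((1 : ℝ) + 1)) + 2 * N₀ := by
      rw [hN₀, ← integral_const_mul, ← integral_const_mul, ← integral_add
        ((h.integrable_rpow (x j)).const_mul 2) (i0.const_mul 2)]
      refine integral_mono (h.integrable_add_rpow (x j))
        (((h.integrable_rpow (x j)).const_mul 2).add (i0.const_mul 2)) fun z => ?_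
      simp only [hsq]
      nlinarith [sq_nonneg (x j z - u₀ z)]
    have h4 : ‖H10.toL2 ((s j)⁻¹ • x j : H10 γ Ω)‖ ^ 2 =
        (s j)⁻¹ ^ 2 * ∫ z in Ω, |x j z| ^ ((1 : ℝ) + 1) := by
      rw [map_smul, norm_smul, mul_pow, Real.norm_eq_abs, sq_abs,
        ← real_inner_self_eq_norm_sq (H10.toL2 (x j)), L2.inner_def]
      congr 1
      refine integral_congr_ae (Eventually.of_forall fun z => ?_)
      simp only [hsq]
      exact (real_inner_self_eq_norm_sq (x j z)).trans (by rw [Real.norm_eq_abs, sq_abs])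
    rw [h4]
    have h5 : lam / (1 + 1) * ∫ z in Ω, |x j z + u₀ z| ^ ((1 : ℝ) + 1) ≤
        lam * (∫ z in Ω, |x j z| ^ ((1 : ℝ) + 1)) + lam * N₀ := by
      have := mul_le_mul_of_nonneg_left h3 (by positivity : 0 ≤ lam / (1 + 1))
      linarith
    have h6 : 1 / 2 * s j ^ 2 ≤ M + lam * N₀ + lam * ∫ z in Ω, |x j z| ^ ((1 : ℝ) + 1) := by
      have h2' : realEnergy δ lam 1 u₀ (x j) ≤ M := h2
      have h1' : 1 / 2 * s j ^ 2 ≤ _ := h1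
      linarith
    have h7 := mul_le_mul_of_nonneg_left h6 (sq_nonneg (s j)⁻¹)
    have h8 : (s j)⁻¹ ^ 2 * (1 / 2 * s j ^ 2) = 1 / 2 := by
      have := (hs0 j).ne'
      field_simp
    linarith
  have hlim : Tendsto (fun j => (M + lam * N₀) * (s j)⁻¹ ^ 2 +
      lam * ‖H10.toL2 ((s j)⁻¹ • x j : H10 γ Ω)‖ ^ 2) atTop (𝓝 0) := by
    have h1 := ((hsinv.pow 2).const_mul (M + lam * N₀)).add ((hL2.norm.pow 2).const_mul lam)
    simpa using h1
  have := ge_of_tendsto' hlim hkey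
  norm_num at this

lemma IsCerami.exists_norm_le (h : Setting δ lam p u₀ u) {c : ℝ}
    {v α : ℕ → H10 γ Ω} (hc : IsCerami δ lam p u₀ u c v α) : ∃ C, ∀ k, ‖v k‖ ≤ C := by
  rcases h.one_le_p.eq_or_lt with rfl | hp
  · exact hc.exists_norm_le_of_one_eq h
  · exact hc.exists_norm_le_of_one_lt h hp

end Setting

end Grushin

namespace Grushin

/-! ### Compactness of Cerami sequences -/

/-- Young's inequality with a large parameter η; since p ≥ 1, the other coefficient η^(-p) is at
most η⁻¹ ≤ ε. -/
lemma exists_rpow_mul_le {p ε : ℝ} (hp : 1 ≤ p) (hε : 0 < ε) :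
    ∃ C : ℝ, 0 ≤ C ∧ ∀ x y : ℝ, 0 ≤ x → 0 ≤ y →
      x ^ p * y ≤ C * x ^ (p + 1) + ε * y ^ (p + 1) := by
  set η := max 1 ε⁻¹ with hη
  have h1 : 1 ≤ η := le_max_left _ _
  have h0 : 0 < η := by linarith
  refine ⟨η, h0.le, fun x y hx hy => ?_⟩
  refine (rpow_mul_le_add (by linarith) h0 hx hy).trans ?_
  have h2 : η⁻¹ ^ p ≤ ε := by
    calc η⁻¹ ^ p ≤ η⁻¹ ^ (1 : ℝ) :=
          Real.rpow_le_rpow_of_exponent_ge (by positivity) (inv_le_one_of_one_le₀ h1) hp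
      _ = η⁻¹ := Real.rpow_one _
      _ ≤ ε := inv_le_of_inv_le₀ hε (le_max_right _ _)
  gcongr

lemma exists_rpow_le {q s ε : ℝ} (hq : 0 < q) (hqs : q < s) (hε : 0 < ε) :
    ∃ C : ℝ, 0 ≤ C ∧ ∀ t : ℝ, 0 ≤ t → t ^ q ≤ ε * t ^ s + C := by
  -- The threshold where ε t ^ (s - q) = 1; above it ε t ^ s exceeds t ^ q.
  set T := ε⁻¹ ^ (1 / (s - q)) with hT
  have hT0 : 0 < T := by positivity
  refine ⟨T ^ q, by positivity, fun t ht => ?_⟩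
  rcases le_total t T with h | h
  · have h1 : t ^ q ≤ T ^ q := Real.rpow_le_rpow ht h hq.le
    have h2 : 0 ≤ ε * t ^ s := by positivity
    linarith
  · have ht0 : 0 < t := hT0.trans_le h
    have h1 : T ^ (s - q) ≤ t ^ (s - q) := Real.rpow_le_rpow hT0.le h (by linarith)
    rw [hT, ← Real.rpow_mul (by positivity), one_div_mul_cancel (by linarith), Real.rpow_one] at h1
    have h2 : t ^ s = t ^ (s - q) * t ^ q := by rw [← Real.rpow_add ht0]; ring_nf
    have h3 : 1 ≤ ε * t ^ (s - q) := by
      calc 1 = ε * ε⁻¹ := (mul_inv_cancel₀ hε.ne').symm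
        _ ≤ _ := by gcongr
    have h4 : 0 ≤ t ^ q := by positivity
    have h5 : 0 ≤ T ^ q := by positivity
    rw [h2]
    nlinarith

/-- For r ≥ 0 compare (r + V)^p with r ^ p. For r ≤ 0, positivity of V + r forces |r| ≤ V, and every
term is bounded by V ^ (p + 1). -/
lemma exists_abs_rpow_mul_sub_le {p ε : ℝ} (hp : 1 ≤ p) (hε : 0 < ε) :
    ∃ C : ℝ, 0 ≤ C ∧ ∀ V r : ℝ, 0 ≤ V → 0 ≤ V + r →
      |(V + r) ^ p * r - |r| ^ (p + 1)| ≤ ε * |r| ^ (p + 1) + C * V ^ (p + 1) := by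
  obtain ⟨C₁, hC₁, h1⟩ := exists_abs_rpow_add_sub_le hp (half_pos hε)
  obtain ⟨C₂, hC₂, h2⟩ := exists_rpow_mul_le (ε := ε / (2 * (C₁ + 1))) hp (by positivity)
  refine ⟨C₁ * C₂ + 2, by positivity, fun V r hV hVr => ?_⟩
  have hq : 0 < p + 1 := by linarith
  have hone : ∀ a : ℝ, 0 ≤ a → a ^ (p + 1) = a ^ p * a := fun a ha => by
    rw [Real.rpow_add_one' ha hq.ne']
  rcases le_total 0 r with hr | hr
  · have h3 := h1 r V
    rw [abs_of_nonneg hr, abs_of_nonneg hV, add_comm r V, abs_of_nonneg hVr] at h3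
    have h4 := h2 V r hV hr
    rw [abs_of_nonneg hr, hone r hr, ← sub_mul, abs_mul, abs_of_nonneg hr]
    have h5 := mul_le_mul_of_nonneg_right h3 hr
    have h6 := mul_le_mul_of_nonneg_left h4 hC₁
    have h7 : C₁ * (ε / (2 * (C₁ + 1)) * r ^ (p + 1)) ≤ ε / 2 * r ^ (p + 1) := by
      rw [← mul_assoc]
      have : C₁ * (ε / (2 * (C₁ + 1))) ≤ ε / 2 := by
        rw [mul_div_assoc', div_le_div_iff₀ (by positivity) two_pos]
        nlinarith
      gcongr
    rw [hone r hr] at h6 h7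
    have h8 : 0 ≤ V ^ (p + 1) := by positivity
    nlinarith
  · have hrV : |r| ≤ V := by rw [abs_of_nonpos hr]; linarith
    have h3 : |(V + r) ^ p * r| ≤ V ^ (p + 1) := by
      rw [abs_mul, abs_of_nonneg (by positivity), hone V hV]
      have : V + r ≤ V := by linarith
      gcongr
    have h4 : |r| ^ (p + 1) ≤ V ^ (p + 1) := by gcongr
    have h5 := abs_sub ((V + r) ^ p * r) (|r| ^ (p + 1))
    rw [abs_of_nonneg (by positivity : 0 ≤ |r| ^ (p + 1))] at h5
    have h6 : 0 ≤ ε * |r| ^ (p + 1) := by positivity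
    have h7 : 0 ≤ C₁ * C₂ * V ^ (p + 1) := by positivity
    linarith

variable {n m : ℕ} {γ : ℝ} {Ω : Set (Pt n m)}

namespace Setting

variable {δ lam p : ℝ} {u₀ : Pt n m → ℝ} {u : H10 γ Ω}

/-- The Sobolev inequality with the optimal constant. -/
lemma sobolevConst_mul_le (hs0 : 0 < critExp n m γ) (w : H10 γ Ω) :
    sobolevConst γ Ω * (∫ z in Ω, |w z| ^ critExp n m γ) ^ (2 / critExp n m γ) ≤ ‖w‖ ^ 2 := by
  set s := critExp n m γ with hs
  set I := ∫ z in Ω, |w z| ^ s with hI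
  have hI0 : 0 ≤ I := integral_nonneg fun z => by positivity
  by_cases hc : I ^ (2 / s) = 0
  · rw [hc, mul_zero]
    positivity
  · have hpos : 0 < I ^ (2 / s) := lt_of_le_of_ne (by positivity) (Ne.symm hc)
    rw [← le_div_iff₀ hpos]
    refine csInf_le ⟨0, ?_⟩ ⟨w, ?_, rfl⟩
    · rintro _ ⟨x, -, rfl⟩
      have : 0 ≤ ∫ z in Ω, |x z| ^ s := integral_nonneg fun z => by positivity
      positivity
    · intro h0
      apply hc
      have h1 : I = 0 := by
        refine integral_eq_zero_of_ae ?_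
        filter_upwards [h0] with z hz
        simp only [hz, Pi.zero_apply, abs_zero, Real.zero_rpow hs0.ne']
      rw [h1, Real.zero_rpow (by positivity)]

lemma sobolevConst_nonneg : 0 ≤ sobolevConst γ Ω := by
  refine Real.sInf_nonneg ?_
  rintro _ ⟨x, -, rfl⟩
  have : 0 ≤ ∫ z in Ω, |x z| ^ critExp n m γ := integral_nonneg fun z => by positivity
  positivity

/-- Bounds for the superlinear part of the energy on bounded sets. -/
lemma exists_integral_add_rpow_le (h : Setting δ lam p u₀ u) {r : ℝ} (hr : 1 ≤ r)
    (hrc : r ≤ critExp n m γ) {x : ℕ → H10 γ Ω} {C : ℝ} (hC : ∀ k, ‖x k‖ ≤ C) :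
    ∃ B : ℝ, ∀ k, ∫ z in Ω, |x k z + u₀ z| ^ r ≤ B := by
  have hr0 : 0 < r := by linarith
  obtain ⟨K, hK, hS⟩ := h.exists_integral_rpow_le hr0 hrc
  obtain ⟨C₁, hC₁, h1⟩ := exists_abs_rpow_add_sub_le hr one_pos
  refine ⟨2 * (K * C ^ r) + C₁ * ∫ z in Ω, |u₀ z| ^ r, fun k => ?_⟩
  have i1 := h.integrable_rpow_of_memLp hr0 hrc
    (H10.memLp_critExp h.one_le_n h.one_le_m h.γ_pos h.isOpen (x k))
  have i2 := h.integrable_rpow_of_memLp hr0 hrc h.memLp_u₀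
  calc ∫ z in Ω, |x k z + u₀ z| ^ r ≤ ∫ z in Ω, (2 * |x k z| ^ r + C₁ * |u₀ z| ^ r) := by
        refine integral_mono (h.integrable_rpow_of_memLp hr0 hrc (h.memLp_add _))
          ((i1.const_mul 2).add (i2.const_mul C₁)) fun z => ?_
        have := (abs_le.1 (h1 (x k z) (u₀ z))).2
        show |x k z + u₀ z| ^ r ≤ 2 * |x k z| ^ r + C₁ * |u₀ z| ^ r
        linarith
    _ = 2 * (∫ z in Ω, |x k z| ^ r) + C₁ * ∫ z in Ω, |u₀ z| ^ r := by
        rw [integral_add (i1.const_mul 2) (i2.const_mul C₁), integral_const_mul,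
          integral_const_mul]
    _ ≤ _ := by
        gcongr
        refine (hS _).trans ?_
        gcongr
        exact hC k

/-- A Cerami sequence together with its weak limit. -/
structure IsWeakCerami (δ lam p : ℝ) (u₀ : Pt n m → ℝ) (u : H10 γ Ω) (c : ℝ)
    (x β : ℕ → H10 γ Ω) (v : H10 γ Ω) : Prop extends IsCerami δ lam p u₀ u c x β where
  bounded : ∃ C, ∀ k, ‖x k‖ ≤ C
  weak : ∀ w, Tendsto (fun k => inner ℝ (x k) w) atTop (𝓝 (inner ℝ v w))
  ae_tendsto : ∀ᵐ z ∂volume.restrict Ω, Tendsto (fun k => x k z) atTop (𝓝 (v z))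

lemma IsWeakCerami.comp {c : ℝ} {x β : ℕ → H10 γ Ω} {v : H10 γ Ω}
    (hx : IsWeakCerami δ lam p u₀ u c x β v) {κ : ℕ → ℕ} (hκ : StrictMono κ) :
    IsWeakCerami δ lam p u₀ u c (fun k => x (κ k)) (fun k => β (κ k)) v :=
  ⟨hx.toIsCerami.comp hκ, hx.bounded.imp fun _ hC _ => hC _,
    fun w => (hx.weak w).comp hκ.tendsto_atTop,
    hx.ae_tendsto.mono fun _ hz => hz.comp hκ.tendsto_atTop⟩

lemma IsCerami.exists_isWeakCerami (h : Setting δ lam p u₀ u) {c : ℝ} {v α : ℕ → H10 γ Ω}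
    (hc : IsCerami δ lam p u₀ u c v α) : ∃ (κ : ℕ → ℕ) (w : H10 γ Ω), StrictMono κ ∧
      IsWeakCerami δ lam p u₀ u c (fun k => v (κ k)) (fun k => α (κ k)) w := by
  obtain ⟨C, hC⟩ := hc.exists_norm_le h
  obtain ⟨w, κ, hκ, h1, -, h2⟩ := H10.exists_subseq_compact h.one_le_n h.one_le_m h.γ_pos
    h.isOpen h.isBounded hC
  exact ⟨κ, w, hκ, hc.comp hκ, ⟨C, fun _ => hC _⟩, h1, h2⟩

/-- Bounded energy and bounded power term bound ∫ G(x_k); Fatou transfers this to the limit. -/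
lemma IsWeakCerami.isDom_limit (h : Setting δ lam p u₀ u) {c : ℝ} {x β : ℕ → H10 γ Ω}
    {v : H10 γ Ω} (hx : IsWeakCerami δ lam p u₀ u c x β v) : IsDom δ u₀ u v := by
  obtain ⟨C, hC⟩ := hx.bounded
  obtain ⟨B, hB⟩ := h.exists_integral_add_rpow_le (r := p + 1) (by linarith [h.one_le_p])
    h.le_critExp hC
  obtain ⟨M, hM0, hM⟩ := exists_forall_le_of_tendsto hx.energy
  refine (h.isDom_of_tendsto hx.isDom hx.ae_tendsto (t := fun _ => M + lam / (p + 1) * B)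
    (fun k => ?_) tendsto_const_nhds).1
  have h1 := (abs_le.1 (hM k)).2
  have h2 : lam / (p + 1) * ∫ z in Ω, |x k z + u₀ z| ^ (p + 1) ≤ lam / (p + 1) * B :=
    mul_le_mul_of_nonneg_left (hB k) (div_nonneg h.lam_pos.le h.q_pos.le)
  rw [realEnergy] at h1
  nlinarith [sq_nonneg ‖x k‖]

/-- The distance to the weak limit is controlled by the power term. -/
lemma IsWeakCerami.exists_norm_sub_sq_le (h : Setting δ lam p u₀ u) {c : ℝ} {x β : ℕ → H10 γ Ω}
    {v : H10 γ Ω} (hx : IsWeakCerami δ lam p u₀ u c x β v) :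
    ∃ o : ℕ → ℝ, Tendsto o atTop (𝓝 0) ∧ ∀ k, ‖x k - v‖ ^ 2 ≤
      lam * (∫ z in Ω, |x k z + u₀ z| ^ p * (x k - v) z) + o k := by
  have hv := hx.isDom_limit h
  -- The minimum of G(x_k) and G(v) is dominated by G(v) and tends to it a.e. Thus ∫ G(v) - ∫ G(x_k)
  -- is at most an o(1), without convergence of ∫ G(x_k).
  set mn : ℕ → Pt n m → ℝ := fun k z => min (GReal δ (u₀ z) (x k z)) (GReal δ (u₀ z) (v z)) with hmn
  have hmi : ∀ k, Integrable (mn k) (volume.restrict Ω) := fun k =>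
    (hx.isDom k).integrable.inf hv.integrable
  have hlim : Tendsto (fun k => ∫ z in Ω, mn k z) atTop (𝓝 (∫ z in Ω, GReal δ (u₀ z) (v z))) := by
    refine tendsto_integral_of_dominated_convergence (fun z => GReal δ (u₀ z) (v z))
      (fun k => (hmi k).aestronglyMeasurable) hv.integrable (fun k => ?_) ?_
    · filter_upwards [h.ae_GReal_nonneg (hx.isDom k).above, h.ae_GReal_nonneg hv.above]
        with z e1 e2
      rw [Real.norm_of_nonneg (le_min e1 e2)]
      exact min_le_right _ _
    · filter_upwards [hx.ae_tendsto, h.ae_pos hv.above, h.ae_pos_u₀] with z e1 e2 e3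
      have := (h.tendsto_GReal e3 e2 e1).min (tendsto_const_nhds (x := GReal δ (u₀ z) (v z)))
      rwa [min_self] at this
  refine ⟨fun k => inner ℝ (β k) (x k - v) - (inner ℝ (x k) v - inner ℝ v v) +
    ((∫ z in Ω, GReal δ (u₀ z) (v z)) - ∫ z in Ω, mn k z), ?_, fun k => ?_⟩
  · have h1 := ((hx.tendsto_inner v).sub ((hx.weak v).sub_const (inner ℝ v v))).add
      (hlim.const_sub (∫ z in Ω, GReal δ (u₀ z) (v z)))
    simpa using h1
  · have h1 := h.inner_subgradient_le (hx.isDom k) (hx.mem k) hv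
    have h2 : ∫ z in Ω, mn k z ≤ ∫ z in Ω, GReal δ (u₀ z) (x k z) :=
      integral_mono (hmi k) (hx.isDom k).integrable fun z => min_le_left _ _
    have h3 : ∫ z in Ω, |x k z + u₀ z| ^ p * (v - x k) z =
        - ∫ z in Ω, |x k z + u₀ z| ^ p * (x k - v) z := by
      rw [← integral_neg]
      refine integral_congr_ae ?_
      filter_upwards [H10.coe_sub v (x k), H10.coe_sub (x k) v] with z e1 e2
      rw [e1, e2]
      ring
    have h4 : inner ℝ (β k) (v - x k) = - inner ℝ (β k) (x k - v) := by
      rw [← inner_neg_right, neg_sub]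
    have h5 : ‖x k - v‖ ^ 2 = - inner ℝ (x k) (v - x k) - (inner ℝ (x k) v - inner ℝ v v) := by
      rw [← real_inner_self_eq_norm_sq, inner_sub_left, inner_sub_right, inner_sub_right,
        inner_sub_right, real_inner_comm (x k) v]
      ring
    rw [h3, h4] at h1
    linarith

lemma IsWeakCerami.tendsto_of_sq {c : ℝ} {x β : ℕ → H10 γ Ω} {v : H10 γ Ω}
    (_hx : IsWeakCerami δ lam p u₀ u c x β v) {t : ℕ → ℝ} (ht : Tendsto t atTop (𝓝 0))
    (h : ∀ k, ‖x k - v‖ ^ 2 ≤ t k) : Tendsto x atTop (𝓝 v) := by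
  rw [tendsto_iff_norm_sub_tendsto_zero]
  have h1 : Tendsto (fun k => ‖x k - v‖ ^ 2) atTop (𝓝 0) :=
    squeeze_zero (fun _ => sq_nonneg _) h ht
  have h2 := h1.sqrt
  simpa [Real.sqrt_sq (norm_nonneg _)] using h2

/-- The subcritical case. -/
lemma IsWeakCerami.tendsto_of_subcritical (h : Setting δ lam p u₀ u)
    (hpc : p + 1 < critExp n m γ) {c : ℝ} {x β : ℕ → H10 γ Ω} {v : H10 γ Ω}
    (hx : IsWeakCerami δ lam p u₀ u c x β v) : Tendsto x atTop (𝓝 v) := by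
  have hfin := H10.isFiniteMeasure_restrict h.isBounded
  have hs := H10.critExp_gt_two h.one_le_n h.one_le_m h.γ_pos
  obtain ⟨o, ho, hxo⟩ := hx.exists_norm_sub_sq_le h
  obtain ⟨C, hC⟩ := hx.bounded
  obtain ⟨B, hB⟩ := h.exists_integral_add_rpow_le (r := critExp n m γ) (by linarith) le_rfl hC
  obtain ⟨K, hK, hS⟩ := h.exists_integral_rpow_le (r := critExp n m γ) (by linarith) le_rfl
  set s := critExp n m γ with hsdef
  have i1 : ∀ k, Integrable (fun z => |x k z + u₀ z| ^ s) (volume.restrict Ω) := fun k =>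
    h.integrable_rpow_of_memLp (by linarith) le_rfl (h.memLp_add _)
  have i2 : ∀ k, Integrable (fun z => |(x k - v) z| ^ s) (volume.restrict Ω) := fun k =>
    h.integrable_rpow_of_memLp (by linarith) le_rfl
      (H10.memLp_critExp h.one_le_n h.one_le_m h.γ_pos h.isOpen _)
  have hlim := tendsto_integral_of_approx_dominated (μ := volume.restrict Ω)
    (F := fun k z => |x k z + u₀ z| ^ p * (x k - v) z)
    (A := fun k z => |x k z + u₀ z| ^ s + |(x k - v) z| ^ s) (f := fun _ => 0)
    (M := B + K * (C + ‖v‖) ^ s) (fun k => h.integrable_rpow_mul _ _) (integrable_zero _ _ _)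
    (fun k => (i1 k).add (i2 k)) (fun k => Eventually.of_forall fun z => by positivity)
    (fun k => by
      rw [integral_add (i1 k) (i2 k)]
      refine add_le_add (hB k) ((hS _).trans ?_)
      have : ‖x k - v‖ ≤ C + ‖v‖ := (norm_sub_le _ _).trans (by gcongr; exact hC k)
      gcongr)
    (by
      filter_upwards [hx.ae_tendsto, ae_all_iff.2 fun k => H10.coe_sub (x k) v] with z e1 e2
      simp only [e2]
      have h1 := (((e1.add_const (u₀ z)).abs).rpow_const (p := p)
        (Or.inr (by linarith [h.one_le_p]))).mul (e1.sub_const (v z))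
      rwa [sub_self, mul_zero] at h1)
    -- Strict subcriticality: t ^ (p + 1) is at most ε t ^ s plus a constant, and constants are
    -- integrable on a bounded domain.
    (fun ε hε => by
      obtain ⟨D, hD, hDb⟩ := exists_rpow_le h.q_pos hpc hε
      refine ⟨fun _ => 2 * D, integrable_const _, fun k => Eventually.of_forall fun z => ?_⟩
      have h1 := rpow_mul_le_add (p := p) (by linarith [h.one_le_p]) one_pos
        (abs_nonneg (x k z + u₀ z)) (abs_nonneg ((x k - v) z))
      rw [inv_one, Real.one_rpow, one_mul, one_mul] at h1
      have h2 := hDb _ (abs_nonneg (x k z + u₀ z))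
      have h3 := hDb _ (abs_nonneg ((x k - v) z))
      rw [abs_mul, abs_of_nonneg (by positivity : 0 ≤ |x k z + u₀ z| ^ p)]
      linarith)
  rw [integral_zero] at hlim
  refine hx.tendsto_of_sq (t := fun k =>
    lam * (∫ z in Ω, |x k z + u₀ z| ^ p * (x k - v) z) + o k) ?_ hxo
  simpa using (hlim.const_mul lam).add ho

/-- A Brezis–Lieb property of the power term. -/
lemma IsWeakCerami.tendsto_integral_rpow_mul (h : Setting δ lam p u₀ u) {c : ℝ}
    {x β : ℕ → H10 γ Ω} {v : H10 γ Ω} (hx : IsWeakCerami δ lam p u₀ u c x β v) :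
    Tendsto (fun k => (∫ z in Ω, |x k z + u₀ z| ^ p * (x k - v) z) -
      ∫ z in Ω, |(x k - v) z| ^ (p + 1)) atTop (𝓝 0) := by
  have hv := hx.isDom_limit h
  obtain ⟨C, hC⟩ := hx.bounded
  obtain ⟨K, hK, hS⟩ := h.exists_integral_rpow_le h.q_pos h.le_critExp
  have hlim := tendsto_integral_of_approx_dominated (μ := volume.restrict Ω)
    (F := fun k z => |x k z + u₀ z| ^ p * (x k - v) z - |(x k - v) z| ^ (p + 1))
    (A := fun k z => |(x k - v) z| ^ (p + 1)) (f := fun _ => 0)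
    (M := K * (C + ‖v‖) ^ (p + 1))
    (fun k => (h.integrable_rpow_mul _ _).sub (h.integrable_rpow _)) (integrable_zero _ _ _)
    (fun k => h.integrable_rpow _) (fun k => Eventually.of_forall fun z => by positivity)
    (fun k => by
      refine (hS _).trans ?_
      have : ‖x k - v‖ ≤ C + ‖v‖ := (norm_sub_le _ _).trans (by gcongr; exact hC k)
      have := h.q_pos
      gcongr)
    (by
      filter_upwards [hx.ae_tendsto, ae_all_iff.2 fun k => H10.coe_sub (x k) v] with z e1 e2
      simp only [e2]
      have h1 := (((e1.add_const (u₀ z)).abs).rpow_const (p := p)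
        (Or.inr (by linarith [h.one_le_p]))).mul (e1.sub_const (v z))
      have h2 := ((e1.sub_const (v z)).abs).rpow_const (p := p + 1) (Or.inr h.q_pos.le)
      have h3 := h1.sub h2
      rwa [sub_self, mul_zero, abs_zero, Real.zero_rpow h.q_pos.ne', sub_zero] at h3)
    (fun ε hε => by
      obtain ⟨D, hD, hDb⟩ := exists_abs_rpow_mul_sub_le h.one_le_p hε
      refine ⟨fun z => D * |v z + u₀ z| ^ (p + 1), (h.integrable_add_rpow v).const_mul D,
        fun k => ?_⟩
      filter_upwards [H10.coe_sub (x k) v, h.ae_pos hv.above, h.ae_pos (hx.isDom k).above,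
        h.ae_pos_u₀] with z e1 e2 e3 e4
      have h1 := hDb (v z + u₀ z) ((x k - v) z) (add_pos e2 e4).le
        (by rw [e1]; linarith)
      rw [show v z + u₀ z + (x k - v) z = x k z + u₀ z by rw [e1]; ring] at h1
      rwa [abs_of_pos (add_pos e3 e4), abs_of_pos (add_pos e2 e4)])
  rw [integral_zero] at hlim
  refine hlim.congr fun k => ?_
  rw [integral_sub (h.integrable_rpow_mul _ _) (h.integrable_rpow _)]

/-- A Brezis–Lieb property of the error in the trapezoid rule. -/
lemma IsWeakCerami.tendsto_integral_powerGap (h : Setting δ lam p u₀ u) {c : ℝ}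
    {x β : ℕ → H10 γ Ω} {v : H10 γ Ω} (hx : IsWeakCerami δ lam p u₀ u c x β v) :
    Tendsto (fun k => (∫ z in Ω, powerGap p u₀ u (x k) z) -
      (1 / 2 - 1 / (p + 1)) * ∫ z in Ω, |(x k - v) z| ^ (p + 1)) atTop
      (𝓝 (∫ z in Ω, powerGap p u₀ u v z)) := by
  have hv := hx.isDom_limit h
  have hp := h.one_le_p
  have hq := h.q_pos
  obtain ⟨C, hC⟩ := hx.bounded
  obtain ⟨K, hK, hS⟩ := h.exists_integral_rpow_le h.q_pos h.le_critExp
  obtain ⟨B, hB⟩ := h.exists_integral_add_rpow_le (r := p + 1) (by linarith) h.le_critExp hC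
  set κ := 1 / 2 - 1 / (p + 1) with hκ
  have hκ0 : 0 ≤ κ := by
    rw [hκ, sub_nonneg]
    gcongr
    linarith
  have hκ1 : κ ≤ 1 := by
    have : 0 ≤ 1 / (p + 1) := by positivity
    rw [hκ]
    linarith
  have hlim := tendsto_integral_of_approx_dominated (μ := volume.restrict Ω)
    (F := fun k z => powerGap p u₀ u (x k) z - κ * |(x k - v) z| ^ (p + 1))
    (A := fun k z => |x k z + u₀ z| ^ (p + 1) + |(x k - v) z| ^ (p + 1))
    (f := powerGap p u₀ u v) (M := B + K * (C + ‖v‖) ^ (p + 1))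
    (fun k => (h.integrable_powerGap_eq _).1.sub ((h.integrable_rpow _).const_mul κ))
    (h.integrable_powerGap_eq v).1
    (fun k => (h.integrable_add_rpow _).add (h.integrable_rpow _))
    (fun k => Eventually.of_forall fun z => by positivity)
    (fun k => by
      rw [integral_add (h.integrable_add_rpow _) (h.integrable_rpow _)]
      refine add_le_add (hB k) ((hS _).trans ?_)
      have : ‖x k - v‖ ≤ C + ‖v‖ := (norm_sub_le _ _).trans (by gcongr; exact hC k)
      gcongr)
    (by
      filter_upwards [hx.ae_tendsto, ae_all_iff.2 fun k => H10.coe_sub (x k) v] with z e1 e2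
      simp only [e2, powerGap]
      have h1 := ((e1.add_const (u₀ z)).abs).rpow_const (p := p) (Or.inr (by linarith))
      have h2 := ((e1.add_const (u₀ z)).abs).rpow_const (p := p + 1) (Or.inr hq.le)
      have h3 := ((e1.sub_const (v z)).abs).rpow_const (p := p + 1) (Or.inr hq.le)
      have h4 := ((((h1.add_const (|u z + u₀ z| ^ p)).const_mul (1 / 2)).mul
        (e1.sub_const (u z))).sub ((h2.sub_const (|u z + u₀ z| ^ (p + 1))).div_const (p + 1))).sub
        (h3.const_mul κ)
      rwa [sub_self, abs_zero, Real.zero_rpow hq.ne', mul_zero, sub_zero] at h4)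
    (fun ε hε => by
      obtain ⟨D₁, hD₁, hb₁⟩ := exists_abs_rpow_add_sub_le (q := p + 1) (by linarith) hε
      obtain ⟨D₂, hD₂, hb₂⟩ := exists_rpow_mul_le hp hε
      refine ⟨fun z => D₁ * |v z + u₀ z| ^ (p + 1) +
        (1 / 2 * ε⁻¹ ^ p + 1 / 2 * D₂ + 1) * |u z + u₀ z| ^ (p + 1),
        ((h.integrable_add_rpow v).const_mul D₁).add ((h.integrable_add_rpow u).const_mul _),
        fun k => ?_⟩
      filter_upwards [H10.coe_sub (x k) v, h.ae_pos hv.above, h.ae_pos (hx.isDom k).above,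
        h.ae_pos_u₀, h.solution.pos] with z e1 e2 e3 e4 e5
      set V := v z + u₀ z with hV
      set X := x k z + u₀ z with hX
      set U := u z + u₀ z with hU
      set r := (x k - v) z with hr
      have hV0 : 0 < V := add_pos e2 e4
      have hX0 : 0 < X := add_pos e3 e4
      have hU0 : 0 < U := add_pos e5 e4
      have h1 := hb₁ r V
      rw [show r + V = X by rw [e1, hV, hX]; ring] at h1
      have h2 := rpow_mul_le_add (p := p) (by linarith) hε hX0.le hU0.le
      have h3 := hb₂ U X hU0.le hX0.le
      have hUq : 0 ≤ U ^ (p + 1) := by positivity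
      have a1 : X ^ (p + 1) = X ^ p * X := Real.rpow_add_one hX0.ne' p
      have a2 : U ^ (p + 1) = U ^ p * U := Real.rpow_add_one hU0.ne' p
      have hXU : 0 ≤ X ^ p * U := by positivity
      have hUX : 0 ≤ U ^ p * X := by positivity
      rw [abs_of_pos hX0, abs_of_pos hV0] at h1
      -- The gap is κ X ^ (p + 1) up to terms containing the fixed U, which Young's inequality makes
      -- ε X ^ (p + 1) plus a multiple of U ^ (p + 1). The difference X ^ (p + 1) - |r| ^ (p + 1) is
      -- of Brezis–Lieb type.
      have h4 : powerGap p u₀ u (x k) z - κ * |r| ^ (p + 1) =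
          κ * (X ^ (p + 1) - |r| ^ (p + 1)) - 1 / 2 * (X ^ p * U) + 1 / 2 * (U ^ p * X) -
            κ * U ^ (p + 1) := by
        rw [powerGap, ← hX, ← hU, abs_of_pos hX0, abs_of_pos hU0, hκ,
          show x k z - u z = X - U by rw [hX, hU]; ring, a1, a2]
        ring
      have h5 : |κ * (X ^ (p + 1) - |r| ^ (p + 1))| ≤ ε * |r| ^ (p + 1) + D₁ * V ^ (p + 1) := by
        rw [abs_mul, abs_of_nonneg hκ0]
        refine le_trans ?_ h1
        exact mul_le_of_le_one_left (abs_nonneg _) hκ1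
      have h6 : κ * U ^ (p + 1) ≤ U ^ (p + 1) := mul_le_of_le_one_left hUq hκ1
      have h7 : 0 ≤ κ * U ^ (p + 1) := by positivity
      have h8 : 0 ≤ ε * X ^ (p + 1) := by positivity
      have h9 : 0 ≤ ε⁻¹ ^ p * U ^ (p + 1) := by positivity
      have h10 : 0 ≤ D₂ * U ^ (p + 1) := by positivity
      obtain ⟨h11, h12⟩ := abs_le.1 h5
      rw [h4, abs_of_pos hX0, abs_of_pos hV0, abs_of_pos hU0, abs_le]
      constructor <;> linarith)
  refine hlim.congr fun k => ?_
  rw [integral_sub (h.integrable_powerGap_eq _).1 ((h.integrable_rpow _).const_mul κ),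
    integral_const_mul]

end Setting

end Grushin

/-! ### Concentration at the critical exponent and the Cerami condition -/

namespace Grushin

variable {n m : ℕ} {γ : ℝ} {Ω : Set (Pt n m)}

namespace Setting

variable {δ lam p : ℝ} {u₀ : Pt n m → ℝ} {u : H10 γ Ω}

/-- B is the mass lost in the weak limit. The first inequality is the limit of the gap inequality,
where the singular gaps and the power gap of v are dropped by their sign. The second is the limit of
the Sobolev inequality for x_k - v, combined with the bound of its norm by the power term. -/
lemma exists_limit_of_concentration (h : Setting δ lam p u₀ u) (hpc : p + 1 = critExp n m γ)
    {c : ℝ} {x β : ℕ → H10 γ Ω} {v : H10 γ Ω} (hx : IsWeakCerami δ lam p u₀ u c x β v) :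
    ∃ (κ : ℕ → ℕ) (B : ℝ), StrictMono κ ∧ 0 ≤ B ∧
      Tendsto (fun k => ∫ z in Ω, |(x (κ k) - v) z| ^ (p + 1)) atTop (𝓝 B) ∧
      lam * (1 / homDim n m γ) * B ≤ c - realEnergy δ lam p u₀ u ∧
      sobolevConst γ Ω * B ^ (2 / (p + 1)) ≤ lam * B := by
  have hq := h.q_pos
  have hQ := one_lt_homDim_sub_one h.one_le_n h.one_le_m h.γ_pos
  have hdiff : 1 / 2 - 1 / (p + 1) = 1 / homDim n m γ := by
    rw [hpc, critExp]
    have : homDim n m γ - 2 ≠ 0 := by linarith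
    have : homDim n m γ ≠ 0 := by linarith
    field_simp
    ring
  obtain ⟨C, hC⟩ := hx.bounded
  obtain ⟨K, hK, hS⟩ := h.exists_integral_rpow_le h.q_pos h.le_critExp
  have hbI : ∀ k, (∫ z in Ω, |(x k - v) z| ^ (p + 1)) ∈ Icc 0 (K * (C + ‖v‖) ^ (p + 1)) := by
    intro k
    refine ⟨integral_nonneg fun z => by positivity, (hS _).trans ?_⟩
    have : ‖x k - v‖ ≤ C + ‖v‖ := (norm_sub_le _ _).trans (by gcongr; exact hC k)
    gcongr
  obtain ⟨B, hB, κ, hκ, hlim⟩ := isCompact_Icc.tendsto_subseq hbI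
  have hlim : Tendsto (fun k => ∫ z in Ω, |(x (κ k) - v) z| ^ (p + 1)) atTop (𝓝 B) := hlim
  have hx' := hx.comp hκ
  refine ⟨κ, B, hκ, hB.1, hlim, ?_, ?_⟩
  · have h1 := (((hx'.tendsto_integral_powerGap h).add
      (hlim.const_mul (1 / 2 - 1 / (p + 1)))).const_mul lam).add
      ((hx'.tendsto_inner u).const_mul (1 / 2))
    have h2 := le_of_tendsto_of_tendsto' h1 (hx'.energy.sub_const (realEnergy δ lam p u₀ u))
      fun k => by
        have h3 := h.gap_le (hx'.isDom k) (hx'.mem k)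
        have h4 := integral_nonneg_of_ae (h.ae_singularGap_nonneg (hx'.isDom k).above)
        rw [sub_add_cancel]
        linarith
    have h5 := mul_nonneg h.lam_pos.le
      (integral_nonneg_of_ae (h.ae_powerGap_nonneg (hx.isDom_limit h).above))
    rw [hdiff] at h2
    linarith
  · obtain ⟨o, ho, hxo⟩ := hx'.exists_norm_sub_sq_le h
    have h1 := (((hx'.tendsto_integral_rpow_mul h).add hlim).const_mul lam).add ho
    have h2 := (hlim.rpow_const (p := 2 / (p + 1)) (Or.inr (by positivity))).const_mul
      (sobolevConst γ Ω)
    have h3 := le_of_tendsto_of_tendsto' h2 h1 fun k => by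
      have h4 := sobolevConst_mul_le (by linarith) (x (κ k) - v)
      rw [← hpc] at h4
      rw [sub_add_cancel]
      exact h4.trans (hxo k)
    simpa using h3

/-- The critical case. -/
lemma IsWeakCerami.exists_tendsto_of_critical (h : Setting δ lam p u₀ u)
    (hpc : p + 1 = critExp n m γ) {c : ℝ} (hc : c < realEnergy δ lam p u₀ u +
      sobolevConst γ Ω ^ (homDim n m γ / 2) /
        (homDim n m γ * lam ^ ((homDim n m γ - 2) / 2)))
    {x β : ℕ → H10 γ Ω} {v : H10 γ Ω} (hx : IsWeakCerami δ lam p u₀ u c x β v) :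
    ∃ κ : ℕ → ℕ, StrictMono κ ∧ Tendsto (fun k => x (κ k)) atTop (𝓝 v) := by
  obtain ⟨κ, B, hκ, hB0, hlim, hgap, hsob⟩ := h.exists_limit_of_concentration hpc hx
  have hQ := one_lt_homDim_sub_one h.one_le_n h.one_le_m h.γ_pos
  set Q := homDim n m γ with hQdef
  have hQ0 : 0 < Q := by linarith
  have hlam := h.lam_pos
  set S := sobolevConst γ Ω with hS
  have hS0 : 0 ≤ S := sobolevConst_nonneg
  refine ⟨κ, hκ, ?_⟩
  -- If B > 0, the Sobolev bound can be divided by B and gives B ≥ (S/λ)^(Q/2); then λ B / Q reaches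
  -- the threshold that c - I(u) stays below.
  have hB : B = 0 := by
    by_contra hBne
    have hBpos : 0 < B := lt_of_le_of_ne hB0 (Ne.symm hBne)
    have hexp : 2 / (p + 1) = 1 - 2 / Q := by
      rw [hpc, critExp, ← hQdef]
      have : Q - 2 ≠ 0 := by linarith
      field_simp
    have h1 : S / lam ≤ B ^ (2 / Q) := by
      rw [hexp, Real.rpow_sub hBpos, Real.rpow_one, mul_div_assoc', div_le_iff₀ (by positivity)]
        at hsob
      rw [div_le_iff₀ hlam]
      refine le_of_mul_le_mul_right ?_ hBpos
      linarith
    have h2 : (S / lam) ^ (Q / 2) ≤ B := by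
      refine (Real.rpow_le_rpow (by positivity) h1 (by positivity)).trans_eq ?_
      rw [← Real.rpow_mul hBpos.le, div_mul_div_cancel₀ hQ0.ne', div_self two_ne_zero,
        Real.rpow_one]
    have h3 : S ^ (Q / 2) / (Q * lam ^ ((Q - 2) / 2)) = lam * (1 / Q) * (S / lam) ^ (Q / 2) := by
      rw [Real.div_rpow hS0 hlam.le, show (Q - 2) / 2 = Q / 2 - 1 by ring,
        Real.rpow_sub_one hlam.ne']
      have : lam ^ (Q / 2) ≠ 0 := by positivity
      field_simp
    have h4 : lam * (1 / Q) * (S / lam) ^ (Q / 2) ≤ lam * (1 / Q) * B := by gcongr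
    linarith
  have hx' := hx.comp hκ
  obtain ⟨o, ho, hxo⟩ := hx'.exists_norm_sub_sq_le h
  refine hx'.tendsto_of_sq ?_ hxo
  rw [hB] at hlim
  have h1 := (((hx'.tendsto_integral_rpow_mul h).add hlim).const_mul lam).add ho
  simpa using h1

/-- The slope is an infimum, so subgradients are chosen up to an error 1 / ((k + 1)(1 + ‖w k‖)),
small even after multiplication by the Cerami weight. Finitely many indices, where the
subdifferential may be empty, are dropped. -/
lemma exists_isCerami (h : Setting δ lam p u₀ u) {c : ℝ} {w : ℕ → H10 γ Ω}
    (hw : ∀ k, w k ∈ effDomain (constrainedEnergy δ lam p u₀ (aboveSet u)))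
    (hE : Tendsto (fun k => constrainedEnergy δ lam p u₀ (aboveSet u) (w k)) atTop
      (𝓝 (c : EReal)))
    (hs : Tendsto (fun k => (1 + ‖w k‖ₑ) *
      subdiffNorm (constrainedEnergy δ lam p u₀ (aboveSet u)) (w k)) atTop (𝓝 0)) :
    ∃ (N : ℕ) (α : ℕ → H10 γ Ω), IsCerami δ lam p u₀ u c (fun k => w (k + N)) α := by
  set J := constrainedEnergy δ lam p u₀ (aboveSet u) with hJ
  have hdom : ∀ k, IsDom δ u₀ u (w k) := fun k => h.isDom_of_lt_top (hw k)
  set η : ℕ → ℝ := fun k => 1 / ((k : ℝ) + 1) / (1 + ‖w k‖) with hη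
  have hη0 : ∀ k, 0 < η k := fun k => by positivity
  have hch : ∀ k, ∃ α : H10 γ Ω, subdiffNorm J (w k) < ⊤ →
      α ∈ frechetSubdiff J (w k) ∧ ‖α‖ₑ ≤ subdiffNorm J (w k) + ENNReal.ofReal (η k) := by
    intro k
    by_cases hk : subdiffNorm J (w k) < ⊤
    · have h1 : subdiffNorm J (w k) < subdiffNorm J (w k) + ENNReal.ofReal (η k) :=
        ENNReal.lt_add_right hk.ne (by simpa using hη0 k)
      conv_lhs at h1 => rw [subdiffNorm]
      obtain ⟨α, hα⟩ := iInf_lt_iff.1 h1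
      obtain ⟨hα1, hα2⟩ := iInf_lt_iff.1 hα
      exact ⟨α, fun _ => ⟨hα1, hα2.le⟩⟩
    · exact ⟨0, fun h' => absurd h' hk⟩
  choose α hα using hch
  have hfin : ∀ᶠ k in atTop, subdiffNorm J (w k) < ⊤ := by
    filter_upwards [hs.eventually (gt_mem_nhds one_pos)] with k hk
    refine lt_of_le_of_lt ?_ (hk.trans ENNReal.one_lt_top)
    exact le_mul_of_one_le_left bot_le le_self_add
  obtain ⟨N, hN⟩ := eventually_atTop.1 hfin
  refine ⟨N, fun k => α (k + N), fun k => hdom _, fun k => (hα _ (hN _ (by omega))).1, ?_, ?_⟩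
  · have h1 : ∀ k, J (w k) = (realEnergy δ lam p u₀ (w k) : ℝ) := fun k =>
      h.constrainedEnergy_eq (hdom k)
    simp only [h1, EReal.tendsto_coe] at hE
    exact hE.comp (tendsto_add_atTop_nat N)
  · have hup : Tendsto (fun k => (1 + ‖w k‖ₑ) * subdiffNorm J (w k) +
        ENNReal.ofReal (1 / ((k : ℝ) + 1))) atTop (𝓝 0) := by
      have h1 := ENNReal.tendsto_ofReal (tendsto_one_div_add_atTop_nhds_zero_nat (𝕜 := ℝ))
      rw [ENNReal.ofReal_zero] at h1
      simpa using hs.add h1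
    have hconv : ∀ k, ENNReal.ofReal ((1 + ‖w k‖) * ‖α k‖) = (1 + ‖w k‖ₑ) * ‖α k‖ₑ := fun k => by
      rw [ENNReal.ofReal_mul (by positivity), ENNReal.ofReal_add zero_le_one (norm_nonneg _),
        ENNReal.ofReal_one, ofReal_norm, ofReal_norm]
    have h0 : Tendsto (fun k => ENNReal.ofReal ((1 + ‖w (k + N)‖) * ‖α (k + N)‖)) atTop (𝓝 0) := by
      refine tendsto_of_tendsto_of_tendsto_of_le_of_le tendsto_const_nhds
        (hup.comp (tendsto_add_atTop_nat N)) (fun _ => bot_le) fun k => ?_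
      show ENNReal.ofReal ((1 + ‖w (k + N)‖) * ‖α (k + N)‖) ≤
        (1 + ‖w (k + N)‖ₑ) * subdiffNorm J (w (k + N)) +
          ENNReal.ofReal (1 / (((k + N : ℕ) : ℝ) + 1))
      rw [hconv]
      refine (mul_le_mul_right (hα _ (hN _ (by omega))).2 _).trans ?_
      rw [mul_add]
      refine add_le_add le_rfl ?_
      have h2 : (1 + ‖w (k + N)‖ₑ) = ENNReal.ofReal (1 + ‖w (k + N)‖) := by
        rw [ENNReal.ofReal_add zero_le_one (norm_nonneg _), ENNReal.ofReal_one, ofReal_norm]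
      rw [h2, ← ENNReal.ofReal_mul (by positivity), hη]
      refine ENNReal.ofReal_le_ofReal (le_of_eq ?_)
      have : (1 + ‖w (k + N)‖) ≠ 0 := by positivity
      field_simp
    have h3 := (ENNReal.tendsto_toReal ENNReal.zero_ne_top).comp h0
    refine h3.congr fun k => ?_
    exact ENNReal.toReal_ofReal (by positivity)

lemma ceramiCondition (h : Setting δ lam p u₀ u) {c : ℝ}
    (hc : p + 1 = critExp n m γ → c < realEnergy δ lam p u₀ u +
      sobolevConst γ Ω ^ (homDim n m γ / 2) /
        (homDim n m γ * lam ^ ((homDim n m γ - 2) / 2))) :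
    CeramiCondition (constrainedEnergy δ lam p u₀ (aboveSet u)) c := by
  refine ⟨h.isProper, h.lowerSemicontinuous, fun w hw hE hs => ?_⟩
  obtain ⟨N, α, hα⟩ := h.exists_isCerami hw hE hs
  obtain ⟨κ, v, hκ, hx⟩ := hα.exists_isWeakCerami h
  have hκN : StrictMono fun k => κ k + N := fun i j hij => Nat.add_lt_add_right (hκ hij) N
  rcases h.le_critExp.lt_or_eq with hlt | heq
  · exact ⟨v, fun k => κ k + N, hκN, hx.tendsto_of_subcritical h hlt⟩
  · obtain ⟨ι, hι, hlim⟩ := hx.exists_tendsto_of_critical h heq (hc heq)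
    exact ⟨v, fun k => κ (ι k) + N, hκN.comp hι, hlim⟩

end Setting

end Grushin

/-! ### The main theorem -/

theorem mainTheorem7 (n m : ℕ) (hn : 1 ≤ n) (hm : 1 ≤ m) (γ δ lam p : ℝ)
    (hγ : 0 < γ) (hδ : 0 < δ) (hlam : 0 < lam) (hp : 1 ≤ p)
    (Ω : Set (Grushin.Pt n m)) (hΩo : IsOpen Ω) (hΩc : IsConnected Ω)
    (hΩb : Bornology.IsBounded Ω)
    (u₀ : Grushin.Pt n m → ℝ) (hu₀ : Grushin.IsSingularSolution γ δ Ω u₀)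
    (u : Grushin.H10 γ Ω) (hu : Grushin.IsPositiveWeakSolution δ lam p u₀ u) :
    (p < Grushin.critExp n m γ - 1 → ∀ c : ℝ,
      Grushin.CeramiCondition
        (Grushin.constrainedEnergy δ lam p u₀ (Grushin.aboveSet u)) c) ∧
    (p = Grushin.critExp n m γ - 1 → ∀ c : ℝ,
      (c : EReal) < Grushin.constrainedEnergy δ lam p u₀ (Grushin.aboveSet u) u +
        ((Grushin.sobolevConst γ Ω ^ (Grushin.homDim n m γ / 2) /
          (Grushin.homDim n m γ * lam ^ ((Grushin.homDim n m γ - 2) / 2)) : ℝ) : EReal) →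
      Grushin.CeramiCondition
        (Grushin.constrainedEnergy δ lam p u₀ (Grushin.aboveSet u)) c) := by
  refine ⟨fun hpc c => ?_, fun hpc c hc => ?_⟩
  · have h : Grushin.Setting δ lam p u₀ u :=
      ⟨hn, hm, hγ, hδ, hlam, hp, by linarith, hΩo, hΩb, hu₀, hu⟩
    exact h.ceramiCondition fun h' => absurd h' (by linarith)
  · have h : Grushin.Setting δ lam p u₀ u :=
      ⟨hn, hm, hγ, hδ, hlam, hp, by linarith, hΩo, hΩb, hu₀, hu⟩
    rw [h.constrainedEnergy_eq h.isDom_self, ← EReal.coe_add, EReal.coe_lt_coe_iff] at hc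
    exact h.ceramiCondition fun _ => hc
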